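/- Let $\eta<\xi$ be real numbers, $0<\theta<1$, and let $f:[\eta,\xi]\to\mathbb R$ be twice continuously differentiable with $f''$ bounded away from $0$ on $[\eta,\xi]$ and $f''\in\mathrm{Lip}_\theta([\eta,\xi])$, i.e. $|f''(x)-f''(y)|\le L|x-y|^\theta$ for some $L$ and all $x,y\in[\eta,\xi]$. Write $\|x\|=\min_{m\in\mathbb Z}|x-m|$, and for real $Q\ge 1$ and $0<\delta<1/2$ put $$N(Q,\delta)=\#\{(a,q)\in\mathbb Z\times\mathbb N:\ 1\le q\le Q,\ \eta q<a\le \xi q,\ \|q f(a/q)\|<\delta\}$$ (the pairs $(a,q)$ need not be coprime) and $F(Q,\delta)=N(Q,\delta)-(\xi-\eta)\delta Q^2$. Let $$X(Q)=Q^{\frac{1-2\theta}{2-\theta}}(\log Q)^{-\frac{5-\theta}{2-\theta}} .$$ Then for every $\varepsilon>0$ and every $c>0$ there is a constant $C>0$, depending only on $\eta,\xi,f,\theta,\varepsilon,c$, such that for all real $Q\ge1$ and all $\delta$ with $Q^{-\frac{1+\theta}{3-\theta}+\varepsilon}\le\delta<\frac12$, $$|F(Q,\delta)|\le C\,\delta^{2/3}Q^{5/3}(\log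 Q)^{2/3}\quad\text{if }\delta\ge c\,X(Q),$$ $$|F(Q,\delta)|\le C\,\delta^{\frac{2}{5-\theta}}Q^{\frac{3(3-\theta)}{5-\theta}}\quad\text{if }\delta\le c\,X(Q).$$ -/

import Mathlib

namespace RatNearCurve

/-- `‖x‖`, the distance from `x` to the nearest integer. -/
noncomputable def distInt (x : ℝ) : ℝ := |x - round x|

/-- `distInt x` is the minimum of `|x - m|` over the integers `m`. -/
theorem distInt_isLeast (x : ℝ) :
    IsLeast (Set.range fun m : ℤ => |x - (m : ℝ)|) (distInt x) := by
  refine ⟨⟨round x, rfl⟩, ?_⟩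
  rintro _ ⟨m, rfl⟩
  exact round_le x m

/-- The second derivative of `f` on the interval `[η, ξ]` (one-sided at the endpoints). -/
noncomputable def secondDeriv (f : ℝ → ℝ) (η ξ : ℝ) : ℝ → ℝ :=
  iteratedDerivWithin 2 f (Set.Icc η ξ)

/-- `g ∈ Lip_θ(S)`. -/
def LipClass (θ : ℝ) (g : ℝ → ℝ) (S : Set ℝ) : Prop :=
  ∃ L : ℝ, ∀ x ∈ S, ∀ y ∈ S, |g x - g y| ≤ L * |x - y| ^ θ

/-- The pairs `(a, q)` with `1 ≤ q ≤ Q`, `η q < a ≤ ξ q` and `‖q f(a/q)‖ < δ`.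
Fractions need not be in lowest terms. -/
def nearPairs (f : ℝ → ℝ) (η ξ Q δ : ℝ) : Set (ℤ × ℕ) :=
  {p | 1 ≤ p.2 ∧ (p.2 : ℝ) ≤ Q ∧ η * (p.2 : ℝ) < (p.1 : ℝ) ∧ (p.1 : ℝ) ≤ ξ * (p.2 : ℝ) ∧
    distInt ((p.2 : ℝ) * f ((p.1 : ℝ) / (p.2 : ℝ))) < δ}

theorem nearPairs_finite (f : ℝ → ℝ) (η ξ Q δ : ℝ) : (nearPairs f η ξ Q δ).Finite := by
  have h : (⋃ q ∈ Set.Iic ⌊Q⌋₊,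
      (fun a : ℤ => (a, q)) '' Set.Icc ⌊η * (q : ℝ)⌋ ⌊ξ * (q : ℝ)⌋).Finite :=
    (Set.finite_Iic _).biUnion fun q _ => (Set.finite_Icc _ _).image _
  refine h.subset ?_
  rintro ⟨a, q⟩ ⟨-, h2, h3, h4, -⟩
  simp only [Set.mem_iUnion]
  refine ⟨q, Nat.le_floor h2, a, ⟨?_, Int.le_floor.2 h4⟩, rfl⟩
  exact_mod_cast (Int.floor_le (η * (q : ℝ))).trans h3.le

/-- The counting function `N(Q, δ)`. -/
noncomputable def count (f : ℝ → ℝ) (η ξ Q δ : ℝ) : ℕ := (nearPairs f η ξ Q δ).ncard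

/-- The error term `F(Q, δ) = N(Q, δ) - (ξ - η) δ Q²`. -/
noncomputable def errorTerm (f : ℝ → ℝ) (η ξ Q δ : ℝ) : ℝ :=
  (count f η ξ Q δ : ℝ) - (ξ - η) * δ * Q ^ 2

/-- `Q^((1-2θ)/(2-θ)) (log Q)^(-(5-θ)/(2-θ))`, where the two ranges of `δ` meet. -/
noncomputable def threshold (θ Q : ℝ) : ℝ :=
  Q ^ ((1 - 2 * θ) / (2 - θ)) * Real.log Q ^ (-((5 - θ) / (2 - θ)))

end RatNearCurve

/-! The error term obeys one bound, O(Q^(3/2+ε) δ^(1/2)), as soon as δQ ≥ 1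
(`exists_abs_errorTerm_le`). In the stated range δQ exceeds a fixed positive power of Q, which
absorbs Q^ε, and this bound then implies both claims.

A counted pair is an integer point (q, a, l) near the cone l = q f(a/q). For q in (Q/2, Q] and a/q
in an interval of length A/Q with A² = δQ, the tangent line follows the curve to within O(δ/Q), so
the region is comparable to a parallelepiped of volume A³. The coordinates of a `Frame` turn it into
a cube and ℤ³ into a lattice; the dual lattice comes from a frame of the same kind on the Legendre
transform of the curve (`frame_dual`). Let v and w be shortest vectors of the two lattices. If w is
long, the covering radius is O(1/|w|) (`exists_int_near`), and comparing the count with volumes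
costs O(A³/|w|). If w is short, the points lie in few planes and are counted directly. Either way
the error in a cell is O(1 + 1/|v| + A³/|w|) (`exists_abs_card_sub_le`).

To sum this over cells, note that a short v is a rational point of small height near the curve
(`near_of_nrm_le`), and a short w is one near the dual curve. So the sums reduce to counting
rational points within O(1/q²) of a curve, for which `exists_countBound` gives O(Q^(1+ε)). That
bound comes from the same analysis with A = 1, where upper bounds suffice: height Q is reduced to
heights at most rQ on the curve and its dual, and an induction over all Legendre pairs at once
closes because r^ε beats the constants. -/

namespace RatNearCurve

/-! ### Pairing and exterior product in dimension three -/

/-- The bilinear form `x₀y₂ - x₁y₁ + x₂y₀`. -/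
def pair {R : Type*} [CommRing R] (x y : Fin 3 → R) : R := x 0 * y 2 - x 1 * y 1 + x 2 * y 0

/-- The vector of `2 × 2` minors of a pair of vectors. -/
def wedge {R : Type*} [CommRing R] (x y : Fin 3 → R) : Fin 3 → R :=
  ![x 0 * y 1 - x 1 * y 0, x 0 * y 2 - x 2 * y 0, x 1 * y 2 - x 2 * y 1]

/-- The real vector with the given integer coordinates. -/
def toReal (x : Fin 3 → ℤ) : Fin 3 → ℝ := fun i => (x i : ℝ)

@[simp] theorem toReal_apply (x : Fin 3 → ℤ) (i : Fin 3) : toReal x i = (x i : ℝ) := rfl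

theorem toReal_sub (x y : Fin 3 → ℤ) : toReal (x - y) = toReal x - toReal y := by
  ext i; simp

theorem toReal_add (x y : Fin 3 → ℤ) : toReal (x + y) = toReal x + toReal y := by
  ext i; simp

theorem toReal_smul (n : ℤ) (x : Fin 3 → ℤ) : toReal (n • x) = (n : ℝ) • toReal x := by
  ext i; simp

theorem toReal_neg (x : Fin 3 → ℤ) : toReal (-x) = -toReal x := by
  ext i; simp

theorem toReal_injective : Function.Injective toReal := by
  intro x y h
  ext i
  have := congrFun h i
  simpa using this

theorem toReal_eq_zero {x : Fin 3 → ℤ} : toReal x = 0 ↔ x = 0 := by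
  constructor
  · intro h
    apply toReal_injective
    rw [h]; ext i; simp
  · rintro rfl; ext i; simp

theorem toReal_wedge (x y : Fin 3 → ℤ) : toReal (wedge x y) = wedge (toReal x) (toReal y) := by
  ext i; fin_cases i <;> simp [wedge]

theorem cast_pair (x y : Fin 3 → ℤ) : ((pair x y : ℤ) : ℝ) = pair (toReal x) (toReal y) := by
  simp [pair]

theorem abs_pair_le (x y : Fin 3 → ℝ) : |pair x y| ≤ 3 * (‖x‖ * ‖y‖) := by
  have hx := fun i => norm_le_pi_norm x i
  have hy := fun i => norm_le_pi_norm y i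
  have h : ∀ i j, |x i * y j| ≤ ‖x‖ * ‖y‖ := fun i j => by
    rw [abs_mul]; exact mul_le_mul (hx i) (hy j) (abs_nonneg _) (norm_nonneg _)
  unfold pair
  have h1 := abs_le.1 (h 0 2)
  have h2 := abs_le.1 (h 1 1)
  have h3 := abs_le.1 (h 2 0)
  rw [abs_le]; constructor <;> linarith

theorem norm_wedge_le (x y : Fin 3 → ℝ) : ‖wedge x y‖ ≤ 2 * (‖x‖ * ‖y‖) := by
  have hx := fun i => norm_le_pi_norm x i
  have hy := fun i => norm_le_pi_norm y i
  have h : ∀ i j, |x i * y j| ≤ ‖x‖ * ‖y‖ := fun i j => by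
    rw [abs_mul]; exact mul_le_mul (hx i) (hy j) (abs_nonneg _) (norm_nonneg _)
  have h' : ∀ i j k l, |x i * y j - x k * y l| ≤ 2 * (‖x‖ * ‖y‖) := fun i j k l => by
    have h1 := abs_le.1 (h i j)
    have h2 := abs_le.1 (h k l)
    rw [abs_le]; constructor <;> linarith
  rw [pi_norm_le_iff_of_nonneg (by positivity)]
  intro i
  fin_cases i
  · exact h' _ _ _ _
  · exact h' _ _ _ _
  · exact h' _ _ _ _

theorem exists_norm_eq (x : Fin 3 → ℝ) : ∃ i, |x i| = ‖x‖ := by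
  obtain ⟨i, hi⟩ := Finite.exists_max fun i => |x i|
  refine ⟨i, le_antisymm (norm_le_pi_norm x i) ?_⟩
  rw [pi_norm_le_iff_of_nonneg (abs_nonneg _)]
  exact hi

/-- If `x ∧ y = 0` and `x ≠ 0` then `y` is a multiple of `x`. -/
theorem exists_smul_of_wedge_eq_zero {x y : Fin 3 → ℝ} (hx : x ≠ 0) (h : wedge x y = 0) :
    ∃ c : ℝ, y = c • x := by
  have h0 := congrFun h 0
  have h1 := congrFun h 1
  have h2 := congrFun h 2
  simp [wedge] at h0 h1 h2
  obtain ⟨i, hi⟩ : ∃ i, x i ≠ 0 := by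
    by_contra hc; push Not at hc; exact hx (funext hc)
  refine ⟨y i / x i, ?_⟩
  ext j
  fin_cases i <;> fin_cases j <;> simp at hi ⊢ <;> field_simp <;> linarith

/-- A vector orthogonal to a nonzero `x ∧ y` lies in the span of `x` and `y`. -/
theorem exists_combination {x y z : Fin 3 → ℝ} (hw : wedge x y ≠ 0)
    (hz : pair z (wedge x y) = 0) : ∃ a b : ℝ, z = a • x + b • y := by
  simp only [pair, wedge, Matrix.cons_val] at hz
  have hne : ∃ i, wedge x y i ≠ 0 := by
    by_contra hc; push Not at hc; exact hw (funext hc)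
  obtain ⟨i, hi⟩ := hne
  fin_cases i <;> simp [wedge] at hi
  -- Cramer's rule in the two coordinates whose minor does not vanish; the third coordinate is the
  -- orthogonality relation.
  · refine ⟨(z 0 * y 1 - z 1 * y 0) / (x 0 * y 1 - x 1 * y 0),
      (x 0 * z 1 - x 1 * z 0) / (x 0 * y 1 - x 1 * y 0), ?_⟩
    ext j
    fin_cases j <;> simp <;>
      rw [div_mul_eq_mul_div, div_mul_eq_mul_div, ← add_div, eq_div_iff hi] <;>
      first | ring1 | linear_combination hz
  · refine ⟨(z 0 * y 2 - z 2 * y 0) / (x 0 * y 2 - x 2 * y 0),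
      (x 0 * z 2 - x 2 * z 0) / (x 0 * y 2 - x 2 * y 0), ?_⟩
    ext j
    fin_cases j <;> simp <;>
      rw [div_mul_eq_mul_div, div_mul_eq_mul_div, ← add_div, eq_div_iff hi] <;>
      first | ring1 | linear_combination -hz
  · refine ⟨(z 1 * y 2 - z 2 * y 1) / (x 1 * y 2 - x 2 * y 1),
      (x 1 * z 2 - x 2 * z 1) / (x 1 * y 2 - x 2 * y 1), ?_⟩
    ext j
    fin_cases j <;> simp <;>
      rw [div_mul_eq_mul_div, div_mul_eq_mul_div, ← add_div, eq_div_iff hi] <;>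
      first | ring1 | linear_combination hz

/-! ### Affine frames and duality -/

/-- An affine frame at a point of a planar curve: `α` is the abscissa, `γ` the ordinate, `ϖ` the
slope, and `Q`, `A` are the scales. -/
@[ext] structure Frame where
  α : ℝ
  γ : ℝ
  ϖ : ℝ
  Q : ℝ
  A : ℝ
  Q_pos : 0 < Q
  A_pos : 0 < A

namespace Frame

/-- The normalised coordinates `(q / Q, (a - αq) / A, (l - γq - ϖ(a - αq)) Q / A²)`. -/
noncomputable def coords (F : Frame) : (Fin 3 → ℝ) →ₗ[ℝ] (Fin 3 → ℝ) :=
  Matrix.toLin' !![1 / F.Q, 0, 0; -F.α / F.A, 1 / F.A, 0;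
    (F.α * F.ϖ - F.γ) * F.Q / F.A ^ 2, -F.ϖ * F.Q / F.A ^ 2, F.Q / F.A ^ 2]

variable (F : Frame)

theorem coords_zero (x : Fin 3 → ℝ) : F.coords x 0 = x 0 / F.Q := by
  simp [coords, Matrix.mulVec, dotProduct, Fin.sum_univ_three]; ring

theorem coords_one (x : Fin 3 → ℝ) : F.coords x 1 = (x 1 - F.α * x 0) / F.A := by
  simp [coords, Matrix.mulVec, dotProduct, Fin.sum_univ_three]; ring

theorem coords_two (x : Fin 3 → ℝ) :
    F.coords x 2 = (x 2 - F.γ * x 0 - F.ϖ * (x 1 - F.α * x 0)) * F.Q / F.A ^ 2 := by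
  simp [coords, Matrix.mulVec, dotProduct, Fin.sum_univ_three]; ring

theorem det_coords : LinearMap.det F.coords = 1 / F.A ^ 3 := by
  have := F.Q_pos.ne'
  have := F.A_pos.ne'
  rw [coords, LinearMap.det_toLin', Matrix.det_fin_three]
  simp
  field_simp

/-- The dual frame. -/
noncomputable def dual : Frame where
  α := F.ϖ
  γ := F.α * F.ϖ - F.γ
  ϖ := F.α
  Q := F.Q / F.A ^ 2
  A := 1 / F.A
  Q_pos := div_pos F.Q_pos (pow_pos F.A_pos 2)
  A_pos := one_div_pos.2 F.A_pos

/-- This identity dictates the data of `dual`: the contragredient of a frame has the shape of a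
frame again, so every lemma on frames also applies to the dual lattice. -/
theorem pair_coords (x y : Fin 3 → ℝ) : pair (F.coords x) (F.dual.coords y) = pair x y := by
  have := F.Q_pos.ne'
  have := F.A_pos.ne'
  simp only [pair, coords_zero, coords_one, coords_two, dual]
  field_simp
  ring

/-- Minors transform by the cofactor matrix, which is the determinant `A⁻³` times the
contragredient. -/
theorem coords_wedge (x y : Fin 3 → ℝ) :
    F.dual.coords (wedge x y) = F.A ^ 3 • wedge (F.coords x) (F.coords y) := by
  have := F.Q_pos.ne'
  have := F.A_pos.ne'
  ext i
  fin_cases i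
  · simp [wedge, coords_zero, coords_one, coords_two, dual]
    field_simp
    ring
  · simp [wedge, coords_zero, coords_one, coords_two, dual]
    field_simp
    ring
  · simp [wedge, coords_zero, coords_one, coords_two, dual]
    field_simp
    ring

theorem coords_injective : Function.Injective F.coords := by
  have hQ := F.Q_pos.ne'
  have hA := F.A_pos.ne'
  rw [injective_iff_map_eq_zero]
  intro x hx
  have h0 := congrFun hx 0
  have h1 := congrFun hx 1
  have h2 := congrFun hx 2
  rw [coords_zero] at h0
  rw [coords_one] at h1
  rw [coords_two] at h2
  simp [hQ, hA] at h0 h1 h2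
  rw [h0] at h1 h2
  simp at h1 h2
  rw [h1] at h2
  simp at h2
  ext i
  fin_cases i
  · exact h0
  · exact h1
  · exact h2

/-- The norm of an integer vector in the frame. -/
noncomputable def nrm (x : Fin 3 → ℤ) : ℝ := ‖F.coords (toReal x)‖

theorem nrm_nonneg (x : Fin 3 → ℤ) : 0 ≤ F.nrm x := norm_nonneg _

theorem nrm_pos {x : Fin 3 → ℤ} (hx : x ≠ 0) : 0 < F.nrm x := by
  rw [nrm, norm_pos_iff]
  intro h
  exact hx (toReal_eq_zero.1 (F.coords_injective (by rw [h, map_zero])))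

theorem nrm_neg (x : Fin 3 → ℤ) : F.nrm (-x) = F.nrm x := by
  rw [nrm, toReal_neg, map_neg, norm_neg, nrm]

theorem nrm_sub_le (x y : Fin 3 → ℤ) : F.nrm (x - y) ≤ F.nrm x + F.nrm y := by
  rw [nrm, toReal_sub, map_sub]; exact norm_sub_le _ _

theorem nrm_wedge_le (x y : Fin 3 → ℤ) :
    F.dual.nrm (wedge x y) ≤ 2 * F.A ^ 3 * (F.nrm x * F.nrm y) := by
  rw [nrm, toReal_wedge, coords_wedge, norm_smul, Real.norm_of_nonneg (pow_pos F.A_pos 3).le]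
  have := norm_wedge_le (F.coords (toReal x)) (F.coords (toReal y))
  have hA := pow_pos F.A_pos 3
  rw [nrm, nrm]
  nlinarith

theorem abs_pair_le_nrm (x y : Fin 3 → ℤ) :
    |((pair x y : ℤ) : ℝ)| ≤ 3 * (F.nrm x * F.dual.nrm y) := by
  rw [cast_pair, ← F.pair_coords]
  exact abs_pair_le _ _

theorem abs_coord_le (x : Fin 3 → ℤ) (i : Fin 3) : |F.coords (toReal x) i| ≤ F.nrm x :=
  norm_le_pi_norm (F.coords (toReal x)) i

theorem finite_nrm_le (r : ℝ) : {x : Fin 3 → ℤ | F.nrm x ≤ r}.Finite := by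
  obtain ⟨B, hB⟩ : ∃ B : ℝ, ∀ x : Fin 3 → ℤ, F.nrm x ≤ r → ∀ i, |(x i : ℝ)| ≤ B := by
    have hinj : LinearMap.ker F.coords = ⊥ := LinearMap.ker_eq_bot.2 F.coords_injective
    obtain ⟨K, -, hK⟩ := F.coords.exists_antilipschitzWith hinj
    refine ⟨K * r, fun x hx i => ?_⟩
    have h1 : ‖toReal x‖ ≤ K * ‖F.coords (toReal x)‖ := by
      have := hK.le_mul_dist (toReal x) 0
      simpa using this
    have h2 : |(x i : ℝ)| ≤ ‖toReal x‖ := norm_le_pi_norm (toReal x) i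
    exact h2.trans (h1.trans (mul_le_mul_of_nonneg_left hx K.2))
  refine (Set.Finite.pi' (t := fun _ : Fin 3 => Set.Icc (-⌈B⌉) ⌈B⌉)
    fun _ => Set.finite_Icc _ _).subset ?_
  intro x hx i
  have := abs_le.1 (hB x hx i)
  have h2 := Int.le_ceil B
  constructor
  · have : (-(⌈B⌉ : ℝ)) ≤ x i := by linarith
    exact_mod_cast this
  · have : (x i : ℝ) ≤ ⌈B⌉ := by linarith
    exact_mod_cast this

theorem exists_min_nrm : ∃ v : Fin 3 → ℤ, v ≠ 0 ∧ ∀ x : Fin 3 → ℤ, x ≠ 0 → F.nrm v ≤ F.nrm x := by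
  have hne : (Pi.single 0 1 : Fin 3 → ℤ) ≠ 0 := by simp
  have hfin : {x : Fin 3 → ℤ | x ≠ 0 ∧ F.nrm x ≤ F.nrm (Pi.single 0 1)}.Finite :=
    (F.finite_nrm_le _).subset fun x hx => hx.2
  obtain ⟨v, hv, hmin⟩ := Set.exists_min_image _ F.nrm hfin ⟨_, hne, le_rfl⟩
  refine ⟨v, hv.1, fun x hx => ?_⟩
  by_cases h : F.nrm x ≤ F.nrm (Pi.single 0 1)
  · exact hmin x ⟨hx, h⟩
  · exact hv.2.trans (not_le.1 h).le

end Frame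

/-! ### Counting lattice points in a box by shortest vectors -/

/-- A set of reals in an interval of length `2L` with gaps at least `s` has at most `1 + 2L/s`
elements. -/
theorem card_le_of_separated {ι : Type*} (S : Finset ι) (φ : ι → ℝ) {c L s : ℝ} (hs : 0 < s)
    (hL : 0 ≤ L) (hφ : ∀ x ∈ S, |φ x - c| ≤ L)
    (hsep : ∀ x ∈ S, ∀ y ∈ S, x ≠ y → s ≤ |φ x - φ y|) :
    (S.card : ℝ) ≤ 1 + 2 * L / s := by
  have hmaps : Set.MapsTo (fun x => ⌊(φ x - c + L) / s⌋) S
      (Finset.Icc (0 : ℤ) ⌊2 * L / s⌋ : Finset ℤ) := by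
    intro x hx
    have h := abs_le.1 (hφ x hx)
    simp only [Finset.coe_Icc, Set.mem_Icc]
    refine ⟨Int.floor_nonneg.2 (div_nonneg (by linarith) hs.le), Int.floor_le_floor ?_⟩
    gcongr; linarith
  have hinj : Set.InjOn (fun x => ⌊(φ x - c + L) / s⌋) (S : Set ι) := by
    intro x hx y hy hxy
    by_contra hne
    have h1 := hsep x hx y hy hne
    have h2 := Int.abs_sub_lt_one_of_floor_eq_floor hxy
    rw [← sub_div, abs_div, abs_of_pos hs, div_lt_one hs] at h2
    have : φ x - c + L - (φ y - c + L) = φ x - φ y := by ring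
    rw [this] at h2
    linarith
  have hcard := Finset.card_le_card_of_injOn _ hmaps hinj
  have h0 : 0 ≤ 2 * L / s := by positivity
  rw [Int.card_Icc] at hcard
  have h3 : ((⌊2 * L / s⌋ + 1 - 0).toNat : ℝ) = (⌊2 * L / s⌋ : ℝ) + 1 := by
    have : 0 ≤ ⌊2 * L / s⌋ := Int.floor_nonneg.2 h0
    have h4 : (((⌊2 * L / s⌋ + 1 - 0).toNat : ℤ)) = ⌊2 * L / s⌋ + 1 := by omega
    exact_mod_cast h4
  calc (S.card : ℝ) ≤ ((⌊2 * L / s⌋ + 1 - 0).toNat : ℝ) := by exact_mod_cast hcard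
    _ = (⌊2 * L / s⌋ : ℝ) + 1 := h3
    _ ≤ 1 + 2 * L / s := by linarith [Int.floor_le (2 * L / s)]


theorem card_le_mul_card_image_of_fiber_le {ι κ : Type*} [DecidableEq κ] (S : Finset ι) (f : ι → κ)
    {c : ℝ} (h : ∀ b ∈ S.image f, ((S.filter fun x => f x = b).card : ℝ) ≤ c) :
    (S.card : ℝ) ≤ c * ((S.image f).card : ℝ) := by
  rw [Finset.card_eq_sum_card_image f S]
  push_cast
  calc ∑ b ∈ S.image f, ((S.filter fun x => f x = b).card : ℝ) ≤ ∑ b ∈ S.image f, c :=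
        Finset.sum_le_sum h
    _ = c * ((S.image f).card : ℝ) := by rw [Finset.sum_const, nsmul_eq_mul, mul_comm]

theorem wedge_sub {R : Type*} [CommRing R] (x y z : Fin 3 → R) :
    wedge x (y - z) = wedge x y - wedge x z := by
  ext i; fin_cases i <;> simp [wedge] <;> ring

theorem pair_sub {R : Type*} [CommRing R] (x y w : Fin 3 → R) :
    pair (x - y) w = pair x w - pair y w := by
  simp [pair]; ring

/-- In dimension three the orthogonal complement of `w` is a plane, so the cross product of two of
its vectors is parallel to `w`. -/
theorem wedge_wedge_eq_zero {R : Type*} [CommRing R] {a b w : Fin 3 → R} (ha : pair a w = 0)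
    (hb : pair b w = 0) : wedge w (wedge a b) = 0 := by
  simp only [pair] at ha hb
  ext i
  fin_cases i <;> simp [wedge]
  · linear_combination a 0 * hb - b 0 * ha
  · linear_combination a 1 * hb - b 1 * ha
  · linear_combination a 2 * hb - b 2 * ha

namespace Frame

variable (F : Frame)

/-- If `y` is an integer vector parallel to `v`, then its norm can be read off the coordinate in
which `v` is largest. -/
theorem nrm_eq_abs_coord {v y : Fin 3 → ℤ} (hv : v ≠ 0) (h : wedge v y = 0) {i : Fin 3}
    (hi : |F.coords (toReal v) i| = F.nrm v) : F.nrm y = |F.coords (toReal y) i| := by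
  have hv' : toReal v ≠ 0 := fun h => hv (toReal_eq_zero.1 h)
  have hw : wedge (toReal v) (toReal y) = 0 := by
    rw [← toReal_wedge, h]; ext i; simp
  obtain ⟨c, hc⟩ := exists_smul_of_wedge_eq_zero hv' hw
  rw [nrm, hc, map_smul, norm_smul, Pi.smul_apply, smul_eq_mul, abs_mul, hi]
  rfl

theorem card_le_of_collinear (S : Finset (Fin 3 → ℤ)) {ρ : ℝ} (hρ : 0 ≤ ρ)
    (hS : ∀ x ∈ S, F.nrm x ≤ ρ) {v : Fin 3 → ℤ} (hv : v ≠ 0)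
    (hpar : ∀ x ∈ S, ∀ y ∈ S, wedge v (x - y) = 0) {s : ℝ} (hs : 0 < s)
    (hmin : ∀ x ∈ S, ∀ y ∈ S, x ≠ y → s ≤ F.nrm (x - y)) :
    (S.card : ℝ) ≤ 1 + 2 * ρ / s := by
  obtain ⟨i, hi⟩ := exists_norm_eq (F.coords (toReal v))
  refine card_le_of_separated S (fun x => F.coords (toReal x) i) (c := 0) hs hρ ?_ ?_
  · intro x hx
    rw [sub_zero]
    exact (F.abs_coord_le x i).trans (hS x hx)
  · intro x hx y hy hne
    have h := hmin x hx y hy hne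
    rw [F.nrm_eq_abs_coord hv (hpar x hx y hy) hi, toReal_sub, map_sub] at h
    exact h

/-- Counting lattice points in a plane with shortest possible normal vector. -/
theorem card_le_of_coplanar (S : Finset (Fin 3 → ℤ)) {ρ : ℝ} (hρ : 0 ≤ ρ)
    (hS : ∀ x ∈ S, F.nrm x ≤ ρ) {w : Fin 3 → ℤ} (hw : w ≠ 0)
    (hmin : ∀ y : Fin 3 → ℤ, y ≠ 0 → F.dual.nrm w ≤ F.dual.nrm y)
    (hplane : ∀ x ∈ S, ∀ y ∈ S, pair (x - y) w = 0) {s : ℝ} (hs : 0 < s)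
    (hsv : ∀ v : Fin 3 → ℤ, v ≠ 0 → s ≤ F.nrm v) :
    (S.card : ℝ) ≤ 1 + 2 * ρ / s + 16 * ρ ^ 2 * F.A ^ 3 / F.dual.nrm w := by
  classical
  have hA := pow_pos F.A_pos 3
  have ht := F.dual.nrm_pos hw
  rcases Nat.lt_or_ge 1 S.card with hcard | hcard
  swap
  · have : (S.card : ℝ) ≤ 1 := by exact_mod_cast hcard
    have h1 : 0 ≤ 2 * ρ / s := by positivity
    have h2 : 0 ≤ 16 * ρ ^ 2 * F.A ^ 3 / F.dual.nrm w := by positivity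
    linarith
  have hne : S.offDiag.Nonempty := by
    obtain ⟨a, ha, b, hb, hab⟩ := Finset.one_lt_card.1 hcard
    exact ⟨(a, b), by simp [ha, hb, hab]⟩
  -- `v` is the shortest difference within `S`, so points of `S` on one line parallel to `v` are
  -- `F.nrm v` apart.
  obtain ⟨⟨a, b⟩, hab, hmin'⟩ := Finset.exists_min_image S.offDiag (fun p => F.nrm (p.1 - p.2)) hne
  rw [Finset.mem_offDiag] at hab
  set v := a - b with hvdef
  have hv : v ≠ 0 := sub_ne_zero.2 hab.2.2
  have hvpos := F.nrm_pos hv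
  have hvs := hsv v hv
  have hv2 : F.nrm v ≤ 2 * ρ := by
    have := F.nrm_sub_le a b
    have := hS a hab.1
    have := hS b hab.2.1
    linarith
  have hvw : pair v w = 0 := hplane a hab.1 b hab.2.1
  -- The value of `wedge v` labels the lines parallel to `v`. Differences of labels are parallel to
  -- `w`, hence at least as long as `w` by its minimality.
  have himage : (((S.image (wedge v)).card : ℕ) : ℝ)
      ≤ 1 + 2 * (2 * F.A ^ 3 * (F.nrm v * ρ)) / F.dual.nrm w := by
    obtain ⟨i, hi⟩ := exists_norm_eq (F.dual.coords (toReal w))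
    refine card_le_of_separated _ (fun x => F.dual.coords (toReal x) i) (c := 0) ht
      (by positivity) ?_ ?_
    · intro y hy
      obtain ⟨x, hx, rfl⟩ := Finset.mem_image.1 hy
      rw [sub_zero]
      refine (F.dual.abs_coord_le _ i).trans ((F.nrm_wedge_le v x).trans ?_)
      have := hS x hx
      gcongr
    · intro y hy y' hy' hne
      obtain ⟨x, hx, rfl⟩ := Finset.mem_image.1 hy
      obtain ⟨x', hx', rfl⟩ := Finset.mem_image.1 hy'
      have hpar : wedge w (wedge v (x - x')) = 0 :=
        wedge_wedge_eq_zero hvw (hplane x hx x' hx')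
      have h0 : wedge v (x - x') ≠ 0 := by
        rw [wedge_sub]; exact sub_ne_zero.2 hne
      have h := hmin _ h0
      rw [F.dual.nrm_eq_abs_coord hw hpar hi, wedge_sub, toReal_sub, map_sub] at h
      exact h
  have hfiber : ∀ c ∈ S.image (wedge v),
      ((S.filter fun x => wedge v x = c).card : ℝ) ≤ 1 + 2 * ρ / F.nrm v := by
    intro c _
    refine F.card_le_of_collinear _ hρ (fun x hx => hS x (Finset.mem_filter.1 hx).1) hv ?_ hvpos ?_
    · intro x hx y hy
      rw [wedge_sub, (Finset.mem_filter.1 hx).2, (Finset.mem_filter.1 hy).2, sub_self]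
    · intro x hx y hy hxy
      exact hmin' (x, y) (by
        simp [(Finset.mem_filter.1 hx).1, (Finset.mem_filter.1 hy).1, hxy])
  have h1 := card_le_mul_card_image_of_fiber_le S (wedge v) hfiber
  have h2 : (1 + 2 * ρ / F.nrm v) * ((S.image (wedge v)).card : ℝ)
      ≤ (1 + 2 * ρ / F.nrm v) * (1 + 2 * (2 * F.A ^ 3 * (F.nrm v * ρ)) / F.dual.nrm w) := by
    gcongr
  have h3 : (1 + 2 * ρ / F.nrm v) * (1 + 2 * (2 * F.A ^ 3 * (F.nrm v * ρ)) / F.dual.nrm w)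
      = 1 + 2 * ρ / F.nrm v + 4 * F.A ^ 3 * ρ / F.dual.nrm w * F.nrm v
        + 8 * F.A ^ 3 * ρ ^ 2 / F.dual.nrm w := by
    field_simp; ring
  -- The one term of the product that grows with `F.nrm v` is harmless because `v` is a difference
  -- of points of the box.
  have h4 : 4 * F.A ^ 3 * ρ / F.dual.nrm w * F.nrm v
      ≤ 4 * F.A ^ 3 * ρ / F.dual.nrm w * (2 * ρ) := by gcongr
  have h5 : 2 * ρ / F.nrm v ≤ 2 * ρ / s := by gcongr
  have h6 : 16 * ρ ^ 2 * F.A ^ 3 / F.dual.nrm w = 4 * F.A ^ 3 * ρ / F.dual.nrm w * (2 * ρ)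
      + 8 * F.A ^ 3 * ρ ^ 2 / F.dual.nrm w := by ring
  linarith

/-- The number of lattice points in a box, in terms of the shortest vectors of the lattice and of
the dual lattice, when the latter has a short vector. -/
theorem card_le_of_dual_short {ρ T : ℝ} (hρ : 0 ≤ ρ) (hT : 0 ≤ T) (S : Finset (Fin 3 → ℤ))
    (hS : ∀ x ∈ S, F.nrm x ≤ ρ) {v w : Fin 3 → ℤ} (hv : v ≠ 0)
    (hvmin : ∀ y : Fin 3 → ℤ, y ≠ 0 → F.nrm v ≤ F.nrm y) (hw : w ≠ 0)
    (hmin : ∀ y : Fin 3 → ℤ, y ≠ 0 → F.dual.nrm w ≤ F.dual.nrm y) (hwT : F.dual.nrm w ≤ T) :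
    (S.card : ℝ) ≤ (1 + 6 * ρ * T) * (1 + 2 * ρ + 16 * ρ ^ 2)
      * (1 + 1 / F.nrm v + F.A ^ 3 / F.dual.nrm w) := by
  classical
  have hA := pow_pos F.A_pos 3
  have ht := F.dual.nrm_pos hw
  have hvpos := F.nrm_pos hv
  -- The box is sliced into planes on which `pair x w` is constant; a short `w` makes them few.
  have himage : (((S.image fun x => pair x w).card : ℕ) : ℝ) ≤ 1 + 6 * ρ * T := by
    have := card_le_of_separated (S.image fun x => pair x w) (fun n : ℤ => (n : ℝ)) (c := 0)
      (L := 3 * (ρ * T)) (s := 1) one_pos (by positivity) ?_ ?_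
    · calc _ ≤ _ := this
        _ = _ := by ring
    · intro n hn
      obtain ⟨x, hx, rfl⟩ := Finset.mem_image.1 hn
      rw [sub_zero]
      refine (F.abs_pair_le_nrm x w).trans ?_
      have := hS x hx
      gcongr
    · intro n _ m _ hnm
      have : 1 ≤ |n - m| := Int.one_le_abs (sub_ne_zero.2 hnm)
      exact_mod_cast this
  have hfiber : ∀ c ∈ S.image fun x => pair x w,
      ((S.filter fun x => pair x w = c).card : ℝ)
        ≤ 1 + 2 * ρ / F.nrm v + 16 * ρ ^ 2 * F.A ^ 3 / F.dual.nrm w := by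
    intro c _
    refine F.card_le_of_coplanar _ hρ (fun x hx => hS x (Finset.mem_filter.1 hx).1) hw hmin ?_
      hvpos hvmin
    intro x hx y hy
    rw [pair_sub, (Finset.mem_filter.1 hx).2, (Finset.mem_filter.1 hy).2, sub_self]
  have h1 := card_le_mul_card_image_of_fiber_le S (fun x => pair x w) hfiber
  have h2 : 1 + 2 * ρ / F.nrm v + 16 * ρ ^ 2 * F.A ^ 3 / F.dual.nrm w
      ≤ (1 + 2 * ρ + 16 * ρ ^ 2) * (1 + 1 / F.nrm v + F.A ^ 3 / F.dual.nrm w) := by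
    have e : (1 + 2 * ρ + 16 * ρ ^ 2) * (1 + 1 / F.nrm v + F.A ^ 3 / F.dual.nrm w)
      = (1 + 2 * ρ / F.nrm v + 16 * ρ ^ 2 * F.A ^ 3 / F.dual.nrm w)
        + (2 * ρ + 16 * ρ ^ 2 + (1 + 16 * ρ ^ 2) * (1 / F.nrm v)
          + (1 + 2 * ρ) * (F.A ^ 3 / F.dual.nrm w)) := by ring
    rw [e]
    have : 0 ≤ 2 * ρ + 16 * ρ ^ 2 + (1 + 16 * ρ ^ 2) * (1 / F.nrm v)
          + (1 + 2 * ρ) * (F.A ^ 3 / F.dual.nrm w) := by positivity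
    linarith
  calc (S.card : ℝ) ≤ _ := h1
    _ ≤ ((1 + 2 * ρ + 16 * ρ ^ 2) * (1 + 1 / F.nrm v + F.A ^ 3 / F.dual.nrm w))
        * (1 + 6 * ρ * T) := by gcongr
    _ = _ := by ring

/-- For a frame with `A = 1` without short dual vectors, the number of lattice points in a box is
controlled by the shortest vector. -/
theorem card_le_of_dual_not_short {ρ : ℝ} (hρ : 0 ≤ ρ) (hA : F.A = 1) (S : Finset (Fin 3 → ℤ))
    (hS : ∀ x ∈ S, F.nrm x ≤ ρ) {v : Fin 3 → ℤ} (hv : v ≠ 0)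
    (hvmin : ∀ y : Fin 3 → ℤ, y ≠ 0 → F.nrm v ≤ F.nrm y)
    (hdual : ∀ w : Fin 3 → ℤ, w ≠ 0 → 1 < F.dual.nrm w) :
    (S.card : ℝ) ≤ (1 + 2 * ρ) * (4 * ρ + 2) ^ 3 * (1 + 1 / F.nrm v) := by
  classical
  have hvpos := F.nrm_pos hv
  set f : (Fin 3 → ℤ) → Fin 3 → ℤ := fun x i => ⌊2 * F.coords (toReal x) i⌋ with hf
  have himage : (((S.image f).card : ℕ) : ℝ) ≤ (4 * ρ + 2) ^ 3 := by
    have hsub : S.image f ⊆ Fintype.piFinset fun _ : Fin 3 => Finset.Icc ⌊-(2 * ρ)⌋ ⌊2 * ρ⌋ := by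
      intro y hy
      obtain ⟨x, hx, rfl⟩ := Finset.mem_image.1 hy
      rw [Fintype.mem_piFinset]
      intro i
      have h := abs_le.1 ((F.abs_coord_le x i).trans (hS x hx))
      rw [Finset.mem_Icc]
      exact ⟨Int.floor_le_floor (by linarith), Int.floor_le_floor (by linarith)⟩
    have h1 := Finset.card_le_card hsub
    rw [Fintype.card_piFinset_const, Int.card_Icc] at h1
    have h2 : ((⌊2 * ρ⌋ + 1 - ⌊-(2 * ρ)⌋).toNat : ℝ) ≤ 4 * ρ + 2 := by
      have h3 : 0 ≤ ⌊2 * ρ⌋ + 1 - ⌊-(2 * ρ)⌋ := by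
        have : ⌊-(2 * ρ)⌋ ≤ ⌊2 * ρ⌋ := Int.floor_le_floor (by linarith)
        omega
      have h4 : (((⌊2 * ρ⌋ + 1 - ⌊-(2 * ρ)⌋).toNat : ℤ) : ℝ)
          = (⌊2 * ρ⌋ : ℝ) + 1 - (⌊-(2 * ρ)⌋ : ℝ) := by
        rw [Int.toNat_of_nonneg h3]; push_cast; ring
      have h5 := Int.floor_le (2 * ρ)
      have h6 := Int.lt_floor_add_one (-(2 * ρ))
      have h7 : (((⌊2 * ρ⌋ + 1 - ⌊-(2 * ρ)⌋).toNat : ℤ) : ℝ)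
        = ((⌊2 * ρ⌋ + 1 - ⌊-(2 * ρ)⌋).toNat : ℝ) := by push_cast; rfl
      rw [← h7, h4]; linarith
    calc (((S.image f).card : ℕ) : ℝ) ≤ (((⌊2 * ρ⌋ + 1 - ⌊-(2 * ρ)⌋).toNat ^ 3 : ℕ) : ℝ) := by
          exact_mod_cast h1
      _ ≤ _ := by push_cast; gcongr
  have hfiber : ∀ c ∈ S.image f, ((S.filter fun x => f x = c).card : ℝ) ≤ 1 + 2 * ρ / F.nrm v := by
    intro c _
    -- In a cube of side 1/2 two differences have a wedge of dual norm at most 2 · (1/2)² < 1, which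
    -- must vanish: the points of one cube are collinear.
    have hclose : ∀ x ∈ S.filter (fun x => f x = c), ∀ y ∈ S.filter (fun x => f x = c),
        F.nrm (x - y) ≤ 1 / 2 := by
      intro x hx y hy
      rw [nrm, pi_norm_le_iff_of_nonneg (by norm_num)]
      intro i
      have h1 : f x i = f y i := by
        rw [(Finset.mem_filter.1 hx).2, (Finset.mem_filter.1 hy).2]
      have h2 := (Int.abs_sub_lt_one_of_floor_eq_floor h1).le
      rw [← mul_sub, abs_mul, abs_of_pos (two_pos : (0 : ℝ) < 2)] at h2
      rw [toReal_sub, map_sub, Pi.sub_apply, Real.norm_eq_abs]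
      linarith
    rcases Nat.lt_or_ge 1 (S.filter fun x => f x = c).card with hcard | hcard
    · obtain ⟨a, ha, b, hb, hab⟩ := Finset.one_lt_card.1 hcard
      refine F.card_le_of_collinear _ hρ (fun x hx => hS x (Finset.mem_filter.1 hx).1)
        (sub_ne_zero.2 hab) ?_ hvpos fun x _ y _ hxy => hvmin _ (sub_ne_zero.2 hxy)
      intro x hx y hy
      by_contra hne
      have h1 := hdual _ hne
      have h2 := F.nrm_wedge_le (a - b) (x - y)
      have h3 := hclose a ha b hb
      have h4 := hclose x hx y hy
      have h5 : F.nrm (a - b) * F.nrm (x - y) ≤ 1 / 2 * (1 / 2) :=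
        mul_le_mul h3 h4 (F.nrm_nonneg _) (by norm_num)
      rw [hA] at h2
      linarith
    · have h1 : ((S.filter fun x => f x = c).card : ℝ) ≤ 1 := by exact_mod_cast hcard
      have h2 : 0 ≤ 2 * ρ / F.nrm v := by positivity
      linarith
  have h1 := card_le_mul_card_image_of_fiber_le S f hfiber
  have h2 : 1 + 2 * ρ / F.nrm v ≤ (1 + 2 * ρ) * (1 + 1 / F.nrm v) := by
    have : (1 + 2 * ρ) * (1 + 1 / F.nrm v) = 1 + 2 * ρ / F.nrm v + (2 * ρ + 1 / F.nrm v) := by ring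
    have : 0 ≤ 2 * ρ + 1 / F.nrm v := by positivity
    linarith
  calc (S.card : ℝ) ≤ _ := h1
    _ ≤ ((1 + 2 * ρ) * (1 + 1 / F.nrm v)) * (4 * ρ + 2) ^ 3 := by gcongr
    _ = _ := by ring

end Frame

/-! ### Legendre pairs; short vectors as rational points near a curve -/

/-- A pair of functions `g`, `h` on the real line that are Legendre transforms of each other, with
derivatives `p`, `s` that are mutually inverse Lipschitz functions. -/
structure LegendrePair (Λ : ℝ) where
  g : ℝ → ℝ
  p : ℝ → ℝ
  h : ℝ → ℝ
  s : ℝ → ℝ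
  one_le : 1 ≤ Λ
  s_p : ∀ x, s (p x) = x
  p_s : ∀ y, p (s y) = y
  legendre : ∀ x, g x + h (p x) = x * p x
  p_lip : ∀ x y, |p x - p y| ≤ Λ * |x - y|
  s_lip : ∀ x y, |s x - s y| ≤ Λ * |x - y|
  g_taylor : ∀ x y, |g y - g x - p x * (y - x)| ≤ Λ * (y - x) ^ 2
  h_taylor : ∀ x y, |h y - h x - s x * (y - x)| ≤ Λ * (y - x) ^ 2

namespace LegendrePair

variable {Λ : ℝ} (L : LegendrePair Λ)

/-- The dual pair. -/
def swap : LegendrePair Λ where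
  g := L.h
  p := L.s
  h := L.g
  s := L.p
  one_le := L.one_le
  s_p := L.p_s
  p_s := L.s_p
  legendre y := by
    have := L.legendre (L.s y)
    rw [L.p_s] at this
    linarith
  p_lip := L.s_lip
  s_lip := L.p_lip
  g_taylor := L.h_taylor
  h_taylor := L.g_taylor

/-- The frame at the point of the curve with abscissa `x`. -/
def frame (x Q A : ℝ) (hQ : 0 < Q) (hA : 0 < A) : Frame := ⟨x, L.g x, L.p x, Q, A, hQ, hA⟩

/-- The relation x p - g = h(p) says that the dual frame sits on the graph of the Legendre
transform. Short dual vectors are therefore rational points near the dual curve. -/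
theorem frame_dual (x Q A : ℝ) (hQ : 0 < Q) (hA : 0 < A) :
    (L.frame x Q A hQ hA).dual = L.swap.frame (L.p x) (Q / A ^ 2) (1 / A)
      (div_pos hQ (pow_pos hA 2)) (one_div_pos.2 hA) := by
  have := L.legendre x
  ext
  · rfl
  · change x * L.p x - L.g x = L.h (L.p x)
    linarith
  · change x = L.s (L.p x)
    rw [L.s_p]
  · rfl
  · rfl

/-- Integer vectors `(q, a, l)` with `2 ^ e ≤ q < 2 ^ (e + 1)` and `a / q` within `1` of `u`, for
which `l / q` is within a multiple of `4 ^ (-e)` of `g (a / q)`. -/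
def NearPoint (u : ℝ) (e : ℕ) (x : Fin 3 → ℤ) : Prop :=
  (2 : ℝ) ^ e ≤ x 0 ∧ (x 0 : ℝ) < 2 ^ (e + 1) ∧ |(x 1 : ℝ) / x 0 - u| ≤ 1 ∧
    |(x 2 : ℝ) - x 0 * L.g (x 1 / x 0)| ≤ (Λ + 1) / 2 ^ e

/-- The number of near points of height about `2 ^ e` is at most `K (2 ^ e) ^ (1 + ε)`. -/
def CountBound (K ε : ℝ) (e : ℕ) : Prop :=
  ∀ (u : ℝ) (S : Finset (Fin 3 → ℤ)), (∀ x ∈ S, L.NearPoint u e x) →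
    (S.card : ℝ) ≤ K * ((2 : ℝ) ^ e) ^ (1 + ε)

variable {L}

/-- A longer window is cut into unit pieces by the integer part of `a / q - u`, and the bound, being
uniform in the centre, is applied to each. -/
theorem CountBound.card_le_of_window {K ε : ℝ} {e : ℕ} (h : L.CountBound K ε e) {u ℓ : ℝ}
    (hℓ : 0 ≤ ℓ) (S : Finset (Fin 3 → ℤ))
    (hS : ∀ x ∈ S, (2 : ℝ) ^ e ≤ x 0 ∧ (x 0 : ℝ) < 2 ^ (e + 1) ∧ |(x 1 : ℝ) / x 0 - u| ≤ ℓ ∧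
      |(x 2 : ℝ) - x 0 * L.g (x 1 / x 0)| ≤ (Λ + 1) / 2 ^ e) :
    (S.card : ℝ) ≤ K * ((2 : ℝ) ^ e) ^ (1 + ε) * (2 * ℓ + 3) := by
  classical
  set f : (Fin 3 → ℤ) → ℤ := fun x => ⌊(x 1 : ℝ) / x 0 - u⌋
  have himage : (((S.image f).card : ℕ) : ℝ) ≤ 2 * ℓ + 3 := by
    have := card_le_of_separated (S.image f) (fun n : ℤ => (n : ℝ)) (c := 0)
      (L := ℓ + 1) (s := 1) one_pos (by positivity) ?_ ?_
    · linarith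
    · intro n hn
      obtain ⟨x, hx, rfl⟩ := Finset.mem_image.1 hn
      have h1 := abs_le.1 (hS x hx).2.2.1
      have h2 := Int.floor_le ((x 1 : ℝ) / x 0 - u)
      have h3 := Int.lt_floor_add_one ((x 1 : ℝ) / x 0 - u)
      rw [sub_zero, abs_le]
      constructor <;> simp only [f] <;> linarith
    · intro n _ m _ hnm
      have : 1 ≤ |n - m| := Int.one_le_abs (sub_ne_zero.2 hnm)
      exact_mod_cast this
  have hfiber : ∀ c ∈ S.image f,
      ((S.filter fun x => f x = c).card : ℝ) ≤ K * ((2 : ℝ) ^ e) ^ (1 + ε) := by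
    intro c _
    refine h (u + c) _ fun x hx => ?_
    obtain ⟨hxS, rfl⟩ := Finset.mem_filter.1 hx
    obtain ⟨h1, h2, -, h4⟩ := hS x hxS
    refine ⟨h1, h2, ?_, h4⟩
    have h5 := Int.floor_le ((x 1 : ℝ) / x 0 - u)
    have h6 := Int.lt_floor_add_one ((x 1 : ℝ) / x 0 - u)
    rw [abs_le]
    constructor <;> simp only [f] <;> linarith
  have hK : 0 ≤ K * ((2 : ℝ) ^ e) ^ (1 + ε) := by
    have := h 0 ∅ (by simp)
    simpa using this
  exact (card_le_mul_card_image_of_fiber_le S f hfiber).trans (by gcongr)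

/-- A nonzero short integer vector in a frame of the curve is a rational point near the curve. -/
theorem near_of_nrm_le {α Q A r : ℝ} (hQ : 0 < Q) (hA : 0 < A) (hr : 0 ≤ r) (hrA : r * A < 1)
    (hrQ : r * A ^ 2 < Q) {x : Fin 3 → ℤ} (hx0 : 0 ≤ x 0) (hx : x ≠ 0)
    (h : (L.frame α Q A hQ hA).nrm x ≤ r) :
    1 ≤ x 0 ∧ (x 0 : ℝ) ≤ r * Q ∧ |(x 1 : ℝ) / x 0 - α| ≤ r * A / x 0 ∧
      |(x 2 : ℝ) - x 0 * L.g (x 1 / x 0)| ≤ (Λ + 1) / x 0 := by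
  set F := L.frame α Q A hQ hA
  have hc := fun i => (F.abs_coord_le x i).trans h
  have h0 := hc 0
  have h1 := hc 1
  have h2 := hc 2
  rw [F.coords_zero] at h0
  rw [F.coords_one] at h1
  rw [F.coords_two] at h2
  simp only [toReal_apply] at h0 h1 h2
  change |(x 0 : ℝ) / Q| ≤ r at h0
  change |((x 1 : ℝ) - α * x 0) / A| ≤ r at h1
  change |((x 2 : ℝ) - L.g α * x 0 - L.p α * (x 1 - α * x 0)) * Q / A ^ 2| ≤ r at h2
  rw [abs_div, abs_of_pos hQ, div_le_iff₀ hQ] at h0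
  rw [abs_div, abs_of_pos hA, div_le_iff₀ hA] at h1
  rw [mul_div_assoc, abs_mul, abs_of_pos (div_pos hQ (pow_pos hA 2)), ← mul_div_assoc,
    div_le_iff₀ (pow_pos hA 2)] at h2
  -- With `q = 0` the second coordinate forces `|a| < 1`, then the third forces `|l| < 1`, so the
  -- vector would vanish.
  have hpos : 1 ≤ x 0 := by
    by_contra hlt
    have hz : x 0 = 0 := by omega
    rw [hz] at h1 h2
    simp only [Int.cast_zero, mul_zero, sub_zero] at h1 h2
    have hz1 : x 1 = 0 := by
      have : |(x 1 : ℝ)| < 1 := h1.trans_lt hrA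
      have : |x 1| < 1 := by exact_mod_cast this
      exact Int.abs_lt_one_iff.1 this
    rw [hz1] at h2
    simp only [Int.cast_zero, mul_zero, sub_zero] at h2
    have hz2 : x 2 = 0 := by
      have : |(x 2 : ℝ)| * Q < 1 * Q := by linarith
      have : |(x 2 : ℝ)| < 1 := lt_of_mul_lt_mul_right this hQ.le
      have : |x 2| < 1 := by exact_mod_cast this
      exact Int.abs_lt_one_iff.1 this
    apply hx
    ext i
    fin_cases i
    · exact hz
    · exact hz1
    · exact hz2
  have hqpos : (0 : ℝ) < x 0 := by
    have : (1 : ℝ) ≤ x 0 := by exact_mod_cast hpos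
    linarith
  rw [abs_of_pos hqpos] at h0
  have hβ : |(x 1 : ℝ) / x 0 - α| ≤ r * A / x 0 := by
    rw [div_sub' hqpos.ne', abs_div, abs_of_pos hqpos]
    gcongr
    rw [mul_comm]; exact h1
  refine ⟨hpos, h0, hβ, ?_⟩
  have ht := L.g_taylor α ((x 1 : ℝ) / x 0)
  -- The deviation from the tangent is at most `r A² / Q`; since `q ≤ r Q`, its product with `q` is
  -- at most `(r A)² ≤ 1`.
  have h3 : |(x 2 : ℝ) - L.g α * x 0 - L.p α * (x 1 - α * x 0)| ≤ 1 / x 0 := by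
    rw [le_div_iff₀ hqpos]
    calc |(x 2 : ℝ) - L.g α * x 0 - L.p α * (x 1 - α * x 0)| * x 0
        ≤ |(x 2 : ℝ) - L.g α * x 0 - L.p α * (x 1 - α * x 0)| * (r * Q) := by gcongr
      _ = (|(x 2 : ℝ) - L.g α * x 0 - L.p α * (x 1 - α * x 0)| * Q) * r := by ring
      _ ≤ (r * A ^ 2) * r := by gcongr
      _ = (r * A) ^ 2 := by ring
      _ ≤ 1 := pow_le_one₀ (by positivity) hrA.le
  have h4 : Λ * ((x 1 : ℝ) / x 0 - α) ^ 2 * x 0 ≤ Λ / x 0 := by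
    have hΛ : 0 ≤ Λ := by linarith [L.one_le]
    have : ((x 1 : ℝ) / x 0 - α) ^ 2 ≤ (1 / x 0) ^ 2 := by
      rw [← sq_abs]
      refine pow_le_pow_left₀ (abs_nonneg _) (hβ.trans ?_) 2
      gcongr
    calc Λ * ((x 1 : ℝ) / x 0 - α) ^ 2 * x 0 ≤ Λ * (1 / x 0) ^ 2 * x 0 := by gcongr
      _ = Λ / x 0 := by field_simp
  have h5 : (x 2 : ℝ) - x 0 * L.g (x 1 / x 0)
      = ((x 2 : ℝ) - L.g α * x 0 - L.p α * (x 1 - α * x 0))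
        - (L.g (x 1 / x 0) - L.g α - L.p α * ((x 1 : ℝ) / x 0 - α)) * x 0 := by
    field_simp; ring
  rw [h5]
  refine (abs_sub _ _).trans ?_
  rw [abs_mul, abs_of_pos hqpos, add_div]
  have := mul_le_mul_of_nonneg_right ht hqpos.le
  linarith

theorem sum_two_pow_rpow_le {ε y : ℝ} (hε : 0 < ε) (N : ℕ) (hN : (2 : ℝ) ^ N ≤ y) :
    ∑ e ∈ Finset.range (N + 1), ((2 : ℝ) ^ e) ^ ε ≤ (2 : ℝ) ^ ε / ((2 : ℝ) ^ ε - 1) * y ^ ε := by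
  have hb : 1 < (2 : ℝ) ^ ε := Real.one_lt_rpow one_lt_two hε
  have h1 : ∀ e : ℕ, ((2 : ℝ) ^ e) ^ ε = ((2 : ℝ) ^ ε) ^ e := fun e => by
    rw [← Real.rpow_natCast, ← Real.rpow_natCast, ← Real.rpow_mul zero_le_two,
      ← Real.rpow_mul zero_le_two, mul_comm]
  have h2 : ((2 : ℝ) ^ ε) ^ N ≤ y ^ ε := by
    rw [← h1]; exact Real.rpow_le_rpow (by positivity) hN hε.le
  have hb1 : 0 < (2 : ℝ) ^ ε - 1 := by linarith
  simp_rw [h1]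
  rw [geom_sum_eq hb.ne', div_mul_eq_mul_div, div_le_div_iff_of_pos_right hb1, pow_succ]
  nlinarith

/-- The number of frames with a short vector, in a family of frames along a curve with separated
base points. -/
theorem card_frames_le {K ε : ℝ} (hK : 0 ≤ K) (hε : 0 < ε) {ι : Type*} (M : Finset ι) (α : ι → ℝ)
    {u ℓ σ Q A r : ℝ} (hQ : 0 < Q) (hA : 0 < A) (hr : 0 < r) (hrA : r * A < 1)
    (hrQ : r * A ^ 2 < Q) (hℓ : 0 ≤ ℓ) (hα : ∀ m ∈ M, |α m - u| ≤ ℓ) (hσ : 0 < σ) (hσ1 : σ ≤ 1)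
    (hsep : ∀ m ∈ M, ∀ m' ∈ M, m ≠ m' → σ * A / Q ≤ |α m - α m'|)
    (hcount : ∀ e : ℕ, (2 : ℝ) ^ e ≤ r * Q → L.CountBound K ε e)
    (hM : ∀ m ∈ M, ∃ x : Fin 3 → ℤ, x ≠ 0 ∧ (L.frame (α m) Q A hQ hA).nrm x ≤ r) :
    (M.card : ℝ) ≤ 3 / σ * (2 * ℓ + 5) * ((2 : ℝ) ^ ε / ((2 : ℝ) ^ ε - 1)) * K
      * (r * Q) ^ (1 + ε) := by
  classical
  have hb : 1 < (2 : ℝ) ^ ε := Real.one_lt_rpow one_lt_two hε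
  have hb1 : 0 < (2 : ℝ) ^ ε - 1 := by linarith
  have hM' : ∀ m ∈ M, ∃ x : Fin 3 → ℤ, 1 ≤ x 0 ∧ (x 0 : ℝ) ≤ r * Q ∧
      |(x 1 : ℝ) / x 0 - α m| ≤ r * A / x 0 ∧
      |(x 2 : ℝ) - x 0 * L.g (x 1 / x 0)| ≤ (Λ + 1) / x 0 := by
    intro m hm
    obtain ⟨x, hx, hxr⟩ := hM m hm
    rcases le_total 0 (x 0) with h0 | h0
    · exact ⟨x, near_of_nrm_le hQ hA hr.le hrA hrQ h0 hx hxr⟩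
    · refine ⟨-x, near_of_nrm_le hQ hA hr.le hrA hrQ (by simpa using h0) (neg_ne_zero.2 hx) ?_⟩
      rw [Frame.nrm_neg]; exact hxr
  rcases M.eq_empty_or_nonempty with rfl | ⟨m₀, hm₀⟩
  · simp; positivity
  have hrQ1 : 1 ≤ r * Q := by
    obtain ⟨x, h1, h2, -⟩ := hM' m₀ hm₀
    have : (1 : ℝ) ≤ x 0 := by exact_mod_cast h1
    linarith
  choose! X hX1 hX2 hX3 hX4 using hM'
  set N := Nat.log 2 ⌊r * Q⌋₊
  have hN : (2 : ℝ) ^ N ≤ r * Q := by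
    have h1 : 2 ^ N ≤ ⌊r * Q⌋₊ := Nat.pow_log_le_self 2 (Nat.floor_pos.2 hrQ1).ne'
    calc (2 : ℝ) ^ N = ((2 ^ N : ℕ) : ℝ) := by push_cast; rfl
      _ ≤ (⌊r * Q⌋₊ : ℝ) := by exact_mod_cast h1
      _ ≤ r * Q := Nat.floor_le (by positivity)
  set lev : ι → ℕ := fun m => Nat.log 2 (X m 0).toNat
  have hlev : ∀ m ∈ M, (2 : ℝ) ^ lev m ≤ X m 0 ∧ (X m 0 : ℝ) < 2 ^ (lev m + 1) := by
    intro m hm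
    have h1 := hX1 m hm
    have h2 : ((X m 0).toNat : ℤ) = X m 0 := Int.toNat_of_nonneg (by omega)
    have h2' : ((X m 0).toNat : ℝ) = X m 0 := by exact_mod_cast h2
    have h3 : (X m 0).toNat ≠ 0 := by omega
    have h4 := Nat.pow_log_le_self 2 h3
    have h5 := Nat.lt_pow_succ_log_self one_lt_two (X m 0).toNat
    rw [← h2']
    exact ⟨by exact_mod_cast h4, by exact_mod_cast h5⟩
  have hlevN : ∀ m ∈ M, lev m ∈ Finset.range (N + 1) := by
    intro m hm
    rw [Finset.mem_range, Nat.lt_succ_iff]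
    refine Nat.log_mono_right (Nat.le_floor ?_)
    have h1 := hX1 m hm
    have h2 : ((X m 0).toNat : ℤ) = X m 0 := Int.toNat_of_nonneg (by omega)
    have h2' : ((X m 0).toNat : ℝ) = X m 0 := by exact_mod_cast h2
    rw [h2']; exact hX2 m hm
  have hpiece : ∀ e ∈ Finset.range (N + 1), ((M.filter fun m => lev m = e).card : ℝ)
      ≤ 3 / σ * (2 * ℓ + 5) * K * (r * Q) * ((2 : ℝ) ^ e) ^ ε := by
    intro e he
    have he' : (2 : ℝ) ^ e ≤ r * Q := by
      refine le_trans ?_ hN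
      exact pow_le_pow_right₀ one_le_two (Nat.lt_succ_iff.1 (Finset.mem_range.1 he))
    have hcb := hcount e he'
    have hmem : ∀ m ∈ M.filter fun m => lev m = e, m ∈ M ∧ (2 : ℝ) ^ e ≤ X m 0 ∧
        (X m 0 : ℝ) < 2 ^ (e + 1) := by
      intro m hm
      obtain ⟨hmM, rfl⟩ := Finset.mem_filter.1 hm
      exact ⟨hmM, hlev m hmM⟩
    -- Frames sharing the point `x` have base points within `r A / 2 ^ e` of `a / q` and spaced by
    -- `σ A / Q`. The additive 1 of the separation count is absorbed because `2 ^ e ≤ r Q`.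
    have hfiber : ∀ x ∈ (M.filter fun m => lev m = e).image X,
        (((M.filter fun m => lev m = e).filter fun m => X m = x).card : ℝ)
          ≤ 3 / σ * (r * Q) / 2 ^ e := by
      intro x _
      have := card_le_of_separated ((M.filter fun m => lev m = e).filter fun m => X m = x) α
        (c := (x 1 : ℝ) / x 0) (L := r * A / 2 ^ e) (s := σ * A / Q) (by positivity)
        (by positivity) ?_ ?_
      · refine this.trans ?_
        have h1 : 2 * (r * A / 2 ^ e) / (σ * A / Q) = 2 / σ * (r * Q) / 2 ^ e := by
          field_simp
        have h2 : 1 ≤ 1 / σ * (r * Q) / 2 ^ e := by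
          rw [le_div_iff₀ (by positivity), one_mul]
          refine he'.trans (le_mul_of_one_le_left (by positivity) ?_)
          rw [le_div_iff₀ hσ]; linarith
        have h3 : 3 / σ * (r * Q) / 2 ^ e = 1 / σ * (r * Q) / 2 ^ e + 2 / σ * (r * Q) / 2 ^ e := by
          ring
        rw [h1, h3]; linarith
      · intro m hm
        obtain ⟨hme, rfl⟩ := Finset.mem_filter.1 hm
        obtain ⟨hmM, h1, h2⟩ := hmem m hme
        rw [abs_sub_comm]
        refine (hX3 m hmM).trans ?_
        gcongr
      · intro m hm m' hm' hne
        exact hsep m (hmem m (Finset.mem_filter.1 hm).1).1 m'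
          (hmem m' (Finset.mem_filter.1 hm').1).1 hne
    -- The window grows from `ℓ` to `ℓ + 1` because `a / q` is within `r A / q ≤ 1` of the base
    -- point.
    have himage : ((((M.filter fun m => lev m = e).image X).card : ℕ) : ℝ)
        ≤ K * ((2 : ℝ) ^ e) ^ (1 + ε) * (2 * (ℓ + 1) + 3) := by
      refine hcb.card_le_of_window (u := u) (by positivity) _ ?_
      intro x hx
      obtain ⟨m, hm, rfl⟩ := Finset.mem_image.1 hx
      obtain ⟨hm, h1, h2⟩ := hmem m hm
      have hq : (1 : ℝ) ≤ X m 0 := by exact_mod_cast hX1 m hm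
      have hΛ : 0 ≤ Λ := by linarith [L.one_le]
      refine ⟨h1, h2, ?_, (hX4 m hm).trans (by gcongr)⟩
      have h3 : |(X m 1 : ℝ) / X m 0 - α m| ≤ 1 := by
        refine (hX3 m hm).trans ?_
        rw [div_le_one (by linarith)]
        linarith
      have h4 := hα m hm
      calc |(X m 1 : ℝ) / X m 0 - u| = |((X m 1 : ℝ) / X m 0 - α m) + (α m - u)| := by ring_nf
        _ ≤ _ := abs_add_le _ _
        _ ≤ ℓ + 1 := by linarith
    have h1 := card_le_mul_card_image_of_fiber_le _ X hfiber
    calc ((M.filter fun m => lev m = e).card : ℝ) ≤ _ := h1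
      _ ≤ 3 / σ * (r * Q) / 2 ^ e * (K * ((2 : ℝ) ^ e) ^ (1 + ε) * (2 * (ℓ + 1) + 3)) := by
        gcongr
      _ = _ := by
        rw [Real.rpow_add (by positivity), Real.rpow_one]
        field_simp
        ring
  have hsum : (M.card : ℝ) = ∑ e ∈ Finset.range (N + 1), ((M.filter fun m => lev m = e).card : ℝ) := by
    rw [Finset.card_eq_sum_card_fiberwise (f := lev) (t := Finset.range (N + 1)) hlevN]
    push_cast; rfl
  rw [hsum]
  calc _ ≤ ∑ e ∈ Finset.range (N + 1), 3 / σ * (2 * ℓ + 5) * K * (r * Q) * ((2 : ℝ) ^ e) ^ ε :=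
        Finset.sum_le_sum hpiece
    _ = 3 / σ * (2 * ℓ + 5) * K * (r * Q) * ∑ e ∈ Finset.range (N + 1), ((2 : ℝ) ^ e) ^ ε := by
        rw [Finset.mul_sum]
    _ ≤ 3 / σ * (2 * ℓ + 5) * K * (r * Q)
        * ((2 : ℝ) ^ ε / ((2 : ℝ) ^ ε - 1) * (r * Q) ^ ε) := by
        gcongr
        exact sum_two_pow_rpow_le hε N hN
    _ = _ := by
        rw [Real.rpow_add (by positivity), Real.rpow_one]; ring

/-- If `y ≤ r`, the last dyadic level `i` with `y ≤ r 2⁻ⁱ` already contributes at least `1 / y`.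
This turns sums of reciprocals into counts of short vectors. -/
theorem one_div_le_sum_dyadic {r y : ℝ} (hr : 0 < r) (hy : 0 < y) (N : ℕ)
    (hN : r * (1 / 2) ^ N < y) :
    1 / y ≤ 1 / r + ∑ i ∈ Finset.range N, if y ≤ r * (1 / 2) ^ i then 2 ^ (i + 1) / r else 0 := by
  induction N with
  | zero =>
    simp at hN ⊢
    exact inv_anti₀ hr hN.le
  | succ n ih =>
    rw [Finset.sum_range_succ]
    by_cases h : y ≤ r * (1 / 2) ^ n
    · rw [if_pos h]
      have h1 : 1 / y ≤ 2 ^ (n + 1) / r := by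
        rw [div_le_div_iff₀ hy hr]
        have : r * (1 / 2) ^ (n + 1) * 2 ^ (n + 1) = r := by
          rw [mul_assoc, ← mul_pow]; norm_num
        have h2 : r * (1 / 2) ^ (n + 1) * 2 ^ (n + 1) ≤ y * 2 ^ (n + 1) := by gcongr
        linarith
      have h2 : 0 ≤ ∑ i ∈ Finset.range n, if y ≤ r * (1 / 2) ^ i then 2 ^ (i + 1) / r else 0 := by
        refine Finset.sum_nonneg fun i _ => ?_
        split_ifs <;> positivity
      have h3 : 0 < 1 / r := by positivity
      linarith
    · have := ih (not_le.1 h)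
      rw [if_neg h]; linarith

/-- The sum of the reciprocals of the lengths of short vectors over a family of frames along a
curve. -/
theorem sum_one_div_nrm_le {K ε : ℝ} (hK : 0 ≤ K) (hε : 0 < ε) {ι : Type*} (M : Finset ι)
    (α : ι → ℝ) {u ℓ σ Q A r : ℝ} (hQ : 0 < Q) (hA : 0 < A) (hr : 0 < r) (hrA : r * A < 1)
    (hrQ : r * A ^ 2 < Q) (hℓ : 0 ≤ ℓ) (hα : ∀ m ∈ M, |α m - u| ≤ ℓ) (hσ : 0 < σ) (hσ1 : σ ≤ 1)
    (hsep : ∀ m ∈ M, ∀ m' ∈ M, m ≠ m' → σ * A / Q ≤ |α m - α m'|)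
    (hcount : ∀ e : ℕ, (2 : ℝ) ^ e ≤ r * Q → L.CountBound K ε e)
    (v : ι → Fin 3 → ℤ) (hv : ∀ m ∈ M, v m ≠ 0) :
    ∑ m ∈ M, 1 / (L.frame (α m) Q A hQ hA).nrm (v m) ≤ M.card / r
      + 6 / σ * (2 * ℓ + 5) * ((2 : ℝ) ^ ε / ((2 : ℝ) ^ ε - 1)) ^ 2 * K
        * r ^ ε * Q ^ (1 + ε) := by
  classical
  have hb : 1 < (2 : ℝ) ^ ε := Real.one_lt_rpow one_lt_two hε
  have hb1 : 0 < (2 : ℝ) ^ ε - 1 := by linarith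
  set y : ι → ℝ := fun m => (L.frame (α m) Q A hQ hA).nrm (v m)
  have hy : ∀ m ∈ M, 0 < y m := fun m hm => Frame.nrm_pos _ (hv m hm)
  obtain ⟨N, hN⟩ : ∃ N : ℕ, ∀ m ∈ M, r * (1 / 2) ^ N < y m := by
    rcases M.eq_empty_or_nonempty with rfl | hne
    · exact ⟨0, by simp⟩
    obtain ⟨m₀, hm₀, hmin⟩ := Finset.exists_min_image M y hne
    obtain ⟨N, hN⟩ := exists_pow_lt_of_lt_one (div_pos (hy m₀ hm₀) hr)
      (by norm_num : (1 / 2 : ℝ) < 1)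
    refine ⟨N, fun m hm => lt_of_lt_of_le ?_ (hmin m hm)⟩
    rw [lt_div_iff₀ hr] at hN; linarith
  have hcard : ∀ i : ℕ, ((M.filter fun m => y m ≤ r * (1 / 2) ^ i).card : ℝ)
      ≤ 3 / σ * (2 * ℓ + 5) * ((2 : ℝ) ^ ε / ((2 : ℝ) ^ ε - 1)) * K
        * (r * (1 / 2) ^ i * Q) ^ (1 + ε) := by
    intro i
    have hle : r * (1 / 2) ^ i ≤ r := by
      have : (1 / 2 : ℝ) ^ i ≤ 1 := pow_le_one₀ (by norm_num) (by norm_num)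
      nlinarith
    refine card_frames_le hK hε _ α hQ hA (by positivity) (lt_of_le_of_lt (by gcongr) hrA)
      (lt_of_le_of_lt (by gcongr) hrQ) hℓ (fun m hm => hα m (Finset.mem_filter.1 hm).1) hσ hσ1
      (fun m hm m' hm' => hsep m (Finset.mem_filter.1 hm).1 m' (Finset.mem_filter.1 hm').1)
      (fun e he => hcount e (he.trans (by gcongr))) ?_
    intro m hm
    obtain ⟨hm, h⟩ := Finset.mem_filter.1 hm
    exact ⟨v m, hv m hm, h⟩
  -- The weight `2 ^ (i + 1) / r` cancels only one power of `r 2⁻ⁱ` in the count. The remaining `(r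
  -- 2⁻ⁱ) ^ ε` makes the series converge and leaves the factor `r ^ ε`.
  have hterm : ∀ i : ℕ, ((M.filter fun m => y m ≤ r * (1 / 2) ^ i).card : ℝ) * (2 ^ (i + 1) / r)
      ≤ 6 / σ * (2 * ℓ + 5) * ((2 : ℝ) ^ ε / ((2 : ℝ) ^ ε - 1)) * K
        * r ^ ε * Q ^ (1 + ε) * ((1 / 2 : ℝ) ^ ε) ^ i := by
    intro i
    refine (mul_le_mul_of_nonneg_right (hcard i) (by positivity)).trans (le_of_eq ?_)
    have h1 : (r * (1 / 2) ^ i * Q) ^ (1 + ε)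
        = r * r ^ ε * ((1 / 2) ^ i * ((1 / 2 : ℝ) ^ ε) ^ i) * Q ^ (1 + ε) := by
      rw [Real.mul_rpow (by positivity) hQ.le, Real.rpow_add (by positivity : 0 < r * (1 / 2) ^ i),
        Real.rpow_one, Real.mul_rpow hr.le (by positivity)]
      have : ((1 / 2 : ℝ) ^ i) ^ ε = ((1 / 2 : ℝ) ^ ε) ^ i := by
        rw [← Real.rpow_natCast, ← Real.rpow_natCast, ← Real.rpow_mul (by norm_num),
          ← Real.rpow_mul (by norm_num), mul_comm]
      rw [this]; ring
    have h2 : (1 / 2 : ℝ) ^ i * 2 ^ (i + 1) = 2 := by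
      rw [pow_succ, ← mul_assoc, ← mul_pow]; norm_num
    rw [h1]
    field_simp
    linear_combination 3 * K * h2
  have hgeom : ∑ i ∈ Finset.range N, ((1 / 2 : ℝ) ^ ε) ^ i ≤ (2 : ℝ) ^ ε / ((2 : ℝ) ^ ε - 1) := by
    have h0 : (1 / 2 : ℝ) ^ ε = ((2 : ℝ) ^ ε)⁻¹ := by
      rw [one_div, Real.inv_rpow zero_le_two]
    have h1 : ((2 : ℝ) ^ ε)⁻¹ < 1 := inv_lt_one_of_one_lt₀ hb
    rw [h0]
    have h2 := (summable_geometric_of_lt_one (by positivity) h1).sum_le_tsum (Finset.range N)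
      (fun i _ => by positivity)
    rw [tsum_geometric_of_lt_one (by positivity) h1] at h2
    refine h2.trans (le_of_eq ?_)
    field_simp
  calc ∑ m ∈ M, 1 / y m ≤ ∑ m ∈ M, (1 / r + ∑ i ∈ Finset.range N,
        if y m ≤ r * (1 / 2) ^ i then 2 ^ (i + 1) / r else 0) :=
        Finset.sum_le_sum fun m hm => one_div_le_sum_dyadic hr (hy m hm) N (hN m hm)
    _ = M.card / r + ∑ i ∈ Finset.range N,
        ((M.filter fun m => y m ≤ r * (1 / 2) ^ i).card : ℝ) * (2 ^ (i + 1) / r) := by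
        rw [Finset.sum_add_distrib, Finset.sum_const, nsmul_eq_mul, Finset.sum_comm]
        congr 1
        · ring
        · refine Finset.sum_congr rfl fun i _ => ?_
          rw [← Finset.sum_filter, Finset.sum_const, nsmul_eq_mul]
    _ ≤ M.card / r + ∑ i ∈ Finset.range N,
        6 / σ * (2 * ℓ + 5) * ((2 : ℝ) ^ ε / ((2 : ℝ) ^ ε - 1)) * K
          * r ^ ε * Q ^ (1 + ε) * ((1 / 2 : ℝ) ^ ε) ^ i := by
        exact add_le_add_right (Finset.sum_le_sum fun i _ => hterm i) _
    _ ≤ M.card / r + 6 / σ * (2 * ℓ + 5) * ((2 : ℝ) ^ ε / ((2 : ℝ) ^ ε - 1)) * K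
          * r ^ ε * Q ^ (1 + ε) * ((2 : ℝ) ^ ε / ((2 : ℝ) ^ ε - 1)) := by
        rw [← Finset.mul_sum]
        gcongr
    _ = _ := by ring

end LegendrePair
-- Dual sums and the inductive bound for near points
namespace LegendrePair

variable {Λ : ℝ}

/-- The inverse `s` of `p` is Lipschitz, so `p` shrinks distances by at most the factor `Λ`. -/
theorem swap_separated (L : LegendrePair Λ) {ι : Type*} {M : Finset ι} {α : ι → ℝ} {τ : ℝ}
    (hsep : ∀ m ∈ M, ∀ m' ∈ M, m ≠ m' → τ ≤ |α m - α m'|) :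
    ∀ m ∈ M, ∀ m' ∈ M, m ≠ m' → 1 / Λ * τ ≤ |L.p (α m) - L.p (α m')| := by
  intro m hm m' hm' hne
  have hΛ : 0 < Λ := by linarith [L.one_le]
  have h1 := hsep m hm m' hm' hne
  have h2 := L.s_lip (L.p (α m)) (L.p (α m'))
  rw [L.s_p, L.s_p] at h2
  rw [one_div_mul_eq_div, div_le_iff₀ hΛ]
  linarith

/-- The sum of the reciprocals of the lengths of dual vectors over a family of frames along a
curve. -/
theorem sum_one_div_dual_nrm_le (L : LegendrePair Λ) {K ε : ℝ} (hK : 0 ≤ K) (hε : 0 < ε)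
    {ι : Type*} (M : Finset ι) (α : ι → ℝ) {u ℓ σ Q A r : ℝ} (hQ : 0 < Q) (hA : 0 < A)
    (hr : 0 < r) (hrA : r < A) (hrQ : r < Q) (hℓ : 0 ≤ ℓ) (hα : ∀ m ∈ M, |α m - u| ≤ ℓ)
    (hσ : 0 < σ) (hσ1 : σ ≤ 1)
    (hsep : ∀ m ∈ M, ∀ m' ∈ M, m ≠ m' → σ * A / Q ≤ |α m - α m'|)
    (hcount : ∀ e : ℕ, (2 : ℝ) ^ e ≤ r * Q / A ^ 2 → L.swap.CountBound K ε e)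
    (w : ι → Fin 3 → ℤ) (hw : ∀ m ∈ M, w m ≠ 0) :
    ∑ m ∈ M, 1 / (L.frame (α m) Q A hQ hA).dual.nrm (w m) ≤ M.card / r
      + 6 * Λ / σ * (2 * (Λ * ℓ) + 5) * ((2 : ℝ) ^ ε / ((2 : ℝ) ^ ε - 1)) ^ 2 * K
        * r ^ ε * (Q / A ^ 2) ^ (1 + ε) := by
  have hΛ : 0 < Λ := by linarith [L.one_le]
  have h := sum_one_div_nrm_le (L := L.swap) hK hε M (fun m => L.p (α m)) (u := L.p u)
    (ℓ := Λ * ℓ) (σ := 1 / Λ * σ) (Q := Q / A ^ 2) (A := 1 / A) (r := r)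
    (div_pos hQ (pow_pos hA 2)) (one_div_pos.2 hA) hr
    (by rw [mul_one_div, div_lt_one hA]; exact hrA)
    (by rw [one_div, inv_pow, ← div_eq_mul_inv]; gcongr) (by positivity)
    (fun m hm => (L.p_lip _ _).trans (by have := hα m hm; gcongr)) (by positivity)
    (by rw [one_div_mul_eq_div, div_le_one hΛ]; linarith [L.one_le])
    (fun m hm m' hm' hne => by
      refine le_trans (le_of_eq ?_) (L.swap_separated hsep m hm m' hm' hne)
      field_simp)
    (fun e he => hcount e (he.trans (le_of_eq (by ring)))) w hw
  simp_rw [frame_dual]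
  refine h.trans (le_of_eq ?_)
  congr 1
  field_simp

/-- Strong induction on `e`, for all pairs with constant `Λ` at once because the step passes to
`L.swap`. Boxes of frames with `A = 1` at spacing `1 / Q` cover the window, each holding O(1 + 1/|v|
+ 1/|w|) points. Vectors of norm at most `r` give near points of lower level, so the induction
hypothesis bounds their share by a multiple of `r ^ ε K Q ^ (1 + ε)`; the rest is O(Q / r). -/
theorem exists_countBound (hΛ : 1 ≤ Λ) {ε : ℝ} (hε : 0 < ε) :
    ∃ K : ℝ, 0 ≤ K ∧ ∀ (e : ℕ) (L : LegendrePair Λ), L.CountBound K ε e := by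
  classical
  have hb : 1 < (2 : ℝ) ^ ε := Real.one_lt_rpow one_lt_two hε
  have hb1 : 0 < (2 : ℝ) ^ ε - 1 := by linarith
  set B := ((2 : ℝ) ^ ε / ((2 : ℝ) ^ ε - 1)) ^ 2 with hB
  have hBpos : 0 < B := by positivity
  -- The vertical tolerance `(Λ + 1) / 2 ^ e` scaled by `Q = 2 · 2 ^ e` gives `2 (Λ + 1)`, and the
  -- Taylor remainder adds `Λ`.
  set ρ := 3 * Λ + 2 with hρ
  have hρ0 : 0 ≤ ρ := by positivity
  set C₁ := (1 + 6 * ρ * 1) * (1 + 2 * ρ + 16 * ρ ^ 2) + (1 + 2 * ρ) * (4 * ρ + 2) ^ 3 with hC₁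
  have hC₁pos : 0 < C₁ := by positivity
  -- `42 = 6 (2 + 5)` and `6 Λ (2 Λ + 5)` are the constants of the primal and dual sums at `ℓ = σ =
  -- 1`; `2 ^ (1 + ε)` comes from `Q = 2 · 2 ^ e`.
  set C₂ := C₁ * (42 + 6 * Λ * (2 * Λ + 5)) * B * 2 ^ (1 + ε) with hC₂
  have hC₂pos : 0 < C₂ := by positivity
  -- The second entry lets the induction hypothesis contribute at most half of the claim; the first
  -- lowers the level.
  set r := min (1 / 4 : ℝ) ((1 / (2 * C₂)) ^ (1 / ε)) with hr
  have hrpos : 0 < r := by positivity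
  have hr4 : r ≤ 1 / 4 := min_le_left _ _
  have hrε : C₂ * r ^ ε ≤ 1 / 2 := by
    have h1 : r ^ ε ≤ 1 / (2 * C₂) := by
      calc r ^ ε ≤ ((1 / (2 * C₂)) ^ (1 / ε)) ^ ε :=
            Real.rpow_le_rpow hrpos.le (min_le_right _ _) hε.le
        _ = 1 / (2 * C₂) := by
          rw [← Real.rpow_mul (by positivity), one_div_mul_cancel hε.ne', Real.rpow_one]
    calc C₂ * r ^ ε ≤ C₂ * (1 / (2 * C₂)) := by gcongr
      _ = 1 / 2 := by field_simp
  -- The other half pays for the `M.card ≤ 6 · 2 ^ e` cells, each weighted by `1 + 2 / r`.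
  set K := 2 * (C₁ * 6 * (1 + 2 / r)) with hK
  have hKpos : 0 ≤ K := by positivity
  refine ⟨K, hKpos, fun e => ?_⟩
  induction e using Nat.strong_induction_on with
  | _ e ih =>
  intro L u S hS
  have h2e : (1 : ℝ) ≤ 2 ^ e := one_le_pow₀ one_le_two
  set Q : ℝ := 2 ^ (e + 1) with hQdef
  have hQe : Q = 2 * 2 ^ e := by rw [hQdef, pow_succ, mul_comm]
  have hQ : 0 < Q := by positivity
  set α : ℕ → ℝ := fun m => u - 1 + m / Q with hα
  set M := Finset.range (2 ^ (e + 2) + 1) with hM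
  have hMcard : (M.card : ℝ) ≤ 6 * 2 ^ e := by
    rw [hM, Finset.card_range]; push_cast
    rw [pow_add]; linarith
  have hQM : ((2 ^ (e + 2) : ℕ) : ℝ) = 2 * Q := by
    rw [hQe]; push_cast; rw [pow_add]; ring
  set F : ℕ → Frame := fun m => L.frame (α m) Q 1 hQ one_pos with hF
  have hαu : ∀ m ∈ M, |α m - u| ≤ 1 := by
    intro m hm
    have h1 : m ≤ 2 ^ (e + 2) := Nat.lt_succ_iff.1 (Finset.mem_range.1 hm)
    have h2 : (m : ℝ) ≤ 2 * Q := by rw [← hQM]; exact_mod_cast h1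
    have h3 : (m : ℝ) / Q ≤ 2 := by rw [div_le_iff₀ hQ]; exact h2
    have h4 : 0 ≤ (m : ℝ) / Q := by positivity
    rw [abs_le]; constructor <;> simp only [hα] <;> linarith
  have hsep : ∀ m ∈ M, ∀ m' ∈ M, m ≠ m' → 1 * 1 / Q ≤ |α m - α m'| := by
    intro m _ m' _ hne
    have h1 : α m - α m' = ((m : ℝ) - m') / Q := by simp only [hα]; ring
    rw [h1, abs_div, abs_of_pos hQ]
    gcongr
    have h2 : 1 ≤ |(m : ℤ) - m'| := Int.one_le_abs (sub_ne_zero.2 (by exact_mod_cast hne))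
    have h3 : ((|(m : ℤ) - m'| : ℤ) : ℝ) = |(m : ℝ) - m'| := by push_cast; rfl
    rw [mul_one, ← h3]; exact_mod_cast h2
  choose v hv hvmin using fun m => (F m).exists_min_nrm
  choose w hw hwmin using fun m => (F m).dual.exists_min_nrm
  -- Heights up to `r Q ≤ Q / 4 = 2 ^ e / 2` belong to strictly lower levels.
  have hle : ∀ e' : ℕ, (2 : ℝ) ^ e' ≤ r * Q → e' < e := by
    intro e' he'
    by_contra hc
    have h1 : (2 : ℝ) ^ e ≤ 2 ^ e' := pow_le_pow_right₀ one_le_two (not_lt.1 hc)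
    have h2 : r * Q ≤ 1 / 4 * Q := by gcongr
    rw [hQe] at h2 he'
    linarith
  have hsum1 := sum_one_div_nrm_le (L := L) hKpos hε M α (u := u) (ℓ := 1) (σ := 1) (Q := Q)
    (A := 1) (r := r) hQ one_pos hrpos (by linarith) (by nlinarith) zero_le_one hαu one_pos le_rfl
    hsep (fun e' he' => ih e' (hle e' he') L) v (fun m _ => hv m)
  have hsum2 := L.sum_one_div_dual_nrm_le hKpos hε M α (u := u) (ℓ := 1) (σ := 1) (Q := Q)
    (A := 1) (r := r) hQ one_pos hrpos (by linarith) (by nlinarith) zero_le_one hαu one_pos le_rfl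
    hsep (fun e' he' => ih e' (hle e' (by simpa using he')) L.swap) w (fun m _ => hw m)
  set f : (Fin 3 → ℤ) → ℕ := fun x => ⌊((x 1 : ℝ) / x 0 - (u - 1)) * Q⌋₊ with hf
  have hfS : ∀ x ∈ S, f x ∈ M ∧ (F (f x)).nrm x ≤ ρ := by
    intro x hx
    obtain ⟨h1, h2, h3, h4⟩ := hS x hx
    have hq : 0 < (x 0 : ℝ) := by linarith
    have h3' := abs_le.1 h3
    have hnn : 0 ≤ ((x 1 : ℝ) / x 0 - (u - 1)) * Q := mul_nonneg (by linarith) hQ.le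
    have hfl := Nat.floor_le hnn
    have hfl' := Nat.lt_floor_add_one (((x 1 : ℝ) / x 0 - (u - 1)) * Q)
    change (f x : ℝ) ≤ _ at hfl
    change _ < (f x : ℝ) + 1 at hfl'
    constructor
    · rw [hM, Finset.mem_range, Nat.lt_succ_iff]
      have : (f x : ℝ) ≤ ((2 ^ (e + 2) : ℕ) : ℝ) := by
        rw [hQM]
        refine hfl.trans ?_
        gcongr; linarith
      exact_mod_cast this
    · have hβ : |(x 1 : ℝ) / x 0 - α (f x)| ≤ 1 / Q := by
        have : (x 1 : ℝ) / x 0 - α (f x)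
            = (((x 1 : ℝ) / x 0 - (u - 1)) * Q - f x) / Q := by
          simp only [hα]; field_simp; ring
        rw [this, abs_div, abs_of_pos hQ, abs_of_nonneg (by linarith)]
        gcongr; linarith
      have ht := L.g_taylor (α (f x)) ((x 1 : ℝ) / x 0)
      have hρ1 : 1 ≤ ρ := by linarith
      have hxQ : (x 0 : ℝ) ≤ Q := h2.le
      rw [Frame.nrm, pi_norm_le_iff_of_nonneg hρ0]
      intro i
      fin_cases i
      · change |(F (f x)).coords (toReal x) 0| ≤ ρ
        rw [Frame.coords_zero]
        change |(x 0 : ℝ) / Q| ≤ ρ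
        rw [abs_of_pos (by positivity)]
        exact ((div_le_one hQ).2 hxQ).trans hρ1
      · change |(F (f x)).coords (toReal x) 1| ≤ ρ
        rw [Frame.coords_one]
        change |((x 1 : ℝ) - α (f x) * x 0) / 1| ≤ ρ
        have : ((x 1 : ℝ) - α (f x) * x 0) / 1 = ((x 1 : ℝ) / x 0 - α (f x)) * x 0 := by
          field_simp
        rw [this, abs_mul, abs_of_pos hq]
        calc |(x 1 : ℝ) / x 0 - α (f x)| * x 0 ≤ 1 / Q * Q := by gcongr
          _ = 1 := by field_simp
          _ ≤ ρ := hρ1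
      · change |(F (f x)).coords (toReal x) 2| ≤ ρ
        rw [Frame.coords_two]
        change |((x 2 : ℝ) - L.g (α (f x)) * x 0 - L.p (α (f x)) * (x 1 - α (f x) * x 0)) * Q
          / 1 ^ 2| ≤ ρ
        have h5 : ((x 2 : ℝ) - L.g (α (f x)) * x 0 - L.p (α (f x)) * (x 1 - α (f x) * x 0)) * Q
            / 1 ^ 2 = ((x 2 : ℝ) - x 0 * L.g (x 1 / x 0)) * Q
              + (L.g (x 1 / x 0) - L.g (α (f x)) - L.p (α (f x)) * ((x 1 : ℝ) / x 0 - α (f x)))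
                * (x 0 * Q) := by
          field_simp; ring
        rw [h5]
        refine (abs_add_le _ _).trans ?_
        rw [abs_mul, abs_mul, abs_of_pos hQ, abs_of_pos (by positivity : 0 < (x 0 : ℝ) * Q)]
        have h6 : |(x 2 : ℝ) - x 0 * L.g (x 1 / x 0)| * Q ≤ 2 * (Λ + 1) := by
          calc _ ≤ (Λ + 1) / 2 ^ e * Q := by gcongr
            _ = 2 * (Λ + 1) := by rw [hQe]; field_simp
        have h7 : Λ * ((x 1 : ℝ) / x 0 - α (f x)) ^ 2 ≤ Λ * (1 / Q) ^ 2 := by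
          rw [← sq_abs]; gcongr
        have h8 : |L.g (x 1 / x 0) - L.g (α (f x)) - L.p (α (f x)) * ((x 1 : ℝ) / x 0 - α (f x))|
            * (x 0 * Q) ≤ Λ := by
          calc _ ≤ Λ * (1 / Q) ^ 2 * (Q * Q) := by
                gcongr; exact ht.trans h7
            _ = Λ := by field_simp
        linarith
  have hcell : ∀ m ∈ M, ((S.filter fun x => f x = m).card : ℝ)
      ≤ C₁ * (1 + 1 / (F m).nrm (v m) + 1 / (F m).dual.nrm (w m)) := by
    intro m _
    have hmem : ∀ x ∈ S.filter (fun x => f x = m), (F m).nrm x ≤ ρ := by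
      intro x hx
      obtain ⟨hxS, rfl⟩ := Finset.mem_filter.1 hx
      exact (hfS x hxS).2
    have hvpos := (F m).nrm_pos (hv m)
    have hwpos := (F m).dual.nrm_pos (hw m)
    by_cases hshort : (F m).dual.nrm (w m) ≤ 1
    · have h := (F m).card_le_of_dual_short hρ0 zero_le_one _ hmem (hv m) (hvmin m) (hw m)
        (hwmin m) hshort
      have h1 : (F m).A = 1 := rfl
      rw [h1, one_pow] at h
      refine h.trans ?_
      gcongr
      rw [hC₁]
      have : 0 ≤ (1 + 2 * ρ) * (4 * ρ + 2) ^ 3 := by positivity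
      linarith
    · have h := (F m).card_le_of_dual_not_short hρ0 rfl _ hmem (hv m) (hvmin m)
        (fun y hy => lt_of_lt_of_le (not_le.1 hshort) (hwmin m y hy))
      refine h.trans ?_
      have h1 : (1 + 2 * ρ) * (4 * ρ + 2) ^ 3 ≤ C₁ := by
        have : 0 ≤ (1 + 6 * ρ * 1) * (1 + 2 * ρ + 16 * ρ ^ 2) := by positivity
        linarith
      have h2 : 0 ≤ 1 / (F m).dual.nrm (w m) := by positivity
      exact mul_le_mul h1 (le_add_of_nonneg_right h2) (by positivity) hC₁pos.le
  have hcardS : (S.card : ℝ) = ∑ m ∈ M, ((S.filter fun x => f x = m).card : ℝ) := by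
    rw [Finset.card_eq_sum_card_fiberwise (f := f) (t := M) fun x hx => (hfS x hx).1]
    push_cast; rfl
  have hQε : Q ^ (1 + ε) = 2 ^ (1 + ε) * ((2 : ℝ) ^ e) ^ (1 + ε) := by
    rw [hQe, Real.mul_rpow zero_le_two (by positivity)]
  have hself : (2 : ℝ) ^ e ≤ ((2 : ℝ) ^ e) ^ (1 + ε) := by
    conv_lhs => rw [← Real.rpow_one ((2 : ℝ) ^ e)]
    exact Real.rpow_le_rpow_of_exponent_le h2e (by linarith)
  have e1 : Q / 1 ^ 2 = Q := by simp
  rw [e1] at hsum2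
  calc (S.card : ℝ) ≤ ∑ m ∈ M, C₁ * (1 + 1 / (F m).nrm (v m) + 1 / (F m).dual.nrm (w m)) := by
        rw [hcardS]; exact Finset.sum_le_sum hcell
    _ = C₁ * (M.card + ∑ m ∈ M, 1 / (F m).nrm (v m) + ∑ m ∈ M, 1 / (F m).dual.nrm (w m)) := by
        rw [← Finset.mul_sum, Finset.sum_add_distrib, Finset.sum_add_distrib, Finset.sum_const,
          nsmul_eq_mul, mul_one]
    _ ≤ C₁ * (M.card + (M.card / r + 6 / 1 * (2 * 1 + 5) * B * K * r ^ ε * Q ^ (1 + ε))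
          + (M.card / r + 6 * Λ / 1 * (2 * (Λ * 1) + 5) * B * K * r ^ ε * Q ^ (1 + ε))) := by
        gcongr
    _ = C₁ * (1 + 2 / r) * M.card + C₂ * r ^ ε * (K * ((2 : ℝ) ^ e) ^ (1 + ε)) := by
        rw [hQε, hC₂]; ring
    _ ≤ C₁ * (1 + 2 / r) * (6 * ((2 : ℝ) ^ e) ^ (1 + ε))
        + 1 / 2 * (K * ((2 : ℝ) ^ e) ^ (1 + ε)) := by
        gcongr
        exact hMcard.trans (by linarith)
    _ = K * ((2 : ℝ) ^ e) ^ (1 + ε) := by rw [hK]; ring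

end LegendrePair
-- Minkowski's theorem, unfolding and volumes
open MeasureTheory Module

/-- The lattice of integer vectors. -/
noncomputable def intLattice : AddSubgroup (Fin 3 → ℝ) :=
  (Submodule.span ℤ (Set.range (Pi.basisFun ℝ (Fin 3)))).toAddSubgroup

theorem mem_intLattice {y : Fin 3 → ℝ} : y ∈ intLattice ↔ ∃ x : Fin 3 → ℤ, toReal x = y := by
  rw [intLattice, Submodule.mem_toAddSubgroup, Basis.mem_span_iff_repr_mem]
  simp only [Pi.basisFun_repr, Set.mem_range, algebraMap_int_eq, eq_intCast]
  constructor
  · intro h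
    choose x hx using h
    exact ⟨x, funext hx⟩
  · rintro ⟨x, rfl⟩ i
    exact ⟨x i, rfl⟩

/-- The integer vectors, as elements of the lattice. -/
noncomputable def intLatticeEquiv : (Fin 3 → ℤ) ≃ intLattice :=
  Equiv.ofBijective (fun x => ⟨toReal x, mem_intLattice.2 ⟨x, rfl⟩⟩)
    ⟨fun _ _ h => toReal_injective (Subtype.ext_iff.1 h),
      fun y => by
        obtain ⟨x, hx⟩ := mem_intLattice.1 y.2
        exact ⟨x, Subtype.ext hx⟩⟩

instance : Countable intLattice := intLatticeEquiv.symm.injective.countable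

theorem isAddFundamentalDomain_intLattice :
    IsAddFundamentalDomain intLattice (ZSpan.fundamentalDomain (Pi.basisFun ℝ (Fin 3))) volume :=
  ZSpan.isAddFundamentalDomain' _ _

instance : DiscreteTopology intLattice :=
  inferInstanceAs (DiscreteTopology (Submodule.span ℤ (Set.range (Pi.basisFun ℝ (Fin 3)))))

theorem volume_fundamentalDomain_intLattice :
    volume (ZSpan.fundamentalDomain (Pi.basisFun ℝ (Fin 3))) = 1 := by
  rw [ZSpan.fundamentalDomain_pi_basisFun, volume_pi, Measure.pi_pi]
  simp

/-- Minkowski's theorem on linear forms. -/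
theorem exists_int_of_linearForms (f : (Fin 3 → ℝ) →ₗ[ℝ] (Fin 3 → ℝ)) (hf : LinearMap.det f ≠ 0)
    (c : Fin 3 → ℝ) (hc : ∀ i, 0 < c i) (h : |LinearMap.det f| ≤ c 0 * c 1 * c 2) :
    ∃ x : Fin 3 → ℤ, x ≠ 0 ∧ ∀ i, |f (toReal x) i| ≤ c i := by
  set e := (f.equivOfDetNeZero hf).toContinuousLinearEquiv.toHomeomorph with he
  have hef : ∀ y, e y = f y := fun y => rfl
  set s : Set (Fin 3 → ℝ) := f ⁻¹' Set.Icc (-c) c with hs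
  have hmem : ∀ y, y ∈ s ↔ ∀ i, |f y i| ≤ c i := by
    intro y
    rw [hs, Set.mem_preimage, Set.mem_Icc, Pi.le_def, Pi.le_def, ← forall_and]
    exact forall_congr' fun i => abs_le.symm
  have hvol : volume s = ENNReal.ofReal (|(LinearMap.det f)⁻¹| * (8 * (c 0 * c 1 * c 2))) := by
    rw [hs, Measure.addHaar_preimage_linearMap _ hf, Real.volume_Icc_pi,
      ENNReal.ofReal_mul (abs_nonneg _), Fin.prod_univ_three]
    have h0 := (hc 0).le
    have h1 := (hc 1).le
    have h2 := (hc 2).le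
    congr 1
    rw [← ENNReal.ofReal_mul (by simp; linarith), ← ENNReal.ofReal_mul]
    · congr 1; simp; ring
    · simp only [Pi.neg_apply, sub_neg_eq_add]; positivity
  -- The version for compact bodies allows equality in the volume condition, which is how the
  -- theorem is applied below.
  obtain ⟨x, hx0, hx⟩ := exists_ne_zero_mem_lattice_of_measure_mul_two_pow_le_measure
    (μ := volume) (s := s) isAddFundamentalDomain_intLattice
    (by
      intro y hy
      rw [hmem] at hy ⊢
      intro i
      rw [map_neg, Pi.neg_apply, abs_neg]; exact hy i)
    ((convex_Icc _ _).linear_preimage f)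
    (e.isCompact_preimage.2 isCompact_Icc)
    (by
      rw [volume_fundamentalDomain_intLattice, hvol, finrank_fin_fun, one_mul]
      have : (2 : ENNReal) ^ 3 = ENNReal.ofReal 8 := by
        rw [show (8 : ℝ) = 2 ^ 3 by norm_num, ENNReal.ofReal_pow zero_le_two]; simp
      rw [this]
      apply ENNReal.ofReal_le_ofReal
      have hd : 0 < |LinearMap.det f| := abs_pos.2 hf
      rw [abs_inv, inv_mul_eq_div, le_div_iff₀ hd]
      linarith)
  obtain ⟨z, hz⟩ := mem_intLattice.1 x.2
  refine ⟨z, ?_, ?_⟩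
  · rintro rfl
    apply hx0
    apply Subtype.ext
    rw [← hz]; ext i; simp
  · rw [← hmem, hz]; exact hx

/-- Unfolding over the unit cube: the volume is the average, over shifts `z`, of the number of
points of ℤ³ + z in `E`. -/
theorem volume_eq_lintegral_tsum {E : Set (Fin 3 → ℝ)} (hE : MeasurableSet E) :
    volume E = ∫⁻ z in ZSpan.fundamentalDomain (Pi.basisFun ℝ (Fin 3)),
      ∑' x : Fin 3 → ℤ, E.indicator 1 (toReal x + z) := by
  have h := isAddFundamentalDomain_intLattice.lintegral_eq_tsum'' (E.indicator 1)
  rw [lintegral_indicator_one hE] at h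
  rw [h, ← intLatticeEquiv.tsum_eq, lintegral_tsum]
  · rfl
  · intro x
    apply Measurable.aemeasurable
    exact (measurable_one.indicator hE).comp (measurable_const_add _)

/-- Every shifted lattice has at least `S.card` points in `E`, hence so does the average. In use
`x₀` is an integer point close to `z`, so that `x - x₀ + z` is a small perturbation of `x`. -/
theorem card_le_volume {E : Set (Fin 3 → ℝ)} (hE : MeasurableSet E) (S : Finset (Fin 3 → ℤ))
    (h : ∀ z : Fin 3 → ℝ, ∃ x₀ : Fin 3 → ℤ, ∀ x ∈ S, toReal (x - x₀) + z ∈ E) :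
    (S.card : ENNReal) ≤ volume E := by
  rw [volume_eq_lintegral_tsum hE]
  have h1 : ∫⁻ z in ZSpan.fundamentalDomain (Pi.basisFun ℝ (Fin 3)), (S.card : ENNReal)
      = S.card := by
    rw [setLIntegral_const, volume_fundamentalDomain_intLattice, mul_one]
  rw [← h1]
  refine lintegral_mono fun z => ?_
  obtain ⟨x₀, hx₀⟩ := h z
  rw [← (Equiv.subRight x₀).tsum_eq]
  calc (S.card : ENNReal) = ∑ x ∈ S, E.indicator 1 (toReal (x - x₀) + z) := by
        rw [Finset.sum_congr rfl fun x hx => Set.indicator_of_mem (hx₀ x hx) _]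
        simp
    _ ≤ _ := ENNReal.sum_le_tsum S

/-- The reverse comparison: each shifted point in `E` is a small perturbation of a distinct point of
`S`. -/
theorem volume_le_card {E : Set (Fin 3 → ℝ)} (hE : MeasurableSet E) (S : Finset (Fin 3 → ℤ))
    (h : ∀ z : Fin 3 → ℝ, ∃ x₀ : Fin 3 → ℤ, ∀ x, toReal (x - x₀) + z ∈ E → x ∈ S) :
    volume E ≤ S.card := by
  rw [volume_eq_lintegral_tsum hE]
  have h1 : ∫⁻ z in ZSpan.fundamentalDomain (Pi.basisFun ℝ (Fin 3)), (S.card : ENNReal)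
      = S.card := by
    rw [setLIntegral_const, volume_fundamentalDomain_intLattice, mul_one]
  rw [← h1]
  refine lintegral_mono fun z => ?_
  obtain ⟨x₀, hx₀⟩ := h z
  rw [← (Equiv.subRight x₀).tsum_eq, tsum_eq_sum (s := S)]
  · calc ∑ x ∈ S, E.indicator 1 (toReal (Equiv.subRight x₀ x) + z) ≤ ∑ x ∈ S, (1 : ENNReal) :=
          Finset.sum_le_sum fun x _ => Set.indicator_le_self' (by simp) _
      _ = S.card := by simp
  · intro x hx
    refine Set.indicator_of_notMem (fun hm => hx (hx₀ x hm)) _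

/-- The vectors `(q, a, l)` with `Q₁ < q ≤ Q₂`, `u < a / q ≤ v` and `|l - q g (a / q)| < d`. -/
def curvedRegion (g : ℝ → ℝ) (Q₁ Q₂ u v d : ℝ) : Set (Fin 3 → ℝ) :=
  {y | Q₁ < y 0 ∧ y 0 ≤ Q₂ ∧ u * y 0 < y 1 ∧ y 1 ≤ v * y 0 ∧ |y 2 - y 0 * g (y 1 / y 0)| < d}

theorem measurableSet_curvedRegion {g : ℝ → ℝ} (hg : Measurable g) (Q₁ Q₂ u v d : ℝ) :
    MeasurableSet (curvedRegion g Q₁ Q₂ u v d) := by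
  have h : ∀ i : Fin 3, Measurable fun y : Fin 3 → ℝ => y i := fun i => measurable_pi_apply i
  have h3 : Measurable fun y : Fin 3 → ℝ => |y 2 - y 0 * g (y 1 / y 0)| :=
    ((h 2).sub ((h 0).mul (hg.comp ((h 1).div (h 0))))).abs
  exact (measurableSet_lt measurable_const (h 0)).inter
    ((measurableSet_le (h 0) measurable_const).inter
    ((measurableSet_lt ((h 0).const_mul u) (h 1)).inter
    ((measurableSet_le (h 1) ((h 0).const_mul v)).inter
    (measurableSet_lt h3 measurable_const))))

/-- Fubini: the slices in the last variable have length `2 d` wherever the curve lies, and the next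
ones have length `(v - u) q`. -/
theorem volume_curvedRegion {g : ℝ → ℝ} (hg : Measurable g) {Q₁ Q₂ u v d : ℝ} (hQ₁ : 0 ≤ Q₁)
    (hQ : Q₁ ≤ Q₂) (huv : u ≤ v) (hd : 0 ≤ d) :
    volume (curvedRegion g Q₁ Q₂ u v d)
      = ENNReal.ofReal (d * (v - u) * (Q₂ ^ 2 - Q₁ ^ 2)) := by
  set T : Set (ℝ × ℝ × ℝ) := {y | Q₁ < y.1 ∧ y.1 ≤ Q₂ ∧ u * y.1 < y.2.1 ∧ y.2.1 ≤ v * y.1 ∧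
    |y.2.2 - y.1 * g (y.2.1 / y.1)| < d} with hT
  have hTm : MeasurableSet T := by
    have h0 : Measurable fun y : ℝ × ℝ × ℝ => y.1 := measurable_fst
    have h1 : Measurable fun y : ℝ × ℝ × ℝ => y.2.1 := measurable_fst.comp measurable_snd
    have h2 : Measurable fun y : ℝ × ℝ × ℝ => y.2.2 := measurable_snd.comp measurable_snd
    have h3 : Measurable fun y : ℝ × ℝ × ℝ => |y.2.2 - y.1 * g (y.2.1 / y.1)| :=
      (h2.sub (h0.mul (hg.comp (h1.div h0)))).abs
    exact (measurableSet_lt measurable_const h0).inter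
      ((measurableSet_le h0 measurable_const).inter
      ((measurableSet_lt (h0.const_mul u) h1).inter
      ((measurableSet_le h1 (h0.const_mul v)).inter
      (measurableSet_lt h3 measurable_const))))
  have hmp : MeasurePreserving (fun y : Fin 3 → ℝ => (y 0, y 1, y 2)) volume volume := by
    have h1 := volume_preserving_piFinSuccAbove (fun _ : Fin 3 => ℝ) 0
    have h2 := (MeasurePreserving.id (volume : Measure ℝ)).prod (volume_preserving_finTwoArrow ℝ)
    exact h2.comp h1
  have hK : curvedRegion g Q₁ Q₂ u v d = (fun y : Fin 3 → ℝ => (y 0, y 1, y 2)) ⁻¹' T := rfl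
  rw [hK, hmp.measure_preimage hTm.nullMeasurableSet, Measure.volume_eq_prod,
    Measure.prod_apply hTm]
  have hslice : ∀ q : ℝ, (volume : Measure (ℝ × ℝ)) (Prod.mk q ⁻¹' T)
      = (Set.Ioc Q₁ Q₂).indicator (fun q => ENNReal.ofReal (2 * d * ((v - u) * q))) q := by
    intro q
    by_cases hq : q ∈ Set.Ioc Q₁ Q₂
    swap
    · rw [Set.indicator_of_notMem hq]
      have : Prod.mk q ⁻¹' T = ∅ := by
        ext y
        simp only [hT, Set.mem_preimage, Set.mem_ofPred_eq, Set.mem_empty_iff_false, iff_false]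
        rintro ⟨h1, h2, -⟩
        exact hq ⟨h1, h2⟩
      rw [this, measure_empty]
    rw [Set.indicator_of_mem hq, Measure.volume_eq_prod, Measure.prod_apply
      (measurable_prodMk_left hTm)]
    have hslice2 : ∀ a : ℝ, volume (Prod.mk a ⁻¹' (Prod.mk q ⁻¹' T))
        = (Set.Ioc (u * q) (v * q)).indicator (fun _ => ENNReal.ofReal (2 * d)) a := by
      intro a
      by_cases ha : a ∈ Set.Ioc (u * q) (v * q)
      · rw [Set.indicator_of_mem ha, ← Real.volume_ball (q * g (a / q)) d]
        congr 1
        ext l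
        simp only [hT, Set.mem_preimage, Set.mem_ofPred_eq, Metric.mem_ball, Real.dist_eq]
        exact ⟨fun h => h.2.2.2.2, fun h => ⟨hq.1, hq.2, ha.1, ha.2, h⟩⟩
      · rw [Set.indicator_of_notMem ha]
        have : Prod.mk a ⁻¹' (Prod.mk q ⁻¹' T) = ∅ := by
          ext y
          simp only [hT, Set.mem_preimage, Set.mem_ofPred_eq, Set.mem_empty_iff_false, iff_false]
          rintro ⟨-, -, h1, h2, -⟩
          exact ha ⟨h1, h2⟩
        rw [this, measure_empty]
    simp_rw [hslice2]
    rw [lintegral_indicator_const measurableSet_Ioc, Real.volume_Ioc, ← ENNReal.ofReal_mul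
      (by linarith), ← sub_mul]
  simp_rw [hslice]
  rw [lintegral_indicator measurableSet_Ioc, ← ofReal_integral_eq_lintegral_ofReal]
  · congr 1
    rw [← intervalIntegral.integral_of_le hQ]
    rw [intervalIntegral.integral_const_mul, intervalIntegral.integral_const_mul, integral_id]
    ring
  · apply Continuous.integrableOn_Ioc
    fun_prop
  · rw [Filter.EventuallyLE, ae_restrict_iff' measurableSet_Ioc]
    refine Filter.Eventually.of_forall fun q hq => ?_
    have : 0 ≤ q := hQ₁.trans hq.1.le
    have : 0 ≤ v - u := by linarith
    simp only [Pi.zero_apply]; positivity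


/-! ### Transference: covering radius and the dual minimum -/

/-- A nonzero integer vector is a multiple of a vector that pairs to `1` with another. -/
theorem exists_primitive {w : Fin 3 → ℤ} (hw : w ≠ 0) :
    ∃ (d : ℤ) (w' x : Fin 3 → ℤ), w = d • w' ∧ pair x w' = 1 := by
  set d₁ : ℤ := ((Int.gcd (w 0) (w 1) : ℕ) : ℤ) with hd₁
  set d : ℤ := ((Int.gcd d₁ (w 2) : ℕ) : ℤ) with hd
  have h₁ : d ∣ d₁ := Int.gcd_dvd_left _ _
  have h2 : d ∣ w 2 := Int.gcd_dvd_right _ _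
  have h0 : d ∣ w 0 := h₁.trans (Int.gcd_dvd_left _ _)
  have h1 : d ∣ w 1 := h₁.trans (Int.gcd_dvd_right _ _)
  obtain ⟨a, ha⟩ := h0
  obtain ⟨b, hb⟩ := h1
  obtain ⟨c, hc⟩ := h2
  have hd0 : d ≠ 0 := by
    intro h
    rw [h, zero_mul] at ha hb hc
    apply hw
    ext i
    fin_cases i
    · exact ha
    · exact hb
    · exact hc
  have e1 := Int.gcd_eq_gcd_ab (w 0) (w 1)
  have e2 := Int.gcd_eq_gcd_ab d₁ (w 2)
  rw [← hd₁] at e1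
  rw [← hd] at e2
  set X := Int.gcdA (w 0) (w 1)
  set Y := Int.gcdB (w 0) (w 1)
  set Z := Int.gcdA d₁ (w 2)
  set W := Int.gcdB d₁ (w 2)
  -- Two Bézout identities combine to `d = w₀ X Z + w₁ Y Z + w₂ W`; order and signs follow those of
  -- `pair`.
  refine ⟨d, ![a, b, c], ![W, -(Y * Z), X * Z], ?_, ?_⟩
  · ext i
    fin_cases i
    · simpa using ha
    · simpa using hb
    · simpa using hc
  · apply mul_left_cancel₀ hd0
    simp only [pair, Matrix.cons_val]
    linear_combination -e2 - Z * e1 - W * hc - Y * Z * hb - X * Z * ha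

/-- Only the coordinate dual to the largest entry of `y` is used. -/
theorem exists_pair_eq {y : Fin 3 → ℝ} {T θ : ℝ} (hT : 0 < T) (hy : T ≤ ‖y‖) (hθ : |θ| ≤ 1) :
    ∃ x : Fin 3 → ℝ, pair x y = θ ∧ ‖x‖ ≤ 1 / T := by
  obtain ⟨k, hk⟩ := exists_norm_eq y
  have hk0 : 0 < |y k| := by rw [hk]; linarith
  have hk0' : y k ≠ 0 := abs_pos.1 hk0
  have hb : |θ / y k| ≤ 1 / T := by
    rw [abs_div, hk]
    gcongr
  fin_cases k
  · refine ⟨Pi.single 2 (θ / y 0), ?_, ?_⟩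
    · simp at hk0'
      simp [pair]; field_simp
    · rw [Pi.norm_single]; exact hb
  · refine ⟨Pi.single 1 (-(θ / y 1)), ?_, ?_⟩
    · simp at hk0'
      simp [pair]; field_simp
    · rw [Pi.norm_single, norm_neg]; exact hb
  · refine ⟨Pi.single 0 (θ / y 2), ?_, ?_⟩
    · simp at hk0'
      simp [pair]; field_simp
    · rw [Pi.norm_single]; exact hb

namespace Frame

variable (F : Frame)

theorem exists_nrm_le : ∃ v : Fin 3 → ℤ, v ≠ 0 ∧ F.nrm v ≤ 1 / F.A := by
  have hA := F.A_pos
  have hdet : LinearMap.det F.coords ≠ 0 := by rw [F.det_coords]; positivity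
  obtain ⟨v, hv, h⟩ := exists_int_of_linearForms F.coords hdet (fun _ => 1 / F.A)
    (fun _ => by positivity) (by
      rw [F.det_coords, abs_of_pos (by positivity)]
      exact le_of_eq (by ring))
  refine ⟨v, hv, ?_⟩
  rw [nrm, pi_norm_le_iff_of_nonneg (by positivity)]
  exact h

/-- Minkowski's theorem for the dual lattice and a cylinder around the direction of `v`. -/
theorem sq_le_of_dual_nrm_ge {T : ℝ} (hT : 0 < T)
    (hdual : ∀ w : Fin 3 → ℤ, w ≠ 0 → T ≤ F.dual.nrm w) {v : Fin 3 → ℤ} (hv : v ≠ 0) :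
    T ^ 2 ≤ 8 * F.A ^ 3 * F.nrm v := by
  have hA := pow_pos F.A_pos 3
  obtain ⟨i, hi⟩ := exists_norm_eq (F.coords (toReal v))
  set ν := F.coords (toReal v) with hν
  have hμ : 0 < F.nrm v := F.nrm_pos hv
  change |ν i| = F.nrm v at hi
  set μ := F.nrm v with hμdef
  have hνle : ∀ k, |ν k| ≤ μ := fun k => F.abs_coord_le v k
  -- One row of the identity is replaced by the form `pair ν`. As `pair` matches index `i` with
  -- `Fin.rev i`, the determinant is `± ν i`, of absolute value `μ`.
  set N : Matrix (Fin 3) (Fin 3) ℝ :=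
    Matrix.updateRow 1 (Fin.rev i) ![ν 2, -ν 1, ν 0] with hN
  have hNdet : |N.det| = μ := by
    rw [← hi, hN]
    fin_cases i <;> simp [Matrix.det_fin_three, Matrix.updateRow_apply]
  set f := (Matrix.toLin' N).comp F.dual.coords with hf
  have hfdet : |LinearMap.det f| = μ * F.A ^ 3 := by
    have : F.dual.A = 1 / F.A := rfl
    rw [hf, LinearMap.det_comp, LinearMap.det_toLin', abs_mul, hNdet, F.dual.det_coords, this,
      one_div_pow, one_div_one_div, abs_of_pos hA]
  have hfrev : ∀ y, f y (Fin.rev i) = pair ν (F.dual.coords y) := by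
    intro y
    simp only [hf, hN, LinearMap.comp_apply, Matrix.toLin'_apply, Matrix.mulVec, dotProduct,
      Matrix.updateRow_self, Fin.sum_univ_three, pair, Matrix.cons_val]
    ring
  have hfne : ∀ y k, k ≠ Fin.rev i → f y k = F.dual.coords y k := by
    intro y k hk
    simp only [hf, hN, LinearMap.comp_apply, Matrix.toLin'_apply, Matrix.mulVec,
      Matrix.updateRow_ne hk]
    simp [dotProduct, Matrix.one_apply]
  -- The bounds 1/2, `s`, `s` multiply to the determinant. The form bounded by 1/2 takes integer
  -- values on ℤ³, so it vanishes at the vector found.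
  set s := Real.sqrt (2 * μ * F.A ^ 3) with hs
  have hspos : 0 < s := Real.sqrt_pos.2 (by positivity)
  have hs2 : s ^ 2 = 2 * μ * F.A ^ 3 := Real.sq_sqrt (by positivity)
  obtain ⟨w, hw, h⟩ := exists_int_of_linearForms f
    (by rw [← abs_pos, hfdet]; positivity) (fun k => if k = Fin.rev i then 1 / 2 else s)
    (fun k => by split_ifs <;> positivity) (by
      rw [hfdet]
      have : μ * F.A ^ 3 = 1 / 2 * s ^ 2 := by rw [hs2]; ring
      rw [this]
      apply le_of_eq
      fin_cases i <;> simp <;> ring)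
  have hpair : pair ν (F.dual.coords (toReal w)) = 0 := by
    have h1 := h (Fin.rev i)
    rw [hfrev, if_pos rfl, hν, F.pair_coords, ← cast_pair] at h1
    have h2 : |((pair v w : ℤ) : ℝ)| < 1 := by linarith
    have h3 : pair v w = 0 := Int.abs_lt_one_iff.1 (by exact_mod_cast h2)
    rw [hν, F.pair_coords, ← cast_pair, h3, Int.cast_zero]
  set ω := F.dual.coords (toReal w) with hω
  have hk : ∀ k, k ≠ Fin.rev i → |ω k| ≤ s := by
    intro k hk
    have := h k
    rwa [hfne _ _ hk, if_neg hk] at this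
  have hprod : ∀ k l, l ≠ Fin.rev i → |ν k * ω l| ≤ μ * s := fun k l hl => by
    rw [abs_mul]; exact mul_le_mul (hνle k) (hk l hl) (abs_nonneg _) hμ.le
  -- The coordinate left uncontrolled is recovered from orthogonality, dividing by the largest entry
  -- of `ν`.
  have hrev : |ω (Fin.rev i)| ≤ 2 * s := by
    have key : |ν i * ω (Fin.rev i)| ≤ 2 * (μ * s) := by
      simp only [pair] at hpair
      fin_cases i
      · have h1 := abs_le.1 (hprod 1 1 (by decide))
        have h2 := abs_le.1 (hprod 2 0 (by decide))
        change |ν 0 * ω 2| ≤ _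
        rw [abs_le]; constructor <;> linarith
      · have h1 := abs_le.1 (hprod 0 2 (by decide))
        have h2 := abs_le.1 (hprod 2 0 (by decide))
        change |ν 1 * ω 1| ≤ _
        rw [abs_le]; constructor <;> linarith
      · have h1 := abs_le.1 (hprod 1 1 (by decide))
        have h2 := abs_le.1 (hprod 0 2 (by decide))
        change |ν 2 * ω 0| ≤ _
        rw [abs_le]; constructor <;> linarith
    rw [abs_mul, hi] at key
    have : μ * |ω (Fin.rev i)| ≤ μ * (2 * s) := by linarith
    exact le_of_mul_le_mul_left this hμ
  have hnrm : F.dual.nrm w ≤ 2 * s := by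
    rw [nrm, pi_norm_le_iff_of_nonneg (by positivity)]
    intro k
    by_cases hk' : k = Fin.rev i
    · rw [hk']; exact hrev
    · exact (hk k hk').trans (by linarith)
  have hTs := (hdual w hw).trans hnrm
  calc T ^ 2 ≤ (2 * s) ^ 2 := by gcongr
    _ = 8 * F.A ^ 3 * μ := by rw [mul_pow, hs2]; ring

/-- If the dual lattice has no short vectors then the lattice has small covering radius. -/
theorem exists_int_near {T : ℝ} (hT : 0 < T)
    (hdual : ∀ w : Fin 3 → ℤ, w ≠ 0 → T ≤ F.dual.nrm w) (z : Fin 3 → ℝ) :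
    ∃ x : Fin 3 → ℤ, ‖F.coords (z - toReal x)‖ ≤ 6 / T := by
  have hA := pow_pos F.A_pos 3
  have hTA : T ≤ F.A := by
    obtain ⟨w, hw, h⟩ := F.dual.exists_nrm_le
    have : F.dual.A = 1 / F.A := rfl
    rw [this, one_div_one_div] at h
    exact (hdual w hw).trans h
  obtain ⟨v₁, hv₁, hmin⟩ := F.exists_min_nrm
  have hμ : 0 < F.nrm v₁ := F.nrm_pos hv₁
  have hμT : F.nrm v₁ ≤ 1 / T := by
    obtain ⟨v, hv, h⟩ := F.exists_nrm_le
    exact (hmin v hv).trans (h.trans (one_div_le_one_div_of_le hT hTA))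
  have hsq := F.sq_le_of_dual_nrm_ge hT hdual hv₁
  obtain ⟨i, hi⟩ := exists_norm_eq (F.coords (toReal v₁))
  -- Minkowski with bound `μ / 2` in the coordinate where `v₁` is largest: a vector parallel to `v₁`
  -- would then be shorter than the minimum. The inequality `hsq` keeps the other bound below `4 /
  -- T`.
  obtain ⟨v₂, hv₂, hv₂T, hind⟩ : ∃ v₂ : Fin 3 → ℤ, v₂ ≠ 0 ∧ F.nrm v₂ ≤ 4 / T ∧
      wedge v₁ v₂ ≠ 0 := by
    set μ := F.nrm v₁ with hμdef
    set s := Real.sqrt (2 / (μ * F.A ^ 3)) with hs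
    have hspos : 0 < s := Real.sqrt_pos.2 (by positivity)
    have hs2 : s ^ 2 = 2 / (μ * F.A ^ 3) := Real.sq_sqrt (by positivity)
    have hsT : s ≤ 4 / T := by
      refine le_of_sq_le_sq ?_ (by positivity)
      rw [hs2, div_pow, div_le_div_iff₀ (by positivity) (by positivity)]
      linarith
    obtain ⟨v₂, hv₂, h⟩ := exists_int_of_linearForms F.coords
      (by rw [F.det_coords]; positivity) (fun k => if k = i then μ / 2 else s)
      (fun k => by split_ifs <;> positivity) (by
        rw [F.det_coords, abs_of_pos (by positivity)]
        have : 1 / F.A ^ 3 = μ / 2 * s ^ 2 := by rw [hs2]; field_simp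
        rw [this]
        apply le_of_eq
        fin_cases i <;> simp <;> ring)
    refine ⟨v₂, hv₂, ?_, ?_⟩
    · rw [nrm, pi_norm_le_iff_of_nonneg (by positivity)]
      intro k
      refine (h k).trans ?_
      split_ifs
      · have : (1 : ℝ) / T ≤ 4 / T := by gcongr; norm_num
        linarith
      · exact hsT
    · intro h0
      have h1 := F.nrm_eq_abs_coord hv₁ h0 hi
      have h2 := h i
      rw [if_pos rfl, ← h1] at h2
      have h3 := hmin v₂ hv₂
      linarith
  -- `w'` is the primitive normal of the plane of `v₁`, `v₂`, and `v₃` steps from one parallel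
  -- lattice plane to the next.
  obtain ⟨d, w', v₃, hw', hv₃⟩ := exists_primitive hind
  have hw'0 : w' ≠ 0 := by
    rintro rfl
    simp [pair] at hv₃
  set n := ⌊pair z (toReal w')⌋ with hn
  set θ := pair z (toReal w') - n with hθ
  have hθ0 : 0 ≤ θ := sub_nonneg.2 (Int.floor_le _)
  have hθ1 : θ ≤ 1 := by have := Int.lt_floor_add_one (pair z (toReal w')); linarith
  -- A displacement of norm at most `1 / T` brings `z` onto the lattice plane of index `n`.
  obtain ⟨y, hy, hyT⟩ := exists_pair_eq (θ := θ) hT (hdual w' hw'0)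
    (abs_le.2 ⟨by linarith, hθ1⟩)
  obtain ⟨e, he⟩ := (LinearMap.injective_iff_surjective.1 F.coords_injective) y
  rw [← he, F.pair_coords] at hy
  have horth : pair (z - (n : ℝ) • toReal v₃ - e) (wedge (toReal v₁) (toReal v₂)) = 0 := by
    have h1 : pair (z - (n : ℝ) • toReal v₃ - e) (toReal w') = 0 := by
      have h2 : pair (toReal v₃) (toReal w') = 1 := by rw [← cast_pair, hv₃, Int.cast_one]
      have h3 : pair (z - (n : ℝ) • toReal v₃ - e) (toReal w')
        = pair z (toReal w') - n * pair (toReal v₃) (toReal w') - pair e (toReal w') := by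
        simp [pair]; ring
      rw [h3, h2, hy]; ring
    have h4 : wedge (toReal v₁) (toReal v₂) = (d : ℝ) • toReal w' := by
      rw [← toReal_wedge, hw', toReal_smul]
    rw [h4]
    have h5 : pair (z - (n : ℝ) • toReal v₃ - e) ((d : ℝ) • toReal w')
        = d * pair (z - (n : ℝ) • toReal v₃ - e) (toReal w') := by
      simp [pair]; ring
    rw [h5, h1, mul_zero]
  have hw : wedge (toReal v₁) (toReal v₂) ≠ 0 := by
    rw [← toReal_wedge]
    exact fun h => hind (toReal_eq_zero.1 h)
  obtain ⟨a, b, hab⟩ := exists_combination hw horth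
  -- `v₁` and `v₂` need not generate the lattice of the plane: rounding the two real coefficients is
  -- enough.
  refine ⟨n • v₃ + ⌊a⌋ • v₁ + ⌊b⌋ • v₂, ?_⟩
  have hz : z - toReal (n • v₃ + ⌊a⌋ • v₁ + ⌊b⌋ • v₂)
      = e + Int.fract a • toReal v₁ + Int.fract b • toReal v₂ := by
    have hz' : z = (n : ℝ) • toReal v₃ + e + (a • toReal v₁ + b • toReal v₂) := by
      rw [← hab]; abel
    rw [toReal_add, toReal_add, toReal_smul, toReal_smul, toReal_smul]
    conv_lhs => rw [hz']
    rw [Int.fract, Int.fract, sub_smul, sub_smul]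
    abel
  rw [hz, map_add, map_add, map_smul, map_smul, he]
  have h1 : ‖Int.fract a • F.coords (toReal v₁)‖ ≤ 1 / T := by
    rw [norm_smul, Real.norm_of_nonneg (Int.fract_nonneg a)]
    calc Int.fract a * F.nrm v₁ ≤ 1 * (1 / T) :=
          mul_le_mul (Int.fract_lt_one a).le hμT (F.nrm_nonneg _) zero_le_one
      _ = 1 / T := one_mul _
  have h2 : ‖Int.fract b • F.coords (toReal v₂)‖ ≤ 4 / T := by
    rw [norm_smul, Real.norm_of_nonneg (Int.fract_nonneg b)]
    calc Int.fract b * F.nrm v₂ ≤ 1 * (4 / T) :=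
          mul_le_mul (Int.fract_lt_one b).le hv₂T (F.nrm_nonneg _) zero_le_one
      _ = 4 / T := one_mul _
  calc ‖y + Int.fract a • F.coords (toReal v₁) + Int.fract b • F.coords (toReal v₂)‖
      ≤ ‖y‖ + ‖Int.fract a • F.coords (toReal v₁)‖ + ‖Int.fract b • F.coords (toReal v₂)‖ :=
        norm_add₃_le
    _ ≤ 1 / T + 1 / T + 4 / T := by gcongr
    _ = 6 / T := by ring

end Frame
-- Counting in one cell
namespace LegendrePair

variable {Λ : ℝ} (L : LegendrePair Λ)

theorem continuous_g : Continuous L.g := by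
  rw [continuous_iff_continuousAt]
  intro x
  rw [ContinuousAt, tendsto_iff_norm_sub_tendsto_zero]
  have h : Filter.Tendsto (fun y => |L.p x| * |y - x| + Λ * (y - x) ^ 2) (nhds x) (nhds 0) := by
    have hc : Continuous fun y => |L.p x| * |y - x| + Λ * (y - x) ^ 2 := by fun_prop
    have := hc.tendsto x
    simpa using this
  refine squeeze_zero (fun _ => norm_nonneg _) (fun y => ?_) h
  have h1 := L.g_taylor x y
  calc ‖L.g y - L.g x‖ = |L.p x * (y - x) + (L.g y - L.g x - L.p x * (y - x))| := by
        rw [Real.norm_eq_abs]; ring_nf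
    _ ≤ |L.p x * (y - x)| + |L.g y - L.g x - L.p x * (y - x)| := abs_add_le _ _
    _ ≤ _ := by rw [abs_mul]; linarith

/-- A small displacement in the frame moves a point near the curve by a small amount. -/
theorem abs_sub_le_of_displacement {α Q A κ : ℝ} (hQ : 0 < Q) (hA : 0 < A) (hκ : κ ≤ 1 / 8)
    {y y' : Fin 3 → ℝ} (h : ‖(L.frame α Q A hQ hA).coords (y' - y)‖ ≤ κ) (hy : Q / 4 ≤ y 0)
    (hyQ : y 0 ≤ 2 * Q) (hy' : Q / 4 ≤ y' 0) (hβ : |y 1 / y 0 - α| ≤ 2 * (A / Q)) :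
    |y' 0 - y 0| ≤ κ * Q ∧ |y' 1 / y' 0 - y 1 / y 0| ≤ 12 * κ * (A / Q) ∧
      |(y' 2 - y' 0 * L.g (y' 1 / y' 0)) - (y 2 - y 0 * L.g (y 1 / y 0))|
        ≤ 101 * Λ * κ * (A ^ 2 / Q) := by
  set F := L.frame α Q A hQ hA
  have hκ0 : 0 ≤ κ := (norm_nonneg _).trans h
  have hΛ := L.one_le
  have hc := fun i => (norm_le_pi_norm (F.coords (y' - y)) i).trans h
  have h0 := hc 0
  have h1 := hc 1
  have h2 := hc 2
  rw [F.coords_zero] at h0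
  rw [F.coords_one] at h1
  rw [F.coords_two] at h2
  simp only [Pi.sub_apply, Real.norm_eq_abs] at h0 h1 h2
  change |(y' 0 - y 0) / Q| ≤ κ at h0
  change |((y' 1 - y 1) - α * (y' 0 - y 0)) / A| ≤ κ at h1
  change |((y' 2 - y 2) - L.g α * (y' 0 - y 0) - L.p α * ((y' 1 - y 1) - α * (y' 0 - y 0))) * Q
    / A ^ 2| ≤ κ at h2
  rw [abs_div, abs_of_pos hQ, div_le_iff₀ hQ] at h0
  rw [abs_div, abs_of_pos hA, div_le_iff₀ hA] at h1
  rw [mul_div_assoc, abs_mul, abs_of_pos (div_pos hQ (pow_pos hA 2)),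
    ← le_div_iff₀ (div_pos hQ (pow_pos hA 2))] at h2
  have e2 : κ / (Q / A ^ 2) = κ * (A ^ 2 / Q) := by field_simp
  rw [e2] at h2
  have hq : 0 < y 0 := by linarith
  have hq' : 0 < y' 0 := by linarith
  set β := y 1 / y 0 with hβdef
  set β' := y' 1 / y' 0 with hβ'def
  set ω := A / Q with hω
  have hω0 : 0 < ω := by positivity
  have hωQ : ω * Q = A := by rw [hω]; field_simp
  have hω2 : ω ^ 2 * Q = A ^ 2 / Q := by rw [hω]; field_simp
  have ea : y 1 = β * y 0 := by rw [hβdef]; field_simp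
  have ea' : y' 1 = β' * y' 0 := by rw [hβ'def]; field_simp
  -- The factor 12 is 1 + 2, from the two terms on the right, divided by the lower bound 1/4 for `y'
  -- 0 / Q`.
  have hββ : |β' - β| ≤ 12 * κ * ω := by
    have e : (β' - β) * y' 0
        = ((y' 1 - y 1) - α * (y' 0 - y 0)) - (β - α) * (y' 0 - y 0) := by
      rw [ea, ea']; ring
    have h3 : |(β' - β) * y' 0| ≤ κ * A + 2 * ω * (κ * Q) := by
      rw [e]
      refine (abs_sub _ _).trans (add_le_add h1 ?_)
      rw [abs_mul]
      exact mul_le_mul hβ h0 (abs_nonneg _) (by positivity)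
    rw [abs_mul, abs_of_pos hq'] at h3
    have h4 : |β' - β| * (Q / 4) ≤ (12 * κ * ω) * (Q / 4) := by
      calc |β' - β| * (Q / 4) ≤ |β' - β| * y' 0 := by gcongr
        _ ≤ κ * A + 2 * ω * (κ * Q) := h3
        _ = (12 * κ * ω) * (Q / 4) := by rw [← hωQ]; ring
    exact le_of_mul_le_mul_right h4 (by positivity)
  refine ⟨h0, hββ, ?_⟩
  have hβ'α : |β' - α| ≤ 4 * ω := by
    calc |β' - α| = |(β' - β) + (β - α)| := by ring_nf
      _ ≤ 12 * κ * ω + 2 * ω := (abs_add_le _ _).trans (add_le_add hββ hβ)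
      _ ≤ 12 * (1 / 8) * ω + 2 * ω := by gcongr
      _ ≤ 4 * ω := by linarith
  have ht1 : |L.g β' - L.g α - L.p α * (β' - α)| ≤ 16 * Λ * ω ^ 2 := by
    refine (L.g_taylor α β').trans ?_
    have : (β' - α) ^ 2 ≤ (4 * ω) ^ 2 := by rw [← sq_abs]; gcongr
    nlinarith
  have ht2 : |L.g β' - L.g β - L.p β * (β' - β)| ≤ 18 * Λ * κ * ω ^ 2 := by
    refine (L.g_taylor β β').trans ?_
    have h3 : (β' - β) ^ 2 ≤ (12 * κ * ω) ^ 2 := by rw [← sq_abs]; gcongr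
    calc Λ * (β' - β) ^ 2 ≤ Λ * (12 * κ * ω) ^ 2 := by gcongr
      _ = 144 * Λ * κ * ω ^ 2 * κ := by ring
      _ ≤ 144 * Λ * κ * ω ^ 2 * (1 / 8) := by gcongr
      _ = _ := by ring
  have ht3 : |(L.p β - L.p α) * (β' - β)| ≤ 24 * Λ * κ * ω ^ 2 := by
    rw [abs_mul]
    calc |L.p β - L.p α| * |β' - β| ≤ (Λ * |β - α|) * (12 * κ * ω) :=
          mul_le_mul (L.p_lip _ _) hββ (abs_nonneg _) (by positivity)
      _ ≤ (Λ * (2 * ω)) * (12 * κ * ω) := by gcongr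
      _ = _ := by ring
  -- The change is split into its tangential part, the remainder at `α` times the change of `q`, and
  -- `q` times the remainder at `β` plus the change of slope. Together they cost 1 + 16 Λ + 84 Λ ≤
  -- 101 Λ.
  have e : (y' 2 - y' 0 * L.g β') - (y 2 - y 0 * L.g β)
      = ((y' 2 - y 2) - L.g α * (y' 0 - y 0) - L.p α * ((y' 1 - y 1) - α * (y' 0 - y 0)))
        - ((y' 0 - y 0) * (L.g β' - L.g α - L.p α * (β' - α))
          + y 0 * ((L.g β' - L.g β - L.p β * (β' - β)) + (L.p β - L.p α) * (β' - β))) := by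
    rw [ea, ea']; ring
  rw [e]
  have h5 : |(y' 0 - y 0) * (L.g β' - L.g α - L.p α * (β' - α))| ≤ κ * Q * (16 * Λ * ω ^ 2) := by
    rw [abs_mul]; exact mul_le_mul h0 ht1 (abs_nonneg _) (by positivity)
  have h6 : |y 0 * ((L.g β' - L.g β - L.p β * (β' - β)) + (L.p β - L.p α) * (β' - β))|
      ≤ 2 * Q * (42 * Λ * κ * ω ^ 2) := by
    rw [abs_mul, abs_of_pos hq]
    refine mul_le_mul hyQ ((abs_add_le _ _).trans ?_) (abs_nonneg _) (by positivity)
    linarith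
  calc _ ≤ κ * (A ^ 2 / Q) + (κ * Q * (16 * Λ * ω ^ 2) + 2 * Q * (42 * Λ * κ * ω ^ 2)) :=
        (abs_sub _ _).trans (add_le_add h2 ((abs_add_le _ _).trans (add_le_add h5 h6)))
    _ = (1 + 100 * Λ) * κ * (ω ^ 2 * Q) := by rw [← hω2]; ring
    _ ≤ 101 * Λ * κ * (ω ^ 2 * Q) := by gcongr; linarith
    _ = _ := by rw [hω2]

theorem mem_curvedRegion_iff {g : ℝ → ℝ} {Q₁ Q₂ u v d : ℝ} (hQ₁ : 0 ≤ Q₁) {y : Fin 3 → ℝ} :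
    y ∈ curvedRegion g Q₁ Q₂ u v d ↔ Q₁ < y 0 ∧ y 0 ≤ Q₂ ∧ u < y 1 / y 0 ∧ y 1 / y 0 ≤ v ∧
      |y 2 - y 0 * g (y 1 / y 0)| < d := by
  simp only [curvedRegion, Set.mem_ofPred_eq]
  refine and_congr_right fun h => ?_
  have hy : 0 < y 0 := lt_of_le_of_lt hQ₁ h
  rw [lt_div_iff₀ hy, div_le_iff₀ hy]

/-- The number of lattice points in a cell near the curve, when the dual lattice has no short
vectors. -/
theorem abs_card_sub_le_of_dual_not_short {α Q A ω T : ℝ} (hQ : 0 < Q) (hA : 0 < A) (hω : 0 ≤ ω)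
    (hωA : ω ≤ A / Q) (hT : 606 * Λ ≤ T)
    (hdual : ∀ w : Fin 3 → ℤ, w ≠ 0 → T ≤ (L.frame α Q A hQ hA).dual.nrm w)
    (S : Finset (Fin 3 → ℤ))
    (hS : ∀ x, x ∈ S ↔ toReal x ∈ curvedRegion L.g (Q / 2) Q α (α + ω) (A ^ 2 / Q)) :
    |(S.card : ℝ) - 3 / 4 * (A ^ 2 / Q) * ω * Q ^ 2| ≤ 960 * Λ * (A ^ 3 / T) := by
  set F := L.frame α Q A hQ hA
  have hΛ := L.one_le
  have hT0 : 0 < T := by linarith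
  -- The covering radius. The threshold 606 = 6 · 101 is what makes `101 Λ κ ≤ 1`, so the shrunk
  -- tolerance stays nonnegative.
  set κ := 6 / T with hκ
  have hκ0 : 0 < κ := by positivity
  have hcκ : 101 * Λ * κ ≤ 1 := by
    rw [hκ, mul_div_assoc', div_le_one hT0]; linarith
  have hκ1 : 101 * κ ≤ 1 := by nlinarith
  have hcov := F.exists_int_near hT0 hdual
  set W := A / Q with hW
  have hW0 : 0 < W := by positivity
  set δ := A ^ 2 / Q with hδ
  have hδ0 : 0 < δ := by positivity
  have hV : δ * W * Q ^ 2 = A ^ 3 := by rw [hδ, hW]; field_simp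
  have hκT : 960 * Λ * (A ^ 3 / T) = 160 * Λ * κ * W * (δ * Q ^ 2) := by
    rw [← hV, hκ]; ring
  have hgm := L.continuous_g.measurable
  rw [hκT]
  set c := 101 * Λ with hc
  have hc0 : 0 < c := by positivity
  have hc101 : 101 ≤ c := by linarith
  have h12 : 12 * κ * W ≤ 1 / 8 * W := by gcongr; linarith
  have hκQ : κ * Q ≤ 1 / 8 * Q := by gcongr; linarith
  have hκQ0 : 0 < κ * Q := by positivity
  have hκW0 : 0 < κ * W := by positivity
  rw [abs_le]
  constructor
  -- A cell this narrow leaves nothing after shrinking, but then the main term is itself below the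
  -- error.
  · rcases lt_or_ge ω (24 * κ * W) with hsmall | hlarge
    · have h1 : (0 : ℝ) ≤ S.card := Nat.cast_nonneg _
      have h2 : 3 / 4 * δ * ω * Q ^ 2 ≤ 3 / 4 * δ * (24 * κ * W) * Q ^ 2 := by gcongr
      have h3 : 3 / 4 * δ * (24 * κ * W) * Q ^ 2 = 18 * κ * W * (δ * Q ^ 2) := by ring
      have h4 : 18 * κ * W * (δ * Q ^ 2) ≤ 160 * Λ * κ * W * (δ * Q ^ 2) := by
        gcongr; linarith
      linarith
    · have hvol := volume_le_card (measurableSet_curvedRegion hgm (Q / 2 + κ * Q) (Q - κ * Q)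
        (α + 12 * κ * W) (α + ω - 12 * κ * W) (δ * (1 - c * κ))) S (by
        intro z
        obtain ⟨x₀, hx₀⟩ := hcov z
        refine ⟨x₀, fun x hx => ?_⟩
        rw [hS, mem_curvedRegion_iff (by positivity)]
        rw [mem_curvedRegion_iff (by positivity)] at hx
        set y := toReal (x - x₀) + z with hy
        obtain ⟨h1, h2, h3, h4, h5⟩ := hx
        have hdiff : ‖F.coords (toReal x - y)‖ ≤ κ := by
          have : toReal x - y = -(z - toReal x₀) := by rw [hy, toReal_sub]; abel
          rw [this, map_neg, norm_neg]; exact hx₀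
        have hq' : |toReal x 0 - y 0| ≤ κ * Q := by
          have h6 := (norm_le_pi_norm (F.coords (toReal x - y)) 0).trans hdiff
          rw [F.coords_zero, Real.norm_eq_abs, abs_div] at h6
          change |(toReal x - y) 0| / |Q| ≤ κ at h6
          rwa [abs_of_pos hQ, div_le_iff₀ hQ] at h6
        have hq'' := abs_le.1 hq'
        obtain ⟨-, h7, h8⟩ := L.abs_sub_le_of_displacement hQ hA (by linarith) hdiff
          (by linarith) (by linarith) (by linarith)
          (by rw [abs_le]; constructor <;> linarith)
        have h7' := abs_le.1 h7
        refine ⟨by linarith, by linarith, by linarith, by linarith, ?_⟩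
        calc |toReal x 2 - toReal x 0 * L.g (toReal x 1 / toReal x 0)|
            = |((toReal x 2 - toReal x 0 * L.g (toReal x 1 / toReal x 0))
              - (y 2 - y 0 * L.g (y 1 / y 0))) + (y 2 - y 0 * L.g (y 1 / y 0))| := by ring_nf
          _ ≤ _ := abs_add_le _ _
          _ < c * κ * δ + δ * (1 - c * κ) := add_lt_add_of_le_of_lt h8 h5
          _ = δ := by ring)
      rw [volume_curvedRegion hgm (by positivity) (by linarith) (by linarith)
        (mul_nonneg hδ0.le (by linarith))] at hvol
      have hvol' := ENNReal.toReal_mono (by simp) hvol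
      rw [ENNReal.toReal_natCast, ENNReal.toReal_ofReal'] at hvol'
      have hvol'' := (le_max_left _ _).trans hvol'
      have e : δ * (1 - c * κ) * (α + ω - 12 * κ * W - (α + 12 * κ * W))
          * ((Q - κ * Q) ^ 2 - (Q / 2 + κ * Q) ^ 2)
          = (1 - c * κ) * (ω - 24 * κ * W) * (3 / 4 * (1 - 4 * κ)) * (δ * Q ^ 2) := by ring
      rw [e] at hvol''
      have h1 : 3 / 4 * ω - 160 * Λ * κ * W
          ≤ (1 - c * κ) * (ω - 24 * κ * W) * (3 / 4 * (1 - 4 * κ)) := by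
        have h2 : 1 - (c + 4) * κ ≤ (1 - c * κ) * (1 - 4 * κ) := by nlinarith [mul_pos hc0 hκ0]
        have h3 : (ω - 24 * κ * W) * (1 - (c + 4) * κ)
            ≤ (ω - 24 * κ * W) * ((1 - c * κ) * (1 - 4 * κ)) :=
          mul_le_mul_of_nonneg_left h2 (by linarith)
        have h4 : (ω - 24 * κ * W) * ((c + 4) * κ) ≤ W * ((c + 4) * κ) := by
          gcongr; linarith
        have h5 : (c + 28) * (κ * W) ≤ 160 * Λ * (κ * W) := by gcongr; linarith
        nlinarith
      have h2 : (3 / 4 * ω - 160 * Λ * κ * W) * (δ * Q ^ 2) ≤ S.card :=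
        (mul_le_mul_of_nonneg_right h1 (by positivity)).trans hvol''
      linarith
  · have hvol := card_le_volume (measurableSet_curvedRegion hgm (Q / 2 - κ * Q) (Q + κ * Q)
        (α - 12 * κ * W) (α + ω + 12 * κ * W) (δ * (1 + c * κ))) S (by
        intro z
        obtain ⟨x₀, hx₀⟩ := hcov z
        refine ⟨x₀, fun x hx => ?_⟩
        rw [hS, mem_curvedRegion_iff (by positivity)] at hx
        rw [mem_curvedRegion_iff (by linarith)]
        set y := toReal (x - x₀) + z with hy
        obtain ⟨h1, h2, h3, h4, h5⟩ := hx
        have hdiff : ‖F.coords (y - toReal x)‖ ≤ κ := by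
          have : y - toReal x = z - toReal x₀ := by rw [hy, toReal_sub]; abel
          rw [this]; exact hx₀
        have hq' : |y 0 - toReal x 0| ≤ κ * Q := by
          have h6 := (norm_le_pi_norm (F.coords (y - toReal x)) 0).trans hdiff
          rw [F.coords_zero, Real.norm_eq_abs, abs_div] at h6
          change |(y - toReal x) 0| / |Q| ≤ κ at h6
          rwa [abs_of_pos hQ, div_le_iff₀ hQ] at h6
        have hq'' := abs_le.1 hq'
        obtain ⟨-, h7, h8⟩ := L.abs_sub_le_of_displacement hQ hA (by linarith) hdiff
          (by linarith) (by linarith) (by linarith)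
          (by rw [abs_le]; constructor <;> linarith)
        have h7' := abs_le.1 h7
        refine ⟨by linarith, by linarith, by linarith, by linarith, ?_⟩
        calc |y 2 - y 0 * L.g (y 1 / y 0)|
            = |((y 2 - y 0 * L.g (y 1 / y 0))
              - (toReal x 2 - toReal x 0 * L.g (toReal x 1 / toReal x 0)))
              + (toReal x 2 - toReal x 0 * L.g (toReal x 1 / toReal x 0))| := by ring_nf
          _ ≤ _ := abs_add_le _ _
          _ < c * κ * δ + δ := add_lt_add_of_le_of_lt h8 h5
          _ = δ * (1 + c * κ) := by ring)
    rw [volume_curvedRegion hgm (by linarith) (by linarith) (by linarith)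
        (by positivity)] at hvol
    have hvol' := ENNReal.toReal_mono (by simp) hvol
    have e : δ * (1 + c * κ) * (α + ω + 12 * κ * W - (α - 12 * κ * W))
          * ((Q + κ * Q) ^ 2 - (Q / 2 - κ * Q) ^ 2)
          = (1 + c * κ) * (ω + 24 * κ * W) * (3 / 4 * (1 + 4 * κ)) * (δ * Q ^ 2) := by ring
    rw [ENNReal.toReal_natCast, e, ENNReal.toReal_ofReal (by positivity)] at hvol'
    have h1 : (1 + c * κ) * (ω + 24 * κ * W) * (3 / 4 * (1 + 4 * κ))
        ≤ 3 / 4 * ω + 160 * Λ * κ * W := by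
      have hcκ4 : c * κ * (4 * κ) ≤ 1 * (4 * κ) := by gcongr
      have h2 : (1 + c * κ) * (1 + 4 * κ) ≤ 1 + (c + 8) * κ := by
        calc _ = 1 + c * κ + 4 * κ + c * κ * (4 * κ) := by ring
          _ ≤ 1 + c * κ + 4 * κ + 1 * (4 * κ) := by linarith only [hcκ4]
          _ = _ := by ring
      have h2' : (1 + c * κ) * (1 + 4 * κ) ≤ 3 := by
        refine h2.trans ?_
        rw [add_mul]
        linarith only [hcκ, hκ1]
      have h3 : ω * ((1 + c * κ) * (1 + 4 * κ)) ≤ ω * (1 + (c + 8) * κ) :=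
        mul_le_mul_of_nonneg_left h2 hω
      have h3' : 24 * (κ * W) * ((1 + c * κ) * (1 + 4 * κ)) ≤ 24 * (κ * W) * 3 :=
        mul_le_mul_of_nonneg_left h2' (by linarith only [hκW0])
      have h4 : ω * ((c + 8) * κ) ≤ W * ((c + 8) * κ) :=
        mul_le_mul_of_nonneg_right hωA (mul_nonneg (by linarith only [hc0]) hκ0.le)
      have h5 : (c + 80) * (κ * W) ≤ 200 * Λ * (κ * W) :=
        mul_le_mul_of_nonneg_right (by linarith only [hc, hΛ]) hκW0.le
      have e1 : (1 + c * κ) * (ω + 24 * κ * W) * (3 / 4 * (1 + 4 * κ))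
          = 3 / 4 * (ω * ((1 + c * κ) * (1 + 4 * κ))
            + 24 * (κ * W) * ((1 + c * κ) * (1 + 4 * κ))) := by ring
      have e2 : ω * (1 + (c + 8) * κ) = ω + ω * ((c + 8) * κ) := by ring
      have e3 : W * ((c + 8) * κ) + 24 * (κ * W) * 3 = (c + 80) * (κ * W) := by ring
      have e4 : 160 * Λ * κ * W = 160 * (Λ * (κ * W)) := by ring
      have e5 : 200 * Λ * (κ * W) = 200 * (Λ * (κ * W)) := by ring
      have e6 : 0 < Λ * (κ * W) := mul_pos (by linarith only [hΛ]) hκW0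
      linarith only [h3, h3', h4, h5, e1, e2, e3, e4, e5, e6]
    have h2 := hvol'.trans (mul_le_mul_of_nonneg_right h1 (by positivity))
    linarith

/-- The number of lattice points in a cell near the curve, in terms of the shortest vectors of the
lattice and of its dual. -/
theorem exists_abs_card_sub_le (hΛ : 1 ≤ Λ) : ∃ C : ℝ, 0 ≤ C ∧ ∀ (L : LegendrePair Λ) (α Q A ω : ℝ)
    (hQ : 0 < Q) (hA : 0 < A), 0 ≤ ω → ω ≤ A / Q → ∀ S : Finset (Fin 3 → ℤ),
    (∀ x, x ∈ S ↔ toReal x ∈ curvedRegion L.g (Q / 2) Q α (α + ω) (A ^ 2 / Q)) →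
    ∃ v w : Fin 3 → ℤ, v ≠ 0 ∧ w ≠ 0 ∧ |(S.card : ℝ) - 3 / 4 * (A ^ 2 / Q) * ω * Q ^ 2|
      ≤ C * (1 + 1 / (L.frame α Q A hQ hA).nrm v + A ^ 3 / (L.frame α Q A hQ hA).dual.nrm w) := by
  set ρ := 1 + Λ with hρ
  set C₁ := (1 + 6 * ρ * (606 * Λ)) * (1 + 2 * ρ + 16 * ρ ^ 2) with hC₁
  have hC₁pos : 0 ≤ C₁ := by positivity
  refine ⟨C₁ + 960 * Λ, by positivity, ?_⟩
  intro L α Q A ω hQ hA hω hωA S hS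
  set F := L.frame α Q A hQ hA
  obtain ⟨v, hv, hvmin⟩ := F.exists_min_nrm
  obtain ⟨w, hw, hwmin⟩ := F.dual.exists_min_nrm
  refine ⟨v, w, hv, hw, ?_⟩
  have hvpos := F.nrm_pos hv
  have hwpos := F.dual.nrm_pos hw
  have hA3 := pow_pos hA 3
  rcases le_total (606 * Λ) (F.dual.nrm w) with hlong | hshort
  · refine (L.abs_card_sub_le_of_dual_not_short hQ hA hω hωA hlong hwmin S hS).trans ?_
    have h1 : A ^ 3 / F.dual.nrm w ≤ 1 + 1 / F.nrm v + A ^ 3 / F.dual.nrm w := by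
      have : 0 ≤ 1 + 1 / F.nrm v := by positivity
      linarith
    exact mul_le_mul (by linarith) h1 (by positivity) (by positivity)
  · have hmem : ∀ x ∈ S, F.nrm x ≤ ρ := by
      intro x hx
      rw [hS, mem_curvedRegion_iff (by positivity)] at hx
      obtain ⟨h1, h2, h3, h4, h5⟩ := hx
      simp only [toReal_apply] at h1 h2 h3 h4 h5
      have hq : (0 : ℝ) < x 0 := by linarith
      have hβ : |(x 1 : ℝ) / x 0 - α| ≤ A / Q := by
        rw [abs_le]; constructor <;> linarith [div_pos hA hQ]
      rw [Frame.nrm, pi_norm_le_iff_of_nonneg (by positivity)]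
      intro i
      fin_cases i
      · change |F.coords (toReal x) 0| ≤ ρ
        rw [Frame.coords_zero]
        change |(x 0 : ℝ) / Q| ≤ ρ
        rw [abs_of_pos (by positivity)]
        exact ((div_le_one hQ).2 h2).trans (by linarith)
      · change |F.coords (toReal x) 1| ≤ ρ
        rw [Frame.coords_one]
        change |((x 1 : ℝ) - α * x 0) / A| ≤ ρ
        have : ((x 1 : ℝ) - α * x 0) / A = ((x 1 : ℝ) / x 0 - α) * x 0 / A := by
          field_simp
        rw [this, abs_div, abs_mul, abs_of_pos hq, abs_of_pos hA, div_le_iff₀ hA]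
        calc |(x 1 : ℝ) / x 0 - α| * x 0 ≤ A / Q * Q := by gcongr
          _ = 1 * A := by field_simp
          _ ≤ ρ * A := by gcongr; linarith
      · change |F.coords (toReal x) 2| ≤ ρ
        rw [Frame.coords_two]
        change |((x 2 : ℝ) - L.g α * x 0 - L.p α * (x 1 - α * x 0)) * Q / A ^ 2| ≤ ρ
        have ht := L.g_taylor α ((x 1 : ℝ) / x 0)
        have e : ((x 2 : ℝ) - L.g α * x 0 - L.p α * (x 1 - α * x 0)) * Q / A ^ 2
            = (((x 2 : ℝ) - x 0 * L.g (x 1 / x 0))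
              + (L.g (x 1 / x 0) - L.g α - L.p α * ((x 1 : ℝ) / x 0 - α)) * x 0)
                / (A ^ 2 / Q) := by
          field_simp; ring
        have hδ : 0 < A ^ 2 / Q := by positivity
        rw [e, abs_div, abs_of_pos hδ, div_le_iff₀ hδ]
        refine (abs_add_le _ _).trans ?_
        have h6 : |(L.g (x 1 / x 0) - L.g α - L.p α * ((x 1 : ℝ) / x 0 - α)) * x 0|
            ≤ Λ * (A ^ 2 / Q) := by
          rw [abs_mul, abs_of_pos hq]
          have h7 : Λ * ((x 1 : ℝ) / x 0 - α) ^ 2 ≤ Λ * (A / Q) ^ 2 := by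
            rw [← sq_abs]; gcongr
          calc _ ≤ Λ * (A / Q) ^ 2 * Q := mul_le_mul (ht.trans h7) h2 hq.le (by positivity)
            _ = Λ * (A ^ 2 / Q) := by field_simp
        rw [hρ, add_mul, one_mul]
        linarith
    have hcard := F.card_le_of_dual_short (by positivity) (by positivity) S hmem hv hvmin hw hwmin
      hshort
    change (S.card : ℝ) ≤ C₁ * (1 + 1 / F.nrm v + A ^ 3 / F.dual.nrm w) at hcard
    -- When `w` is short, `A³` is at most a multiple of `A³ / |w|`, so the main term is also part of
    -- the error.
    have hmain : 3 / 4 * (A ^ 2 / Q) * ω * Q ^ 2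
        ≤ 960 * Λ * (1 + 1 / F.nrm v + A ^ 3 / F.dual.nrm w) := by
      have h1 : A ^ 3 ≤ 606 * Λ * (A ^ 3 / F.dual.nrm w) := by
        rw [mul_div_assoc', le_div_iff₀ hwpos, mul_comm]
        gcongr
      have h2 : 0 ≤ 1 / F.nrm v := by positivity
      have h3 : 0 ≤ A ^ 3 / F.dual.nrm w := by positivity
      calc 3 / 4 * (A ^ 2 / Q) * ω * Q ^ 2 ≤ 3 / 4 * (A ^ 2 / Q) * (A / Q) * Q ^ 2 := by gcongr
        _ = 3 / 4 * A ^ 3 := by field_simp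
        _ ≤ 606 * Λ * (A ^ 3 / F.dual.nrm w) := by linarith
        _ ≤ 960 * Λ * (1 + 1 / F.nrm v + A ^ 3 / F.dual.nrm w) :=
          mul_le_mul (by linarith) (by linarith) h3 (by positivity)
    have hm0 : 0 ≤ 3 / 4 * (A ^ 2 / Q) * ω * Q ^ 2 := by positivity
    have hc0 : (0 : ℝ) ≤ S.card := Nat.cast_nonneg _
    have hpos : 0 ≤ C₁ * (1 + 1 / F.nrm v + A ^ 3 / F.dual.nrm w) := by positivity
    rw [add_mul, abs_le]
    constructor <;> linarith

end LegendrePair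
-- Summation over cells in a dyadic block
namespace LegendrePair

variable {Λ : ℝ}

/-- The interval `(η, ξ]` is cut into `n` cells of equal length `ω ≤ W`, which are separated by at
least `W / 2` unless there is only one. -/
theorem exists_cells {R W : ℝ} (hR : 0 < R) (hW : 0 < W) : ∃ (n : ℕ) (ω : ℝ), 0 < n ∧ 0 < ω ∧
    (n : ℝ) * ω = R ∧ ω ≤ W ∧ (n : ℝ) ≤ R / W + 1 ∧
    ∀ i < n, ∀ j < n, i ≠ j → 1 / 2 * W ≤ |(i : ℝ) * ω - j * ω| := by
  have hRW : 0 < R / W := div_pos hR hW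
  have hn : 0 < ⌈R / W⌉₊ := Nat.ceil_pos.2 hRW
  set n := ⌈R / W⌉₊ with hn'
  have hnR : (0 : ℝ) < n := by exact_mod_cast hn
  have hle : R / W ≤ n := Nat.le_ceil _
  have hlt : (n : ℝ) < R / W + 1 := Nat.ceil_lt_add_one hRW.le
  have hω : 0 < R / n := div_pos hR hnR
  refine ⟨n, R / n, hn, hω, by field_simp, ?_, hlt.le, ?_⟩
  · rw [div_le_iff₀ hnR, mul_comm]
    exact (div_le_iff₀ hW).1 hle
  · intro i hi j hj hij
    have h2 : (2 : ℝ) ≤ n := by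
      have : 2 ≤ n := by omega
      exact_mod_cast this
    have hdist : (1 : ℝ) ≤ |(i : ℝ) - j| := by
      have h3 : (1 : ℤ) ≤ |(i : ℤ) - j| := Int.one_le_abs (by omega)
      have h4 : ((1 : ℤ) : ℝ) ≤ ((|(i : ℤ) - j| : ℤ) : ℝ) := Int.cast_le.2 h3
      simpa using h4
    -- From `n - 1 < R / W` and `n ≤ 2 (n - 1)`.
    have hhalf : 1 / 2 * W ≤ R / n := by
      rw [le_div_iff₀ hnR]
      have h3 : (n - 1) * W < R := by
        rw [← lt_div_iff₀ hW]; linarith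
      nlinarith
    rw [← sub_mul, abs_mul, abs_of_pos hω]
    exact hhalf.trans (le_mul_of_one_le_left hω.le hdist)

/-- The points of a finite set near the curve, sorted into cells. -/
theorem card_eq_sum_card_cells {g : ℝ → ℝ} {Q₁ Q₂ η ω d : ℝ} {n : ℕ} (hQ₁ : 0 ≤ Q₁)
    (hω : 0 < ω) (S : Finset (Fin 3 → ℤ))
    (hS : ∀ x, x ∈ S ↔ toReal x ∈ curvedRegion g Q₁ Q₂ η (η + n * ω) d) :
    ∃ T : ℕ → Finset (Fin 3 → ℤ), S.card = ∑ m ∈ Finset.range n, (T m).card ∧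
      ∀ m < n, ∀ x, x ∈ T m ↔
        toReal x ∈ curvedRegion g Q₁ Q₂ (η + m * ω) (η + m * ω + ω) d := by
  classical
  -- The cells are open on the left and closed on the right, hence the ceiling minus one.
  set φ : (Fin 3 → ℤ) → ℕ := fun x => ⌈(toReal x 1 / toReal x 0 - η) / ω⌉₊ - 1 with hφ
  have hφiff : ∀ x, η < toReal x 1 / toReal x 0 → ∀ m : ℕ, φ x = m ↔
      η + m * ω < toReal x 1 / toReal x 0 ∧ toReal x 1 / toReal x 0 ≤ η + m * ω + ω := by
    intro x hx m
    have hpos : 0 < (toReal x 1 / toReal x 0 - η) / ω := div_pos (by linarith) hω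
    have h0 : 0 < ⌈(toReal x 1 / toReal x 0 - η) / ω⌉₊ := Nat.ceil_pos.2 hpos
    have h1 : φ x = m ↔ ⌈(toReal x 1 / toReal x 0 - η) / ω⌉₊ = m + 1 := by
      rw [hφ]; dsimp only; omega
    rw [h1, Nat.ceil_eq_iff (by omega), lt_div_iff₀ hω, div_le_iff₀ hω]
    push_cast
    constructor
    · rintro ⟨h2, h3⟩; constructor <;> linarith
    · rintro ⟨h2, h3⟩; constructor <;> linarith
  refine ⟨fun m => {x ∈ S | φ x = m}, ?_, ?_⟩
  · refine Finset.card_eq_sum_card_fiberwise ?_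
    intro x hx
    rw [Finset.mem_coe, hS, mem_curvedRegion_iff hQ₁] at hx
    obtain ⟨-, -, h1, h2, -⟩ := hx
    have h3 := ((hφiff x h1 _).1 rfl).1
    have h4 : ((φ x : ℕ) : ℝ) * ω < n * ω := by linarith
    have h5 : ((φ x : ℕ) : ℝ) < n := lt_of_mul_lt_mul_right h4 hω.le
    simpa using h5
  · intro m hm x
    have hm1 : ((m : ℝ) + 1) * ω ≤ n * ω := by
      have : (m : ℝ) + 1 ≤ n := by exact_mod_cast hm
      gcongr
    have hm0 : 0 ≤ (m : ℝ) * ω := by positivity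
    rw [Finset.mem_filter, hS, mem_curvedRegion_iff hQ₁, mem_curvedRegion_iff hQ₁]
    constructor
    · rintro ⟨⟨h1, h2, h3, h4, h5⟩, h6⟩
      obtain ⟨h7, h8⟩ := (hφiff x h3 m).1 h6
      exact ⟨h1, h2, h7, h8, h5⟩
    · rintro ⟨h1, h2, h3, h4, h5⟩
      have h6 : η < toReal x 1 / toReal x 0 := by linarith
      exact ⟨⟨h1, h2, h6, by linarith, h5⟩, (hφiff x h6 m).2 ⟨h3, h4⟩⟩

/-- The number of lattice points near the curve in a dyadic range of denominators. -/
theorem exists_abs_card_block_sub_le (hΛ : 1 ≤ Λ) {η ξ ε : ℝ} (hηξ : η < ξ) (hε : 0 < ε) :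
    ∃ C : ℝ, 0 ≤ C ∧ ∀ (L : LegendrePair Λ) (Q A : ℝ), 1 ≤ A → A ^ 2 ≤ Q →
    ∀ S : Finset (Fin 3 → ℤ),
    (∀ x, x ∈ S ↔ toReal x ∈ curvedRegion L.g (Q / 2) Q η ξ (A ^ 2 / Q)) →
    |(S.card : ℝ) - 3 / 4 * (A ^ 2 / Q) * (ξ - η) * Q ^ 2| ≤ C * (Q ^ (1 + ε) * A) := by
  obtain ⟨C, hC, hcell⟩ := exists_abs_card_sub_le hΛ
  obtain ⟨K, hK, hcount⟩ := exists_countBound hΛ hε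
  set R := ξ - η with hR
  have hR0 : 0 < R := sub_pos.2 hηξ
  set B := ((2 : ℝ) ^ ε / ((2 : ℝ) ^ ε - 1)) ^ 2 with hB
  have hB0 : 0 ≤ B := sq_nonneg _
  set P := 6 / (1 / 2 : ℝ) * (2 * R + 5) * B * K with hP
  set D := 6 * Λ / (1 / 2 : ℝ) * (2 * (Λ * R) + 5) * B * K with hD
  have hP0 : 0 ≤ P := by positivity
  have hD0 : 0 ≤ D := by positivity
  refine ⟨C * (5 * (R + 1) + P + D), by positivity, ?_⟩
  intro L Q A hA1 hAQ S hS
  have hA : 0 < A := by linarith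
  have hAA : A ≤ A ^ 2 := by nlinarith
  have hQ1 : 1 ≤ Q := by linarith
  have hQ : 0 < Q := by linarith
  obtain ⟨n, ω, hn, hω, hnω, hωW, hnle, hsep⟩ := exists_cells hR0 (div_pos hA hQ)
  have hnR : (0 : ℝ) < n := by exact_mod_cast hn
  have hξ : ξ = η + n * ω := by rw [hnω, hR]; ring
  rw [hξ] at hS
  obtain ⟨T, hcard, hT⟩ := card_eq_sum_card_cells (by positivity) hω S hS
  have hex : ∀ m : ℕ, ∃ vw : (Fin 3 → ℤ) × (Fin 3 → ℤ), m < n → vw.1 ≠ 0 ∧ vw.2 ≠ 0 ∧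
      |((T m).card : ℝ) - 3 / 4 * (A ^ 2 / Q) * ω * Q ^ 2|
      ≤ C * (1 + 1 / (L.frame (η + m * ω) Q A hQ hA).nrm vw.1
        + A ^ 3 / (L.frame (η + m * ω) Q A hQ hA).dual.nrm vw.2) := by
    intro m
    by_cases hm : m < n
    · obtain ⟨v, w, h⟩ := hcell L (η + m * ω) Q A ω hQ hA hω.le hωW (T m) (hT m hm)
      exact ⟨(v, w), fun _ => h⟩
    · exact ⟨0, fun h => absurd h hm⟩
  choose vw hvw using hex
  set M := Finset.range n with hM
  have hMcard : (M.card : ℝ) = n := by rw [hM, Finset.card_range]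
  have hαu : ∀ m ∈ M, |η + m * ω - η| ≤ R := by
    intro m hm
    have hm' : (m : ℝ) ≤ n := by exact_mod_cast (Finset.mem_range.1 hm).le
    rw [add_sub_cancel_left, abs_of_nonneg (by positivity), ← hnω]
    gcongr
  have hsep' : ∀ m ∈ M, ∀ m' ∈ M, m ≠ m' →
      1 / 2 * A / Q ≤ |(η + (m : ℝ) * ω) - (η + (m' : ℝ) * ω)| := by
    intro m hm m' hm' hne
    rw [add_sub_add_left_eq_sub, mul_div_assoc]
    exact hsep m (Finset.mem_range.1 hm) m' (Finset.mem_range.1 hm') hne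
  -- Up to the factor 2, `r = 1 / (2 A)` is the limit allowed by `r A < 1`; likewise `r = A / 2` for
  -- the dual frames, whose scale is `1 / A`.
  have hprimal := sum_one_div_nrm_le (L := L) hK hε M (fun m : ℕ => η + m * ω) (u := η) (ℓ := R)
    (σ := 1 / 2) (Q := Q) (A := A) (r := 1 / (2 * A)) hQ hA (by positivity)
    (by rw [one_div_mul_eq_div, div_lt_one (by positivity)]; linarith)
    (by rw [one_div_mul_eq_div, div_lt_iff₀ (by positivity)]; nlinarith)
    hR0.le hαu (by norm_num) (by norm_num) hsep' (fun e _ => hcount e L) (fun m => (vw m).1)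
    (fun m hm => (hvw m (Finset.mem_range.1 hm)).1)
  have hdual := L.sum_one_div_dual_nrm_le hK hε M (fun m : ℕ => η + m * ω) (u := η) (ℓ := R)
    (σ := 1 / 2) (Q := Q) (A := A) (r := A / 2) hQ hA (by positivity) (by linarith) (by linarith)
    hR0.le hαu (by norm_num) (by norm_num) hsep' (fun e _ => hcount e L.swap) (fun m => (vw m).2)
    (fun m hm => (hvw m (Finset.mem_range.1 hm)).2.1)
  rw [hMcard, ← hB, ← hP] at hprimal
  rw [hMcard, ← hB, ← hD] at hdual
  set Y := Q ^ (1 + ε) with hY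
  have hY0 : 0 < Y := Real.rpow_pos_of_pos hQ _
  have hQY : Q ≤ Y := by
    calc Q = Q ^ (1 : ℝ) := (Real.rpow_one Q).symm
      _ ≤ Q ^ (1 + ε) := Real.rpow_le_rpow_of_exponent_le hQ1 (by linarith)
  -- The cells number about `R Q / A`. The hypothesis `A² ≤ Q` absorbs the extra cell from rounding
  -- up.
  have hnA : (n : ℝ) * A ^ 2 ≤ (R + 1) * (Y * A) := by
    calc (n : ℝ) * A ^ 2 ≤ (R / (A / Q) + 1) * A ^ 2 := by gcongr
      _ = R * (Q * A) + A ^ 2 := by field_simp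
      _ ≤ R * (Q * A) + Q * A := by nlinarith
      _ = (R + 1) * (Q * A) := by ring
      _ ≤ (R + 1) * (Y * A) := by gcongr
  have hnA1 : (n : ℝ) * A ≤ n * A ^ 2 := by gcongr
  have hnA0 : (n : ℝ) ≤ n * A := le_mul_of_one_le_right hnR.le hA1
  have hprimal' : ∑ m ∈ M, 1 / (L.frame (η + m * ω) Q A hQ hA).nrm (vw m).1
      ≤ 2 * (n * A) + P * (Y * A) := by
    refine hprimal.trans ?_
    have h1 : (n : ℝ) / (1 / (2 * A)) = 2 * (n * A) := by field_simp
    have h2 : (1 / (2 * A)) ^ ε ≤ 1 :=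
      Real.rpow_le_one (by positivity) (by rw [div_le_one (by positivity)]; linarith) hε.le
    have h3 : P * (1 / (2 * A)) ^ ε * Y ≤ P * 1 * (Y * A) := by
      have : Y ≤ Y * A := le_mul_of_one_le_right hY0.le hA1
      gcongr
    linarith
  have hdual' : A ^ 3 * ∑ m ∈ M, 1 / (L.frame (η + m * ω) Q A hQ hA).dual.nrm (vw m).2
      ≤ 2 * (n * A ^ 2) + D * (Y * A) := by
    refine (mul_le_mul_of_nonneg_left hdual (by positivity)).trans ?_
    have h1 : (Q / A ^ 2) ^ (1 + ε) = Y / (A ^ 2 * (A ^ 2) ^ ε) := by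
      rw [Real.div_rpow hQ.le (by positivity), Real.rpow_add (x := A ^ 2) (by positivity),
        Real.rpow_one]
    have h2 : (A / 2) ^ ε ≤ (A ^ 2) ^ ε :=
      Real.rpow_le_rpow (by positivity) (by linarith) hε.le
    have h3 : 0 < (A ^ 2) ^ ε := Real.rpow_pos_of_pos (by positivity) _
    rw [h1]
    have h4 : A ^ 3 * (n / (A / 2) + D * (A / 2) ^ ε * (Y / (A ^ 2 * (A ^ 2) ^ ε)))
        = 2 * (n * A ^ 2) + D * (Y * A) * ((A / 2) ^ ε / (A ^ 2) ^ ε) := by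
      field_simp
    rw [h4]
    -- The dual height is `Q / A²`, and its `ε`-power more than compensates for `r ^ ε`.
    have h5 : (A / 2) ^ ε / (A ^ 2) ^ ε ≤ 1 := (div_le_one h3).2 h2
    have h6 : D * (Y * A) * ((A / 2) ^ ε / (A ^ 2) ^ ε) ≤ D * (Y * A) * 1 :=
      mul_le_mul_of_nonneg_left h5 (by positivity)
    linarith
  have hmain : (S.card : ℝ) - 3 / 4 * (A ^ 2 / Q) * R * Q ^ 2
      = ∑ m ∈ M, (((T m).card : ℝ) - 3 / 4 * (A ^ 2 / Q) * ω * Q ^ 2) := by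
    rw [Finset.sum_sub_distrib, Finset.sum_const, nsmul_eq_mul, hMcard, hcard, Nat.cast_sum, ← hnω]
    ring
  rw [hmain]
  calc |∑ m ∈ M, (((T m).card : ℝ) - 3 / 4 * (A ^ 2 / Q) * ω * Q ^ 2)|
      ≤ ∑ m ∈ M, |((T m).card : ℝ) - 3 / 4 * (A ^ 2 / Q) * ω * Q ^ 2| :=
        Finset.abs_sum_le_sum_abs _ _
    _ ≤ ∑ m ∈ M, C * (1 + 1 / (L.frame (η + m * ω) Q A hQ hA).nrm (vw m).1
        + A ^ 3 / (L.frame (η + m * ω) Q A hQ hA).dual.nrm (vw m).2) :=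
        Finset.sum_le_sum fun m hm => (hvw m (Finset.mem_range.1 hm)).2.2
    _ = C * (n + ∑ m ∈ M, 1 / (L.frame (η + m * ω) Q A hQ hA).nrm (vw m).1
        + A ^ 3 * ∑ m ∈ M, 1 / (L.frame (η + m * ω) Q A hQ hA).dual.nrm (vw m).2) := by
        rw [← Finset.mul_sum, Finset.sum_add_distrib, Finset.sum_add_distrib, Finset.sum_const,
          nsmul_eq_mul, hMcard, mul_one, Finset.mul_sum (a := A ^ 3)]
        simp only [mul_one_div]
    _ ≤ C * ((5 * (R + 1) + P + D) * (Y * A)) := by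
        refine mul_le_mul_of_nonneg_left ?_ hC
        linarith
    _ = _ := by ring

end LegendrePair
-- Summation over all denominators
namespace LegendrePair

variable {Λ : ℝ}

/-- The trivial range of denominators: if `δ Q < 2` the points near the curve are counted without
a main term. -/
theorem card_le_of_mul_lt_two {L : LegendrePair Λ} {K ε η ξ Q δ : ℝ} (hε : 0 < ε) (hηξ : η < ξ)
    (hcount : ∀ e : ℕ, L.CountBound K ε e) (hK : 0 ≤ K) (hQ : 1 ≤ Q) (hδQ : δ * Q < 2)
    (S : Finset (Fin 3 → ℤ)) (hS : ∀ x, x ∈ S ↔ toReal x ∈ curvedRegion L.g 0 Q η ξ δ) :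
    (S.card : ℝ) ≤ K * (2 * (ξ - η) + 3)
      * ((2 : ℝ) ^ (1 + ε) / ((2 : ℝ) ^ (1 + ε) - 1) * Q ^ (1 + ε)) := by
  classical
  set φ : (Fin 3 → ℤ) → ℕ := fun x => Nat.log 2 (x 0).toNat with hφ
  have hfloor : ⌊Q⌋₊ ≠ 0 := (Nat.floor_pos.2 hQ).ne'
  set N := Nat.log 2 ⌊Q⌋₊ with hN
  have hNQ : (2 : ℝ) ^ N ≤ Q := by
    have h1 : 2 ^ N ≤ ⌊Q⌋₊ := Nat.pow_log_le_self 2 hfloor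
    have h2 : ((2 ^ N : ℕ) : ℝ) ≤ ⌊Q⌋₊ := by exact_mod_cast h1
    push_cast at h2
    exact h2.trans (Nat.floor_le (by linarith))
  have hmem : ∀ x ∈ S, ((x 0).toNat : ℝ) = x 0 ∧ (x 0).toNat ≠ 0 ∧ (x 0).toNat ≤ ⌊Q⌋₊ := by
    intro x hx
    rw [hS, mem_curvedRegion_iff le_rfl] at hx
    obtain ⟨h1, h2, -⟩ := hx
    rw [toReal_apply] at h1 h2
    have h3 : 0 < x 0 := by exact_mod_cast h1
    have h4 : ((x 0).toNat : ℤ) = x 0 := Int.toNat_of_nonneg h3.le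
    have h5 : ((x 0).toNat : ℝ) = x 0 := by exact_mod_cast congrArg (Int.cast : ℤ → ℝ) h4
    exact ⟨h5, by omega, Nat.le_floor (by rw [h5]; exact h2)⟩
  have hmaps : Set.MapsTo φ S (Finset.range (N + 1)) := by
    intro x hx
    have h := Nat.log_mono_right (b := 2) (hmem x hx).2.2
    simpa [hφ, Nat.lt_succ_iff] using h
  have hfiber : ∀ e : ℕ, (({x ∈ S | φ x = e} : Finset _).card : ℝ)
      ≤ K * ((2 : ℝ) ^ e) ^ (1 + ε) * (2 * (ξ - η) + 3) := by
    intro e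
    refine (hcount e).card_le_of_window (u := η) (sub_pos.2 hηξ).le _ ?_
    intro x hx
    obtain ⟨hxS, hxe⟩ := Finset.mem_filter.1 hx
    obtain ⟨h1, h2, -⟩ := hmem x hxS
    rw [hS, mem_curvedRegion_iff le_rfl] at hxS
    obtain ⟨-, h3, h4, h5, h6⟩ := hxS
    simp only [toReal_apply] at h3 h4 h5 h6
    have h7 : (2 : ℝ) ^ e ≤ x 0 := by
      rw [← h1, ← hxe]
      exact_mod_cast Nat.pow_log_le_self 2 h2
    have h8 : (x 0 : ℝ) < 2 ^ (e + 1) := by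
      rw [← h1, ← hxe]
      exact_mod_cast Nat.lt_pow_succ_log_self one_lt_two _
    refine ⟨h7, h8, ?_, ?_⟩
    · rw [abs_of_pos (by linarith)]; linarith
    -- Since `δ 2 ^ e ≤ δ Q < 2 ≤ Λ + 1`, every point meets the tolerance required by `CountBound`.
    · refine h6.le.trans ?_
      rw [le_div_iff₀ (by positivity)]
      have h0 : 0 < δ := (abs_nonneg _).trans_lt h6
      calc δ * 2 ^ e ≤ δ * Q := by gcongr; exact h7.trans h3
        _ ≤ Λ + 1 := by linarith [L.one_le]
  rw [Finset.card_eq_sum_card_fiberwise hmaps, Nat.cast_sum]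
  calc ∑ e ∈ Finset.range (N + 1), (({x ∈ S | φ x = e} : Finset _).card : ℝ)
      ≤ ∑ e ∈ Finset.range (N + 1), K * (2 * (ξ - η) + 3) * ((2 : ℝ) ^ e) ^ (1 + ε) :=
        Finset.sum_le_sum fun e _ => (hfiber e).trans_eq (by ring)
    _ = K * (2 * (ξ - η) + 3) * ∑ e ∈ Finset.range (N + 1), ((2 : ℝ) ^ e) ^ (1 + ε) :=
        (Finset.mul_sum _ _ _).symm
    _ ≤ _ := by
        refine mul_le_mul_of_nonneg_left (sum_two_pow_rpow_le (by linarith) N hNQ) ?_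
        have := sub_pos.2 hηξ
        positivity

/-- The number of lattice points near the curve, with denominators up to `Q`. -/
theorem exists_abs_card_total_sub_le (hΛ : 1 ≤ Λ) {η ξ ε : ℝ} (hηξ : η < ξ) (hε : 0 < ε) :
    ∃ C : ℝ, 0 ≤ C ∧ ∀ (L : LegendrePair Λ) (Q δ : ℝ), 0 < δ → δ ≤ 1 → 1 ≤ δ * Q →
    ∀ S : Finset (Fin 3 → ℤ), (∀ x, x ∈ S ↔ toReal x ∈ curvedRegion L.g 0 Q η ξ δ) →
    |(S.card : ℝ) - (ξ - η) * δ * Q ^ 2| ≤ C * (Q ^ (1 + ε) * √(δ * Q)) := by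
  classical
  obtain ⟨C, hC, hblock⟩ := exists_abs_card_block_sub_le hΛ hηξ hε
  obtain ⟨K, hK, hcount⟩ := exists_countBound hΛ hε
  have hR : 0 < ξ - η := sub_pos.2 hηξ
  set B := (2 : ℝ) ^ (1 + ε) / ((2 : ℝ) ^ (1 + ε) - 1) with hB
  have hB0 : 0 ≤ B := by
    have : 1 < (2 : ℝ) ^ (1 + ε) := Real.one_lt_rpow one_lt_two (by linarith)
    exact div_nonneg (by linarith) (by linarith)
  -- Halving `Q` at least halves the error bound, so `C' / 2 + C ≤ C'` closes the induction; the
  -- remaining terms pay for the base case.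
  set C' := 2 * C + K * (2 * (ξ - η) + 3) * B + 2 * (ξ - η) with hC'
  have hC'0 : 0 ≤ C' := by positivity
  refine ⟨C', hC'0, ?_⟩
  intro L Q δ hδ hδ1 hδQ S hS
  have hbase : ∀ Q : ℝ, 1 ≤ δ * Q → δ * Q < 2 → ∀ S : Finset (Fin 3 → ℤ),
      (∀ x, x ∈ S ↔ toReal x ∈ curvedRegion L.g 0 Q η ξ δ) →
      |(S.card : ℝ) - (ξ - η) * δ * Q ^ 2| ≤ C' * (Q ^ (1 + ε) * √(δ * Q)) := by
    intro Q hδQ hδQ2 S hS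
    have hQ0 : 0 < Q := pos_of_mul_pos_right (by linarith) hδ.le
    have hQ1 : 1 ≤ Q := hδQ.trans (mul_le_of_le_one_left hQ0.le hδ1)
    have h1 := card_le_of_mul_lt_two hε hηξ (fun e => hcount e L) hK hQ1 hδQ2 S hS
    have hsqrt : 1 ≤ √(δ * Q) := Real.one_le_sqrt.2 hδQ
    have hQY : Q ≤ Q ^ (1 + ε) := by
      calc Q = Q ^ (1 : ℝ) := (Real.rpow_one Q).symm
        _ ≤ Q ^ (1 + ε) := Real.rpow_le_rpow_of_exponent_le hQ1 (by linarith)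
    have h2 : (ξ - η) * δ * Q ^ 2 ≤ 2 * (ξ - η) * Q ^ (1 + ε) := by
      calc (ξ - η) * δ * Q ^ 2 = (ξ - η) * ((δ * Q) * Q) := by ring
        _ ≤ (ξ - η) * (2 * Q ^ (1 + ε)) := by gcongr
        _ = _ := by ring
    have h3 : 0 ≤ (ξ - η) * δ * Q ^ 2 := by positivity
    have h4 : (0 : ℝ) ≤ S.card := Nat.cast_nonneg _
    have h5 : (K * (2 * (ξ - η) + 3) * B + 2 * (ξ - η)) * Q ^ (1 + ε)
        ≤ C' * (Q ^ (1 + ε) * √(δ * Q)) := by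
      have : Q ^ (1 + ε) ≤ Q ^ (1 + ε) * √(δ * Q) :=
        le_mul_of_one_le_right (by positivity) hsqrt
      gcongr
      linarith
    have h6 : 0 ≤ K * (2 * (ξ - η) + 3) * (B * Q ^ (1 + ε)) := by positivity
    have h7 : 0 ≤ 2 * (ξ - η) * Q ^ (1 + ε) := by positivity
    rw [add_mul, mul_assoc _ B] at h5
    rw [abs_le]
    constructor <;> linarith
  -- `N` bounds the number of halvings of `Q` before `δ Q < 2`.
  obtain ⟨N, hN⟩ := pow_unbounded_of_one_lt (δ * Q) (one_lt_two : (1 : ℝ) < 2)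
  induction N generalizing Q S with
  | zero => rw [pow_zero] at hN; linarith
  | succ N ih =>
    rcases lt_or_ge (δ * Q) 2 with hlt | hge
    · exact hbase Q hδQ hlt S hS
    have hQ0 : 0 < Q := pos_of_mul_pos_right (by linarith) hδ.le
    set S₁ := {x ∈ S | (x 0 : ℝ) ≤ Q / 2} with hS₁
    set S₂ := {x ∈ S | ¬ (x 0 : ℝ) ≤ Q / 2} with hS₂
    have hcard : (S.card : ℝ) = S₁.card + S₂.card := by
      rw [← Nat.cast_add, hS₁, hS₂, Finset.card_filter_add_card_filter_not]
    have h1 := ih (Q / 2) (by linarith) S₁ (by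
      intro x
      rw [hS₁, Finset.mem_filter, hS, mem_curvedRegion_iff le_rfl, mem_curvedRegion_iff le_rfl]
      constructor
      · rintro ⟨⟨h1, h2, h3⟩, h4⟩; exact ⟨h1, h4, h3⟩
      · rintro ⟨h1, h2, h3⟩; exact ⟨⟨h1, h2.trans (by linarith), h3⟩, h2⟩)
      (by rw [pow_succ] at hN; linarith)
    have hA2 : √(δ * Q) ^ 2 = δ * Q := Real.sq_sqrt (by linarith)
    have hAQ : √(δ * Q) ^ 2 / Q = δ := by rw [hA2]; field_simp
    have h2 := hblock L Q (√(δ * Q)) (Real.one_le_sqrt.2 hδQ)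
      (by rw [hA2]; exact mul_le_of_le_one_left hQ0.le hδ1) S₂ (by
      intro x
      rw [hAQ, hS₂, Finset.mem_filter, hS, mem_curvedRegion_iff le_rfl,
        mem_curvedRegion_iff (by positivity), not_le]
      constructor
      · rintro ⟨⟨h1, h2, h3⟩, h4⟩; exact ⟨h4, h2, h3⟩
      · rintro ⟨h1, h2, h3⟩
        exact ⟨⟨lt_trans (by positivity) h1, h2, h3⟩, h1⟩)
    rw [hAQ] at h2
    have h3 : (Q / 2) ^ (1 + ε) * √(δ * (Q / 2)) ≤ 1 / 2 * (Q ^ (1 + ε) * √(δ * Q)) := by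
      have h4 : (Q / 2) ^ (1 + ε) ≤ 1 / 2 * Q ^ (1 + ε) := by
        rw [Real.div_rpow hQ0.le zero_le_two, div_eq_mul_one_div, mul_comm]
        have h5 : (2 : ℝ) ≤ 2 ^ (1 + ε) := by
          calc (2 : ℝ) = 2 ^ (1 : ℝ) := (Real.rpow_one 2).symm
            _ ≤ 2 ^ (1 + ε) := Real.rpow_le_rpow_of_exponent_le one_le_two (by linarith)
        gcongr
      have h5 : √(δ * (Q / 2)) ≤ √(δ * Q) := Real.sqrt_le_sqrt (by gcongr; linarith)
      rw [← mul_assoc]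
      gcongr
    have h4 : (S.card : ℝ) - (ξ - η) * δ * Q ^ 2
        = (S₁.card - (ξ - η) * δ * (Q / 2) ^ 2) + (S₂.card - 3 / 4 * δ * (ξ - η) * Q ^ 2) := by
      rw [hcard]; ring
    rw [h4]
    refine (abs_add_le _ _).trans ?_
    have h5 : C' * ((Q / 2) ^ (1 + ε) * √(δ * (Q / 2)))
        ≤ C' * (1 / 2 * (Q ^ (1 + ε) * √(δ * Q))) := mul_le_mul_of_nonneg_left h3 hC'0
    have h6 : C * (Q ^ (1 + ε) * √(δ * Q)) ≤ C' / 2 * (Q ^ (1 + ε) * √(δ * Q)) := by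
      have : C ≤ C' / 2 := by
        have h7 : 0 ≤ K * (2 * (ξ - η) + 3) * B := by positivity
        linarith
      gcongr
    linarith

end LegendrePair

/-! ### From pairs to lattice points, and from `f` to a Legendre pair -/

/-- The pairs counted by `count` correspond to the lattice points near the curve. -/
theorem exists_finset_card_eq_count {f g : ℝ → ℝ} {η ξ Q δ : ℝ}
    (hfg : ∀ x ∈ Set.Icc η ξ, g x = f x) (hδ : δ < 1 / 2) :
    ∃ S : Finset (Fin 3 → ℤ), S.card = count f η ξ Q δ ∧
      ∀ x, x ∈ S ↔ toReal x ∈ curvedRegion g 0 Q η ξ δ := by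
  classical
  set φ : ℤ × ℕ → (Fin 3 → ℤ) := fun p => ![(p.2 : ℤ), p.1, round ((p.2 : ℝ) * f (p.1 / p.2))]
    with hφ
  have hinj : Function.Injective φ := by
    rintro ⟨a, q⟩ ⟨a', q'⟩ h
    have h0 := congrFun h 0
    have h1 := congrFun h 1
    simp only [hφ, Matrix.cons_val_zero, Matrix.cons_val_one, Nat.cast_inj] at h0 h1
    rw [h0, h1]
  refine ⟨(nearPairs_finite f η ξ Q δ).toFinset.image φ, ?_, ?_⟩
  · rw [Finset.card_image_of_injective _ hinj, count,
      Set.ncard_eq_toFinset_card _ (nearPairs_finite f η ξ Q δ)]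
  intro x
  rw [LegendrePair.mem_curvedRegion_iff le_rfl, Finset.mem_image]
  simp only [Set.Finite.mem_toFinset, toReal_apply]
  constructor
  · rintro ⟨⟨a, q⟩, ⟨h1, h2, h3, h4, h5⟩, rfl⟩
    dsimp only at h1 h2 h3 h4 h5
    have hq : (0 : ℝ) < q := by exact_mod_cast h1
    have h6 : η < (a : ℝ) / q := (lt_div_iff₀ hq).2 h3
    have h7 : (a : ℝ) / q ≤ ξ := (div_le_iff₀ hq).2 h4
    simp only [hφ, Matrix.cons_val_zero, Matrix.cons_val_one, Matrix.cons_val, Int.cast_natCast]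
    refine ⟨hq, h2, h6, h7, ?_⟩
    rw [hfg _ ⟨h6.le, h7⟩, abs_sub_comm]
    exact h5
  · rintro ⟨h1, h2, h3, h4, h5⟩
    have hpos : 0 < x 0 := by exact_mod_cast h1
    have hcast : ((x 0).toNat : ℤ) = x 0 := Int.toNat_of_nonneg hpos.le
    have hcastR : ((x 0).toNat : ℝ) = x 0 := by exact_mod_cast congrArg (Int.cast : ℤ → ℝ) hcast
    rw [hfg _ ⟨h3.le, h4⟩, abs_sub_comm] at h5
    refine ⟨(x 1, (x 0).toNat), ⟨?_, ?_, ?_, ?_, ?_⟩, ?_⟩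
    · dsimp only; omega
    · dsimp only; rw [hcastR]; exact h2
    · dsimp only; rw [hcastR]; exact (lt_div_iff₀ h1).1 h3
    · dsimp only; rw [hcastR]; exact (div_le_iff₀ h1).1 h4
    · dsimp only; rw [hcastR]; exact (round_le _ _).trans_lt h5
    -- Both integers are within `δ < 1 / 2` of the same real number, so they coincide.
    · have hround : round ((x 0 : ℝ) * f (x 1 / x 0)) = x 2 := by
        have h6 := (round_le ((x 0 : ℝ) * f (x 1 / x 0)) (x 2)).trans_lt h5
        have h7 := abs_lt.1 h5
        have h8 := abs_lt.1 h6
        have h9 : ((x 2 : ℤ) : ℝ) < round ((x 0 : ℝ) * f (x 1 / x 0)) + 1 := by linarith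
        have h10 : ((round ((x 0 : ℝ) * f (x 1 / x 0)) : ℤ) : ℝ) < x 2 + 1 := by linarith
        have h9' : x 2 < round ((x 0 : ℝ) * f (x 1 / x 0)) + 1 := by exact_mod_cast h9
        have h10' : round ((x 0 : ℝ) * f (x 1 / x 0)) < x 2 + 1 := by exact_mod_cast h10
        omega
      funext i
      fin_cases i
      · simp [hφ, hcast]
      · simp [hφ]
      · simp only [hφ, hcastR]
        exact hround


/-- A primitive of a bi-Lipschitz monotone function of the line, together with its Legendre
transform. -/
theorem LegendrePair.exists_of_biLipschitz {Λ σ η b : ℝ} {p : ℝ → ℝ} (hΛ : 1 ≤ Λ)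
    (hσ : σ = 1 ∨ σ = -1) (hlow : ∀ x y, x ≤ y → y - x ≤ Λ * (σ * (p y - p x)))
    (hup : ∀ x y, x ≤ y → σ * (p y - p x) ≤ Λ * (y - x)) :
    ∃ L : LegendrePair (Λ ^ 3), ∀ x, L.g x = b + ∫ t in η..x, p t := by
  have hΛ0 : 0 < Λ := by linarith
  have hσσ : σ * σ = 1 := by rcases hσ with rfl | rfl <;> norm_num
  have hσabs : |σ| = 1 := by rcases hσ with rfl | rfl <;> norm_num
  have hΛ1 : Λ ≤ Λ ^ 3 := le_self_pow₀ hΛ (by norm_num)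
  have hmono : StrictMono fun x => σ * p x := by
    intro x y hxy
    have h1 := hlow x y hxy.le
    have h2 : 0 < σ * (p y - p x) := pos_of_mul_pos_right (by linarith) hΛ0.le
    change σ * p x < σ * p y
    linarith
  have habs : ∀ x y, x ≤ y → |p y - p x| = σ * (p y - p x) := by
    intro x y hxy
    have h1 : 0 ≤ σ * (p y - p x) := by
      have := hmono.monotone hxy
      change σ * p x ≤ σ * p y at this
      linarith
    rw [← abs_of_nonneg h1, abs_mul, hσabs, one_mul]
  have hlip : ∀ x y, |p x - p y| ≤ Λ * |x - y| := by
    intro x y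
    rcases le_total x y with h | h
    · rw [abs_sub_comm (p x), abs_sub_comm x, habs x y h, abs_of_nonneg (sub_nonneg.2 h)]
      exact hup x y h
    · rw [habs y x h, abs_of_nonneg (sub_nonneg.2 h)]
      exact hup y x h
  have hinv : ∀ x y, |x - y| ≤ Λ * |p x - p y| := by
    intro x y
    rcases le_total x y with h | h
    · rw [abs_sub_comm (p x), abs_sub_comm x, habs x y h, abs_of_nonneg (sub_nonneg.2 h)]
      exact hlow x y h
    · rw [habs y x h, abs_of_nonneg (sub_nonneg.2 h)]
      exact hlow y x h
  have hcont : Continuous p := by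
    have : LipschitzWith ⟨Λ, hΛ0.le⟩ p := by
      refine LipschitzWith.of_dist_le_mul fun x y => ?_
      rw [Real.dist_eq, Real.dist_eq]
      exact hlip x y
    exact this.continuous
  have hsurj : Function.Surjective fun x => σ * p x := by
    refine (continuous_const.mul hcont).surjective ?_ ?_
    · have h1 : Filter.Tendsto (fun x : ℝ => σ * p 0 + x / Λ) Filter.atTop Filter.atTop :=
        Filter.tendsto_atTop_add_const_left _ _ (Filter.tendsto_id.atTop_div_const hΛ0)
      refine Filter.tendsto_atTop_mono' _ ?_ h1
      filter_upwards [Filter.eventually_ge_atTop (0 : ℝ)] with x hx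
      have h2 := hlow 0 x hx
      have h3 : x / Λ ≤ σ * (p x - p 0) := by rw [div_le_iff₀' hΛ0]; linarith
      change σ * p 0 + x / Λ ≤ σ * p x
      linarith
    · have h1 : Filter.Tendsto (fun x : ℝ => σ * p 0 + x / Λ) Filter.atBot Filter.atBot :=
        Filter.tendsto_atBot_add_const_left _ _ (Filter.tendsto_id.atBot_div_const hΛ0)
      refine Filter.tendsto_atBot_mono' _ ?_ h1
      filter_upwards [Filter.eventually_le_atBot (0 : ℝ)] with x hx
      have h2 := hlow x 0 hx
      have h3 : σ * (p x - p 0) ≤ x / Λ := by rw [le_div_iff₀' hΛ0]; linarith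
      change σ * p x ≤ σ * p 0 + x / Λ
      linarith
  -- The sign `σ` makes `p` increasing; its inverse is read off from the order isomorphism `σ p`.
  set E := hmono.orderIsoOfSurjective _ hsurj with hE
  have hEapp : ∀ x, E x = σ * p x := fun x => rfl
  set s : ℝ → ℝ := fun y => E.symm (σ * y) with hs
  have hsp : ∀ x, s (p x) = x := fun x => by
    rw [hs]; dsimp only; rw [← hEapp, E.symm_apply_apply]
  have hps : ∀ y, p (s y) = y := fun y => by
    have h1 : σ * p (s y) = σ * y := by rw [← hEapp, hs]; dsimp only; rw [E.apply_symm_apply]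
    calc p (s y) = σ * σ * p (s y) := by rw [hσσ, one_mul]
      _ = σ * (σ * p (s y)) := by ring
      _ = σ * σ * y := by rw [h1]; ring
      _ = y := by rw [hσσ, one_mul]
  set g : ℝ → ℝ := fun x => b + ∫ t in η..x, p t with hg
  have hint : ∀ x y, IntervalIntegrable p volume x y := fun x y => hcont.intervalIntegrable x y
  have htaylor : ∀ x y, |g y - g x - p x * (y - x)| ≤ Λ * (y - x) ^ 2 := by
    intro x y
    have h1 : g y - g x - p x * (y - x) = ∫ t in x..y, (p t - p x) := by
      rw [intervalIntegral.integral_sub (hint x y) intervalIntegrable_const,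
        intervalIntegral.integral_const, smul_eq_mul,
        ← intervalIntegral.integral_interval_sub_left (hint η y) (hint η x)]
      simp only [hg]; ring
    rw [h1, ← Real.norm_eq_abs]
    refine (intervalIntegral.norm_integral_le_of_norm_le_const (C := Λ * |y - x|) ?_).trans_eq ?_
    · intro t ht
      refine (hlip t x).trans (mul_le_mul_of_nonneg_left ?_ hΛ0.le)
      exact Set.abs_sub_left_of_mem_uIcc (Set.uIoc_subset_uIcc ht)
    · rw [mul_assoc, abs_mul_abs_self, sq]
  have hs_lip : ∀ x y, |s x - s y| ≤ Λ * |x - y| := fun x y => by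
    have := hinv (s x) (s y)
    rwa [hps, hps] at this
  refine ⟨{ g := g, p := p, h := fun y => y * s y - g (s y), s := s, one_le := hΛ.trans hΛ1,
            s_p := hsp, p_s := hps, legendre := ?_, p_lip := ?_, s_lip := ?_, g_taylor := ?_,
            h_taylor := ?_ }, fun x => rfl⟩
  · intro x
    rw [hsp]; ring
  · exact fun x y => (hlip x y).trans (by gcongr)
  · exact fun x y => (hs_lip x y).trans (by gcongr)
  · exact fun x y => (htaylor x y).trans (by gcongr)
  · intro x y
    -- The remainder of the transform at `x` is a remainder of `g` based at `s y`. The Lipschitz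
    -- constant of `s`, squared, raises `Λ` to `Λ ^ 3`.
    have h1 : y * s y - g (s y) - (x * s x - g (s x)) - s x * (y - x)
        = g (s x) - g (s y) - p (s y) * (s x - s y) := by rw [hps]; ring
    rw [h1]
    refine (htaylor (s y) (s x)).trans ?_
    have h2 : (s x - s y) ^ 2 ≤ (Λ * |x - y|) ^ 2 := by
      rw [← sq_abs]; gcongr; exact hs_lip x y
    calc Λ * (s x - s y) ^ 2 ≤ Λ * (Λ * |x - y|) ^ 2 := by gcongr
      _ = Λ ^ 3 * (y - x) ^ 2 := by rw [mul_pow, sq_abs]; ring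

theorem forall_le_or_forall_le_neg {F : ℝ → ℝ} {η ξ m : ℝ} (hm : 0 < m)
    (hF : ContinuousOn F (Set.Icc η ξ)) (h : ∀ x ∈ Set.Icc η ξ, m ≤ |F x|) :
    (∀ x ∈ Set.Icc η ξ, m ≤ F x) ∨ ∀ x ∈ Set.Icc η ξ, m ≤ -F x := by
  by_contra! hcon
  obtain ⟨⟨x, hx, hx1⟩, y, hy, hy1⟩ := hcon
  have hx2 : F x ≤ 0 := by
    rcases le_abs.1 (h x hx) with h1 | h1 <;> linarith
  have hy2 : 0 ≤ F y := by
    rcases le_abs.1 (h y hy) with h1 | h1 <;> linarith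
  obtain ⟨z, hz, hz0⟩ := isPreconnected_Icc.intermediate_value hx hy hF ⟨hx2, hy2⟩
  have := h z hz
  rw [hz0, abs_zero] at this
  linarith

/-- A function with continuous and nonvanishing second derivative on `[η, ξ]` extends to a function
of the line which has a Legendre transform. -/
theorem exists_legendrePair {η ξ : ℝ} (hηξ : η < ξ) {f : ℝ → ℝ}
    (hf : ContDiffOn ℝ 2 f (Set.Icc η ξ))
    (hf0 : ∃ m : ℝ, 0 < m ∧ ∀ x ∈ Set.Icc η ξ, m ≤ |secondDeriv f η ξ x|) :
    ∃ (Λ : ℝ) (L : LegendrePair Λ), ∀ x ∈ Set.Icc η ξ, L.g x = f x := by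
  obtain ⟨m, hm, hfm⟩ := hf0
  set I := Set.Icc η ξ with hI
  have hu : UniqueDiffOn ℝ I := uniqueDiffOn_Icc hηξ
  set f₁ := derivWithin f I with hf₁
  have hcont₁ : ContinuousOn f₁ I := hf.continuousOn_derivWithin hu (by norm_num)
  have hcont₂ : ContinuousOn (secondDeriv f η ξ) I :=
    hf.continuousOn_iteratedDerivWithin (m := 2) (by norm_num) hu
  have hderiv₁ : ∀ x ∈ Set.Ioo η ξ, HasDerivAt f (f₁ x) x := fun x hx =>
    ((hf.differentiableOn (by norm_num)) x ⟨hx.1.le, hx.2.le⟩).hasDerivWithinAt.hasDerivAt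
      (Icc_mem_nhds hx.1 hx.2)
  have hderiv₂ : ∀ x ∈ Set.Ioo η ξ, HasDerivAt f₁ (secondDeriv f η ξ x) x := fun x hx => by
    have h1 := hf.differentiableOn_iteratedDerivWithin (m := 1) (by norm_num) hu
    rw [iteratedDerivWithin_one] at h1
    have h2 := ((h1 x ⟨hx.1.le, hx.2.le⟩).hasDerivWithinAt).hasDerivAt (Icc_mem_nhds hx.1 hx.2)
    have h3 : secondDeriv f η ξ = derivWithin f₁ I := by
      rw [secondDeriv, iteratedDerivWithin_succ, iteratedDerivWithin_one]
    rwa [h3]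
  obtain ⟨M, hM⟩ := isCompact_Icc.exists_bound_of_continuousOn hcont₂
  obtain ⟨σ, hσ, hσm⟩ : ∃ σ : ℝ, (σ = 1 ∨ σ = -1) ∧
      ∀ x ∈ I, m ≤ σ * secondDeriv f η ξ x := by
    rcases forall_le_or_forall_le_neg hm hcont₂ hfm with h | h
    · exact ⟨1, Or.inl rfl, fun x hx => by rw [one_mul]; exact h x hx⟩
    · exact ⟨-1, Or.inr rfl, fun x hx => by rw [neg_one_mul]; exact h x hx⟩
  have hσσ : σ * σ = 1 := by rcases hσ with rfl | rfl <;> norm_num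
  have hσM : ∀ x ∈ I, σ * secondDeriv f η ξ x ≤ M := by
    intro x hx
    refine (le_abs_self _).trans ?_
    rw [abs_mul, (by rcases hσ with rfl | rfl <;> norm_num : |σ| = 1), one_mul]
    exact hM x hx
  set Λ := max 1 (max M (1 / m)) with hΛ
  have hΛ1 : 1 ≤ Λ := le_max_left _ _
  have hΛM : M ≤ Λ := (le_max_left _ _).trans (le_max_right _ _)
  have hΛm : 1 ≤ Λ * m := by
    have : 1 / m ≤ Λ := (le_max_right _ _).trans (le_max_right _ _)
    rwa [div_le_iff₀ hm] at this
  have hmvt : ∀ u ∈ I, ∀ v ∈ I, u ≤ v →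
      v - u ≤ Λ * (σ * (f₁ v - f₁ u)) ∧ σ * (f₁ v - f₁ u) ≤ Λ * (v - u) := by
    intro u hu v hv huv
    rcases huv.eq_or_lt with rfl | hlt
    · simp
    have hsub : Set.Icc u v ⊆ I := Set.Icc_subset_Icc hu.1 hv.2
    obtain ⟨z, hz, hzeq⟩ := exists_hasDerivAt_eq_slope f₁ (secondDeriv f η ξ) hlt
      (hcont₁.mono hsub)
      (fun x hx => hderiv₂ x ⟨hu.1.trans_lt hx.1, hx.2.trans_le hv.2⟩)
    have hzI : z ∈ I := hsub ⟨hz.1.le, hz.2.le⟩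
    have hvu : 0 < v - u := sub_pos.2 hlt
    have h1 : σ * (f₁ v - f₁ u) = σ * secondDeriv f η ξ z * (v - u) := by
      rw [hzeq]; field_simp
    rw [h1]
    constructor
    · calc v - u = 1 * (v - u) := (one_mul _).symm
        _ ≤ Λ * m * (v - u) := by gcongr
        _ ≤ Λ * (σ * secondDeriv f η ξ z) * (v - u) := by gcongr; exact hσm z hzI
        _ = _ := by ring
    · exact mul_le_mul_of_nonneg_right ((hσM z hzI).trans hΛM) hvu.le
  set κ : ℝ → ℝ := fun x => max η (min ξ x) with hκ
  have hκI : ∀ x, κ x ∈ I := fun x =>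
    ⟨le_max_left _ _, max_le hηξ.le (min_le_left _ _)⟩
  have hκmono : ∀ x y, x ≤ y → κ x ≤ κ y := fun x y hxy =>
    max_le_max le_rfl (min_le_min le_rfl hxy)
  have hκsub : ∀ x y, x ≤ y → κ y - κ x ≤ y - x := by
    intro x y hxy
    simp only [hκ]
    rcases le_total ξ x with h1 | h1 <;> rcases le_total ξ y with h2 | h2 <;>
      rcases le_total η x with h3 | h3 <;> rcases le_total η y with h4 | h4 <;>
      simp [h1, h2, h3, h4, hηξ.le, hxy] <;> linarith
  have hκid : ∀ x ∈ I, κ x = x := by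
    intro x hx
    simp only [hκ]
    rw [min_eq_right hx.2, max_eq_right hx.1]
  -- `f'` is continued beyond the endpoints with slope `σ`, the sign of `f''`. This preserves the
  -- bi-Lipschitz bounds because `1 ≤ Λ`.
  set p : ℝ → ℝ := fun x => f₁ (κ x) + σ * (x - κ x) with hp
  have hpdiff : ∀ x y, σ * (p y - p x) = σ * (f₁ (κ y) - f₁ (κ x)) + ((y - x) - (κ y - κ x)) := by
    intro x y
    have : σ * (p y - p x)
        = σ * (f₁ (κ y) - f₁ (κ x)) + σ * σ * ((y - x) - (κ y - κ x)) := by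
      simp only [hp]; ring
    rw [this, hσσ, one_mul]
  obtain ⟨L, hL⟩ := LegendrePair.exists_of_biLipschitz (η := η) (b := f η) (p := p) hΛ1 hσ
    (fun x y hxy => by
      have h1 := (hmvt _ (hκI x) _ (hκI y) (hκmono x y hxy)).1
      have h2 : (y - x) - (κ y - κ x) ≤ Λ * ((y - x) - (κ y - κ x)) :=
        le_mul_of_one_le_left (sub_nonneg.2 (hκsub x y hxy)) hΛ1
      rw [hpdiff, mul_add]
      linarith)
    (fun x y hxy => by
      have h1 := (hmvt _ (hκI x) _ (hκI y) (hκmono x y hxy)).2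
      have h2 : (y - x) - (κ y - κ x) ≤ Λ * ((y - x) - (κ y - κ x)) :=
        le_mul_of_one_le_left (sub_nonneg.2 (hκsub x y hxy)) hΛ1
      rw [hpdiff]
      linarith)
  refine ⟨_, L, fun x hx => ?_⟩
  have hpf : Set.EqOn p f₁ I := fun t ht => by
    simp only [hp]; rw [hκid t ht, sub_self, mul_zero, add_zero]
  have hsub : Set.Icc η x ⊆ I := Set.Icc_subset_Icc_right hx.2
  have h1 : ∫ t in η..x, p t = f x - f η := by
    refine intervalIntegral.integral_eq_sub_of_hasDerivAt_of_le hx.1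
      (hf.continuousOn.mono hsub) (fun t ht => ?_) ?_
    · rw [hpf (hsub ⟨ht.1.le, ht.2.le⟩)]
      exact hderiv₁ t ⟨ht.1, ht.2.trans_le hx.2⟩
    · refine ContinuousOn.intervalIntegrable_of_Icc hx.1 ?_
      exact (hcont₁.mono hsub).congr fun t ht => hpf (hsub ht)
  rw [hL, h1]
  ring


/-! ### Comparison with the claimed bounds -/

/-- The error term is `O(Q ^ (3 / 2 + ε) δ ^ (1 / 2))`. -/
theorem exists_abs_errorTerm_le {η ξ : ℝ} (hηξ : η < ξ) {f : ℝ → ℝ}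
    (hf : ContDiffOn ℝ 2 f (Set.Icc η ξ))
    (hf0 : ∃ m : ℝ, 0 < m ∧ ∀ x ∈ Set.Icc η ξ, m ≤ |secondDeriv f η ξ x|) {ε : ℝ} (hε : 0 < ε) :
    ∃ C : ℝ, 0 ≤ C ∧ ∀ Q δ : ℝ, 0 < δ → δ < 1 / 2 → 1 ≤ δ * Q →
      |errorTerm f η ξ Q δ| ≤ C * (Q ^ (1 + ε) * √(δ * Q)) := by
  obtain ⟨Λ, L, hL⟩ := exists_legendrePair hηξ hf hf0
  obtain ⟨C, hC, h⟩ := LegendrePair.exists_abs_card_total_sub_le L.one_le hηξ hε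
  refine ⟨C, hC, fun Q δ hδ hδ2 hδQ => ?_⟩
  obtain ⟨S, hcard, hS⟩ := exists_finset_card_eq_count (Q := Q) hL hδ2
  have := h L Q δ hδ (by linarith) hδQ S hS
  rwa [hcard] at this

/-- The power part of the target is Q (δQ)^(2/3), larger than Q (δQ)^(1/2) by (δQ)^(1/6), which
absorbs Q^ε. The logarithm is bounded below since `2 ≤ Q`. -/
theorem rpow_mul_sqrt_le_of_rpow_le {Q δ e₀ ε : ℝ} (hQ : 2 ≤ Q) (hδ : 0 < δ)
    (h : Q ^ e₀ ≤ δ * Q) (hε : ε ≤ e₀ / 6) :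
    Q ^ (1 + ε) * √(δ * Q) ≤ 1 / Real.log 2 ^ ((2 : ℝ) / 3) *
      (δ ^ ((2 : ℝ) / 3) * Q ^ ((5 : ℝ) / 3) * Real.log Q ^ ((2 : ℝ) / 3)) := by
  have hQ0 : 0 < Q := by linarith
  have hT : 0 < δ * Q := mul_pos hδ hQ0
  have hlog2 : 0 < Real.log 2 := Real.log_pos one_lt_two
  have hlog : Real.log 2 ^ ((2 : ℝ) / 3) ≤ Real.log Q ^ ((2 : ℝ) / 3) :=
    Real.rpow_le_rpow hlog2.le (Real.log_le_log two_pos hQ) (by norm_num)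
  have hl0 : 0 < Real.log 2 ^ ((2 : ℝ) / 3) := Real.rpow_pos_of_pos hlog2 _
  have h1 : Q ^ ε ≤ (δ * Q) ^ ((1 : ℝ) / 6) := by
    calc Q ^ ε ≤ Q ^ (e₀ * (1 / 6)) :=
          Real.rpow_le_rpow_of_exponent_le (by linarith) (by linarith)
      _ = (Q ^ e₀) ^ ((1 : ℝ) / 6) := Real.rpow_mul hQ0.le _ _
      _ ≤ _ := Real.rpow_le_rpow (by positivity) h (by norm_num)
  calc Q ^ (1 + ε) * √(δ * Q) = Q * Q ^ ε * (δ * Q) ^ ((1 : ℝ) / 2) := by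
        rw [Real.rpow_add hQ0, Real.rpow_one, Real.sqrt_eq_rpow]
    _ ≤ Q * (δ * Q) ^ ((1 : ℝ) / 6) * (δ * Q) ^ ((1 : ℝ) / 2) := by gcongr
    _ = Q * (δ * Q) ^ ((2 : ℝ) / 3) := by
        rw [mul_assoc, ← Real.rpow_add hT]; norm_num
    _ = δ ^ ((2 : ℝ) / 3) * Q ^ ((5 : ℝ) / 3) := by
        rw [Real.mul_rpow hδ.le hQ0.le, (by norm_num : (5 : ℝ) / 3 = 1 + 2 / 3),
          Real.rpow_add hQ0, Real.rpow_one]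
        ring
    _ = 1 / Real.log 2 ^ ((2 : ℝ) / 3) *
        (δ ^ ((2 : ℝ) / 3) * Q ^ ((5 : ℝ) / 3) * Real.log 2 ^ ((2 : ℝ) / 3)) := by
        field_simp
    _ ≤ _ := by gcongr

theorem rpow_mul_sqrt_le_of_le_one {Q δ a b ε : ℝ} (hQ : 1 ≤ Q) (hδ : 0 < δ) (hδ1 : δ ≤ 1)
    (ha : a ≤ 1 / 2) (hb : 3 / 2 + ε ≤ b) : Q ^ (1 + ε) * √(δ * Q) ≤ δ ^ a * Q ^ b := by
  have hQ0 : 0 < Q := by linarith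
  calc Q ^ (1 + ε) * √(δ * Q) = δ ^ ((1 : ℝ) / 2) * (Q ^ (1 + ε) * Q ^ ((1 : ℝ) / 2)) := by
        rw [Real.sqrt_eq_rpow, Real.mul_rpow hδ.le hQ0.le]; ring
    _ = δ ^ ((1 : ℝ) / 2) * Q ^ (3 / 2 + ε) := by
        rw [← Real.rpow_add hQ0]; congr 2; ring
    _ ≤ δ ^ a * Q ^ b :=
        mul_le_mul (Real.rpow_le_rpow_of_exponent_ge hδ hδ1 ha)
          (Real.rpow_le_rpow_of_exponent_le hQ hb) (by positivity) (by positivity)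

end RatNearCurve

theorem theorem2 (η ξ : ℝ) (hηξ : η < ξ) (f : ℝ → ℝ)
    (hf : ContDiffOn ℝ 2 f (Set.Icc η ξ))
    (hf0 : ∃ m : ℝ, 0 < m ∧ ∀ x ∈ Set.Icc η ξ, m ≤ |RatNearCurve.secondDeriv f η ξ x|)
    (θ : ℝ) (hθ0 : 0 < θ) (hθ1 : θ < 1)
    (hLip : RatNearCurve.LipClass θ (RatNearCurve.secondDeriv f η ξ) (Set.Icc η ξ))
    (ε : ℝ) (hε : 0 < ε) (c : ℝ) (hc : 0 < c) :
    ∃ C : ℝ, 0 < C ∧ ∀ Q δ : ℝ, 1 ≤ Q →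
      Q ^ (-((1 + θ) / (3 - θ)) + ε) ≤ δ → δ < 1 / 2 →
      (c * RatNearCurve.threshold θ Q ≤ δ →
        |RatNearCurve.errorTerm f η ξ Q δ| ≤
          C * (δ ^ ((2 : ℝ) / 3) * Q ^ ((5 : ℝ) / 3) * Real.log Q ^ ((2 : ℝ) / 3))) ∧
      (δ ≤ c * RatNearCurve.threshold θ Q →
        |RatNearCurve.errorTerm f η ξ Q δ| ≤
          C * (δ ^ (2 / (5 - θ)) * Q ^ (3 * (3 - θ) / (5 - θ)))) := by
  set β := (1 + θ) / (3 - θ) with hβ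
  have hβ1 : β < 1 := by rw [hβ, div_lt_one (by linarith)]; linarith
  have h5 : 0 < 5 - θ := by linarith
  set b := 3 * (3 - θ) / (5 - θ) with hb
  have hb' : 3 / 2 < b := by rw [hb, lt_div_iff₀ h5]; linarith
  -- The first entry is one sixth of the exponent of `Q` bounding `δ Q` from below, for the first
  -- estimate; the second is the room left by `b > 3 / 2`, which is where `θ < 1` enters.
  set ε' := min ((1 - β + ε) / 6) (b - 3 / 2) with hε'
  have hε'0 : 0 < ε' := lt_min (by linarith) (by linarith)
  obtain ⟨C, hC, h⟩ := RatNearCurve.exists_abs_errorTerm_le hηξ hf hf0 hε'0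
  have hlog2 : 0 < Real.log 2 := Real.log_pos one_lt_two
  set D := 1 / Real.log 2 ^ ((2 : ℝ) / 3) with hD
  have hD0 : 0 < D := by positivity
  refine ⟨C * D + C + 1, by positivity, ?_⟩
  intro Q δ hQ hδ hδ2
  have hQ0 : 0 < Q := by linarith
  have hδ0 : 0 < δ := (Real.rpow_pos_of_pos hQ0 _).trans_le hδ
  -- The range of `δ` is nonempty only if `1 / Q < 1 / 2`.
  have hQ2 : 2 ≤ Q := by
    have h1 : Q ^ (-1 : ℝ) ≤ δ :=
      (Real.rpow_le_rpow_of_exponent_le hQ (by linarith)).trans hδ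
    rw [Real.rpow_neg_one] at h1
    have h2 : Q * Q⁻¹ = 1 := mul_inv_cancel₀ hQ0.ne'
    nlinarith
  have hδQ : Q ^ (1 - β + ε) ≤ δ * Q := by
    calc Q ^ (1 - β + ε) = Q ^ (-β + ε) * Q := by
          rw [← Real.rpow_add_one hQ0.ne']; congr 1; ring
      _ ≤ δ * Q := by gcongr
  have hδQ1 : 1 ≤ δ * Q := (Real.one_le_rpow hQ (by linarith)).trans hδQ
  have hmain := h Q δ hδ0 hδ2 hδQ1
  have hlog : 0 ≤ Real.log Q := Real.log_nonneg hQ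
  constructor
  · intro _
    have h1 := RatNearCurve.rpow_mul_sqrt_le_of_rpow_le hQ2 hδ0 hδQ (min_le_left _ _ : ε' ≤ _)
    rw [← hD] at h1
    refine hmain.trans ((mul_le_mul_of_nonneg_left h1 hC).trans ?_)
    rw [← mul_assoc]
    gcongr
    linarith
  · intro _
    have h1 := RatNearCurve.rpow_mul_sqrt_le_of_le_one (a := 2 / (5 - θ)) (b := b) (ε := ε') hQ hδ0
      (by linarith) (by rw [div_le_div_iff₀ h5 two_pos]; linarith)
      (by linarith [min_le_right ((1 - β + ε) / 6) (b - 3 / 2)])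
    refine hmain.trans ((mul_le_mul_of_nonneg_left h1 hC).trans ?_)
    gcongr
    have : 0 ≤ C * D := by positivity
    linarith
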